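/- **Setting.** Let $A=\sqrt{-\Delta}$ on $\mathbb R^3$, $\langle A\rangle=(1+A^2)^{1/2}$, let $\|\cdot\|$ be the norm of $L^2=L^2(\mathbb R^3,\mathbb R^3)$, and for $s\ge 0$ let $H^s$ be the Sobolev space of $\mathbb R^3$-valued fields with norm $\|f\|_{H^s}=\|\langle A\rangle^s f\|$. Fix a real $3\times 3$ matrix $M$ and an orthogonal projection $P$ on $L^2$ which is fibered in Fourier space, i.e. $\widehat{Pf}(\xi)=P(\xi)\hat f(\xi)$ (for instance the Leray projection, or $P=I$). Let $r\ge 1/2$, $0<T<\infty$, $I=\,]0,T]$, $\bar I=[0,T]$. The class $\mathcal S_{r,I}$ of *strong solutions* of $\partial_t u+P(Mu\cdot\nabla)u-\Delta u=0$, $u(t)\in\operatorname{Ran}P$, consists of all $u\in C(\bar I,H^r)$ such that 1. $u(t)\in PH^r$ for all $t\in\bar I$; 2. $A^{5/4}u\in C(I,L^2)$, $|u|:=\sup_{t\in I}t^{3/8}\|A^{5/4}u(t)\|<\infty$, and $t^{3/8}\|A^{5/4}u(t)\|\to0$ as $t\to0$; 3. $u\in C^1(I,\mathcal S'(\mathbb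 R^3))$ (weak* topology) and $\frac{d}{dt}u=-A^2u-P(Mu\cdot\nabla)u$ on $I$ in the sense of distributions. (At the end point $T$ derivatives in $t$ are one-sided.) **Theorem.** Let $u\in\mathcal S_{r,I}$ and $u_0=u(0)$. (a) There exist $\delta=\delta(u,r)>0$ and $C=C(u,T,r)>0$ such that $$\|e^{\min(\sqrt t,\delta)A}u(t)\|_{H^{1/2}}\le C\quad\text{for all }t\in I,$$ and, with the same $\delta$ and $C$, for all $\bar r\ge 1/2$ and with $\tilde C=C\max_{x\ge0}x^{\bar r-1/2}e^{-x}$, $$\|A^{\bar r}u(t)\|\le\tilde C\,\min(\sqrt t,\delta)^{-(\bar r-1/2)}\quad\text{for all }t\in I.$$ If $r>1/2$, then ($M$, $P$ and $r$ being fixed) $\delta$ can be chosen to depend only on $|u|$ and $\|u_0\|_{H^r}$, and $C$ only on $T$, $|u|$, $\sup_{t\in I}\|u(t)\|_{H^{1/2}}$ and $\|u_0\|_{H^r}$. (b) $u\in C^k(I,H^{\bar r})$ for all $k\in\mathbb N\cup\{0\}$ and all $\bar r\ge1/2$. (c) Writing $u(t)(x)=u(t,x)$, one has $u\in C^\infty(I\times\mathbb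 R^3)$ (after modification of each $u(t)$ on a null set). (d) If in addition $\nabla\cdot(Mu(t))=0$ for all $t\in I$, then $$\|u(t)\|^2=\|u_0\|^2-2\int_0^t\|Au(s)\|^2\,ds\quad\text{for all }t\in I,$$ the integral being convergent; in particular $\|u(t)\|\le\|u_0\|$ for all $t\in I$. -/

import Mathlib

open MeasureTheory Set Filter Topology
open scoped FourierTransform SchwartzMap ENNReal ContDiff Laplacian InnerProductSpace

noncomputable section

namespace StrongNS

/-- Physical space `ℝ³`, also the space of values of real vector fields. -/
abbrev R3 : Type := EuclideanSpace ℝ (Fin 3)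

/-- `ℂ³` with its Hermitian norm. -/
abbrev C3 : Type := EuclideanSpace ℂ (Fin 3)

/-- The real Hilbert space `L²(ℝ³, ℝ³)`. -/
abbrev L2 : Type := Lp R3 2 (volume : Measure R3)

/-- The inclusion `ℝ³ → ℂ³`. -/
def complexify : R3 →L[ℝ] C3 :=
  LinearMap.toContinuousLinearMap
    { toFun := fun x => WithLp.toLp 2 (fun i => ((x i : ℝ) : ℂ))
      map_add' := fun x y => by ext i; simp
      map_smul' := fun c x => by ext i; simp }

/-- The Fourier transform of a real `L²` vector field, normalised as
`∫ exp (-2πi⟪x, ξ⟫) f x dx`. With this normalisation `-i∇` is multiplication by `2πξ`. -/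
def hat (f : L2) : Lp C3 2 (volume : Measure R3) :=
  𝓕 (complexify.compLp f)

/-- `g = w(D) f`: the field `f` is in the domain of the Fourier multiplier with symbol `w`, and
`g ∈ L²` is the result of applying it. -/
def IsMultiplier (w : R3 → ℂ) (f g : L2) : Prop :=
  ∀ᵐ ξ : R3, hat g ξ = w ξ • hat f ξ

/-- The `L²` norm of `w(D) f`, by Plancherel. It is `∞` if `f` is not in the domain. -/
def multNorm (w : R3 → ℂ) (f : L2) : ℝ≥0∞ :=
  eLpNorm (fun ξ => w ξ • hat f ξ) 2 (volume : Measure R3)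

/-- Symbol of `A ^ s`, where `A = √(-Δ)`. -/
def symA (s : ℝ) (ξ : R3) : ℂ := (((2 * Real.pi * ‖ξ‖) ^ s : ℝ) : ℂ)

/-- Symbol of `⟨A⟩ ^ s = (1 - Δ) ^ (s / 2)`. -/
def symBessel (s : ℝ) (ξ : R3) : ℂ := (((1 + (2 * Real.pi * ‖ξ‖) ^ 2) ^ (s / 2) : ℝ) : ℂ)

/-- Symbol of `exp (θ A)`. -/
def symExp (θ : ℝ) (ξ : R3) : ℂ := ((Real.exp (θ * (2 * Real.pi * ‖ξ‖)) : ℝ) : ℂ)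

/-- Symbol of the partial derivative `∂ⱼ`. -/
def symD (j : Fin 3) (ξ : R3) : ℂ := 2 * (Real.pi : ℂ) * Complex.I * ((ξ j : ℝ) : ℂ)

/-- `‖A ^ s f‖` in `L²`. -/
def normA (s : ℝ) (f : L2) : ℝ≥0∞ := multNorm (symA s) f

/-- `‖f‖` in `H^s`, that is, `‖⟨A⟩ ^ s f‖` in `L²`. -/
def normH (s : ℝ) (f : L2) : ℝ≥0∞ := multNorm (symBessel s) f

/-- `‖exp (θ A) f‖` in `H^s`. -/
def normExpH (θ s : ℝ) (f : L2) : ℝ≥0∞ := multNorm (fun ξ => symExp θ ξ * symBessel s ξ) f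

/-- `w(D) u` is defined on `J` and belongs to `C^k(J, L²)`. -/
def MultContDiffOn (k : ℕ) (w : R3 → ℂ) (J : Set ℝ) (u : ℝ → L2) : Prop :=
  ∃ v : ℝ → L2, (∀ t ∈ J, IsMultiplier w (u t) (v t)) ∧ ContDiffOn ℝ k v J

/-- `u ∈ C^k(J, (H^s)³)`, for `s ≥ 0`. As `⟨A⟩ ^ s : H^s → L²` is an isometric isomorphism of
Hilbert spaces, this says that `⟨A⟩ ^ s u ∈ C^k(J, L²)`. -/
def SobolevContDiffOn (k : ℕ) (s : ℝ) (J : Set ℝ) (u : ℝ → L2) : Prop :=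
  MultContDiffOn k (symBessel s) J u

/-- `P` is an orthogonal projection on `L²(ℝ³, ℝ³)` which is fibered in Fourier space: the
transform of `P f` at `ξ` is `σ ξ` applied to the transform of `f` at `ξ`. -/
structure IsFiberedProjection (P : L2 →L[ℝ] L2) : Prop where
  proj : IsStarProjection P
  fibered : ∃ σ : R3 → Matrix (Fin 3) (Fin 3) ℂ, ∀ f : L2, ∀ᵐ ξ : R3,
    hat (P f) ξ = WithLp.toLp 2 ((σ ξ).mulVec (hat f ξ).ofLp)

/-- The vector `M v`. -/
def matVec (M : Matrix (Fin 3) (Fin 3) ℝ) (v : R3) : R3 := WithLp.toLp 2 (M.mulVec v.ofLp)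

open Classical in
/-- The weak derivative `∂ⱼ f ∈ L²` (it exists for `f ∈ H¹`; otherwise the value is `0`). -/
def partialD (j : Fin 3) (f : L2) : L2 :=
  if h : ∃ g : L2, IsMultiplier (symD j) f g then h.choose else 0

/-- `((M f) · ∇) f = ∑ⱼ (M f)ⱼ ∂ⱼ f`, as a function on `ℝ³`. -/
def convection (M : Matrix (Fin 3) (Fin 3) ℝ) (f : L2) (x : R3) : R3 :=
  ∑ j : Fin 3, (matVec M (f x)) j • (partialD j f) x

open Classical in
/-- The class in `L²` of a square integrable vector field (otherwise the value is `0`). -/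
def toL2 (g : R3 → R3) : L2 :=
  if h : MemLp g 2 (volume : Measure R3) then h.toLp g else 0

/-- The pairing of `f ∈ L² ⊆ 𝓢'` with a test function. -/
def pair (f : L2) (φ : 𝓢(R3, R3)) : ℝ := ∫ x : R3, ⟪f x, φ x⟫_ℝ

/-- `∇ · (M f) = 0` in the sense of distributions. -/
def DivFree (M : Matrix (Fin 3) (Fin 3) ℝ) (f : L2) : Prop :=
  ∀ φ : 𝓢(R3, ℝ), ∫ x : R3, fderiv ℝ φ x (matVec M (f x)) = 0

/-- The norm `|u| = sup_{0 < t ≤ T} t ^ (3/8) ‖A ^ (5/4) u(t)‖`. -/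
def critNorm (T : ℝ) (u : ℝ → L2) : ℝ≥0∞ :=
  ⨆ t ∈ Ioc 0 T, ENNReal.ofReal (t ^ (3 / 8 : ℝ)) * normA (5 / 4) (u t)

/-- `u` is a strong solution of class `𝒮_{r, ]0,T]}` of
`∂ₜ u + P ((M u) · ∇) u - Δ u = 0`, `u(t) ∈ Ran P`. Only the values of `u` on `[0, T]` matter. -/
structure IsStrongSolution (M : Matrix (Fin 3) (Fin 3) ℝ) (P : L2 →L[ℝ] L2) (r T : ℝ)
    (u : ℝ → L2) : Prop where
  /-- `u ∈ C([0, T], H^r)` -/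
  continuous : SobolevContDiffOn 0 r (Icc 0 T) u
  /-- `u(t) ∈ Ran P` -/
  mem_range : ∀ t ∈ Icc 0 T, u t ∈ P.range
  /-- `A ^ (5/4) u ∈ C(]0, T], L²)` -/
  continuous_crit : MultContDiffOn 0 (symA (5 / 4)) (Ioc 0 T) u
  /-- `t ^ (3/8) ‖A ^ (5/4) u(t)‖` is bounded on `]0, T]` -/
  bounded_crit : critNorm T u < ⊤
  /-- `t ^ (3/8) ‖A ^ (5/4) u(t)‖ → 0` as `t → 0` -/
  vanish_crit : Tendsto (fun t : ℝ => ENNReal.ofReal (t ^ (3 / 8 : ℝ)) * normA (5 / 4) (u t))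
    (𝓝[>] 0) (𝓝 0)
  /-- `u ∈ C¹(]0, T], 𝓢')` for the weak* topology -/
  contDiff_weak : ∀ φ : 𝓢(R3, R3), ContDiffOn ℝ 1 (fun t => pair (u t) φ) (Ioc 0 T)
  /-- `du/dt = -A² u - P ((M u) · ∇) u` on `]0, T]` in the sense of distributions -/
  equation : ∀ φ : 𝓢(R3, R3), ∀ t ∈ Ioc 0 T,
    HasDerivWithinAt (fun s => pair (u s) φ)
      (pair (u t) (Δ φ) - pair (P (toL2 (convection M (u t)))) φ) (Ioc 0 T) t

/-- The analyticity bound on `]0, T]` with constants `δ` and `C`, and the Sobolev bounds with the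
same `δ` and with `C̃ = C max_{x ≥ 0} x ^ (s - 1/2) exp (-x)`. -/
def AnalyticityBounds (T δ C : ℝ) (u : ℝ → L2) : Prop :=
  (∀ t ∈ Ioc 0 T, normExpH (min (√t) δ) (1 / 2) (u t) ≤ ENNReal.ofReal C) ∧
  ∀ s : ℝ, 1 / 2 ≤ s → ∀ t ∈ Ioc 0 T,
    normA s (u t) ≤ ENNReal.ofReal
      (C * sSup ((fun x : ℝ => x ^ (s - 1 / 2) * Real.exp (-x)) '' Ici 0)
        * (min (√t) δ) ^ (-(s - 1 / 2)))

end StrongNS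

end

noncomputable section

namespace StrongNS

/-! The nonlinearity is controlled by a scale-invariant product estimate, ‖(Mf·∇)g‖ ≤ K ‖A^(5/4) f‖
‖A^(5/4) g‖. It is proved as a bound on the absolute values of the Fourier transforms
(`lintegral_riesz_conv_sq_le`), so it persists under every weight `W` with W(ξ) ≤ W(η) W(ξ-η)
(`multNorm_Nl_le`). The weights exp(θ|ξ|), their truncations, and multiples of the Bessel weights
are of this kind.

For (a), the solution satisfies Duhamel's inequality in weighted norms (`IsMild.multNorm_le`). Take
the weight exp(√(t-t₀) A). Since √(t-t₀) ≤ √(t-s) + √(s-t₀), the first summand is absorbed by the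
heat operator exp((t-s)Δ) and the second stays on u(s). The time integral of (t-s)^(-5/8)
(s-t₀)^(-3/4) is bounded by a multiple of (t-t₀)^(-3/8), so the estimate closes at the critical
scaling as soon as the heat evolution of u(t₀) and the critical norm of u are small. The weighted
norm of u is not known to be finite beforehand. The weight is therefore truncated at 2^n, and one
inducts on n: passing to n+1 at most doubles the norm, and Duhamel brings it back below the original
bound (`IsMild.gevrey`). No uniqueness theorem for solutions is needed.

Smallness has two sources. Near t = 0 the heat evolution of u(0) is small on some ]0,τ], by
dominated convergence if r = 1/2 and with an explicit τ if r > 1/2; a continuity argument from t = 0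
transfers this to u (`IsMild.small_of_heat`). For t > τ one restarts at t - δ², where ‖A^(5/4) u‖ is
bounded in terms of |u| and τ and hence small relative to a short interval. This gives the stated
dependence of δ and C (`exists_analyticityBounds`).

For (b), uniform Sobolev bounds away from t = 0 and continuity in L² give continuity in every H^s by
interpolation. The equation then expresses the time derivative through bounded linear and bilinear
maps of higher Sobolev norms, and one inducts on k (`ContSmooth.contDiffOn`). For (c), the value at
x is a fixed functional applied to a translation operator, smooth in x in operator norm, acting on a
field smooth in t (`smoothRep_eq`). For (d), the nonlinearity does no work
(`DivFree.inner_Nl_eq_zero`), so d/dt ‖u‖² = -2‖Au‖². -/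

/-! ### Real fields on the Fourier side -/

/-- Coordinatewise complex conjugation on `ℂ³`. -/
def conjC : C3 →L[ℝ] C3 :=
  LinearMap.toContinuousLinearMap
    { toFun := fun z => WithLp.toLp 2 (fun i => (starRingEnd ℂ) (z i))
      map_add' := fun x y => by ext i; simp
      map_smul' := fun c x => by ext i; simp }

/-- Coordinatewise real part on `ℂ³`. -/
def reC : C3 →L[ℝ] R3 :=
  LinearMap.toContinuousLinearMap
    { toFun := fun z => WithLp.toLp 2 (fun i => (z i).re)
      map_add' := fun x y => by ext i; simp
      map_smul' := fun c x => by ext i; simp }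

@[simp] lemma conjC_apply (z : C3) (i : Fin 3) : conjC z i = (starRingEnd ℂ) (z i) := rfl
@[simp] lemma reC_apply (z : C3) (i : Fin 3) : reC z i = (z i).re := rfl
@[simp] lemma complexify_apply (z : R3) (i : Fin 3) : complexify z i = ((z i : ℝ) : ℂ) := rfl

lemma conjC_complexify (z : R3) : conjC (complexify z) = complexify z := by ext i; simp

lemma reC_complexify (z : R3) : reC (complexify z) = z := by ext i; simp

lemma complexify_reC {z : C3} (h : conjC z = z) : complexify (reC z) = z := by
  ext i
  have := congrArg (fun w : C3 => w i) h
  simp only [conjC_apply] at this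
  simpa using (Complex.conj_eq_iff_re.1 this)

lemma conjC_smul (c : ℂ) (z : C3) : conjC (c • z) = (starRingEnd ℂ) c • conjC z := by
  ext i; simp

lemma norm_complexify (z : R3) : ‖complexify z‖ = ‖z‖ := by
  simp [EuclideanSpace.norm_eq]

/-- Reflection `F ↦ F (-·)` on `L²`. -/
def reflLp : Lp C3 2 (volume : Measure R3) →ₗᵢ[ℝ] Lp C3 2 (volume : Measure R3) :=
  Lp.compMeasurePreservingₗᵢ ℝ Neg.neg (Measure.measurePreserving_neg volume)

lemma coeFn_reflLp (F : Lp C3 2 (volume : Measure R3)) :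
    ∀ᵐ ξ : R3, reflLp F ξ = F (-ξ) :=
  Lp.coeFn_compMeasurePreserving F (Measure.measurePreserving_neg volume)

lemma fourier_conjC_apply (φ : 𝓢(R3, C3)) (ξ : R3) :
    (𝓕 (SchwartzMap.postcompCLM conjC φ)) ξ = conjC ((𝓕 φ) (-ξ)) := by
  rw [SchwartzMap.fourier_coe, SchwartzMap.fourier_coe, Real.fourier_eq, Real.fourier_eq,
    ← ContinuousLinearMap.integral_comp_comm]
  · congr 1
    ext1 x
    rw [SchwartzMap.postcompCLM_apply, Circle.smul_def, Circle.smul_def, conjC_smul]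
    congr 1
    rw [← Circle.coe_inv_eq_conj]
    congr 1
    rw [inner_neg_right, neg_neg, AddChar.map_neg_eq_inv]
  · exact (Real.fourierIntegral_convergent_iff _).2 φ.integrable

/-- Both sides are continuous on L², and Schwartz functions, for which the integral formula is
available, are dense. -/
lemma fourier_conjC (f : Lp C3 2 (volume : Measure R3)) :
    𝓕 (conjC.compLpL 2 volume f) = reflLp (conjC.compLpL 2 volume (𝓕 f)) := by
  refine DenseRange.induction_on (SchwartzMap.denseRange_toLpCLM (F := C3) (p := 2)
    (μ := (volume : Measure R3)) ENNReal.ofNat_ne_top) f ?_ ?_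
  · apply isClosed_eq
    · exact (FourierTransform.continuous_fourier).comp (conjC.compLpL 2 volume).continuous
    · exact reflLp.continuous.comp
        ((conjC.compLpL 2 volume).continuous.comp FourierTransform.continuous_fourier)
  · intro φ
    have h1 : conjC.compLpL 2 volume (φ.toLp 2 (volume : Measure R3))
        = (SchwartzMap.postcompCLM conjC φ).toLp 2 := by
      apply Lp.ext
      filter_upwards [conjC.coeFn_compLpL (p := 2) (φ.toLp 2 (volume : Measure R3)),
        φ.coeFn_toLp 2 volume, (SchwartzMap.postcompCLM conjC φ).coeFn_toLp 2 volume] with x h1 h2 h3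
      rw [h1, h2, h3, SchwartzMap.postcompCLM_apply]
    rw [SchwartzMap.toLpCLM_apply, h1, SchwartzMap.toLp_fourier_eq, SchwartzMap.toLp_fourier_eq]
    apply Lp.ext
    have hn := (Measure.measurePreserving_neg (volume : Measure R3)).quasiMeasurePreserving
    filter_upwards [(𝓕 (SchwartzMap.postcompCLM conjC φ)).coeFn_toLp 2 volume,
      coeFn_reflLp (conjC.compLpL 2 volume ((𝓕 φ).toLp 2)),
      hn.ae (conjC.coeFn_compLpL (p := 2) ((𝓕 φ).toLp 2 (volume : Measure R3))),
      hn.ae ((𝓕 φ).coeFn_toLp 2 volume)] with x h1 h2 h3 h4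
    rw [h1, h2, h3, h4, fourier_conjC_apply]

/-- `hat` as a real linear isometry. -/
def hatₗᵢ : L2 →ₗᵢ[ℝ] Lp C3 2 (volume : Measure R3) where
  toFun := hat
  map_add' f g := by
    change 𝓕 (complexify.compLpL 2 volume (f + g)) = _
    rw [map_add, FourierTransform.fourier_add]; rfl
  map_smul' c f := by
    change 𝓕 (complexify.compLpL 2 volume (c • f)) = _
    rw [map_smul]
    exact (Lp.fourierTransformₗᵢ R3 C3).toContinuousLinearEquiv.toContinuousLinearMap.map_smul_of_tower c _
  norm_map' f := by
    change ‖𝓕 (complexify.compLp f)‖ = _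
    rw [Lp.norm_fourier_eq]
    apply le_antisymm
    · refine Lp.norm_le_norm_of_ae_le ?_
      filter_upwards [complexify.coeFn_compLp f] with x hx
      rw [hx, norm_complexify]
    · refine Lp.norm_le_norm_of_ae_le ?_
      filter_upwards [complexify.coeFn_compLp f] with x hx
      rw [hx, norm_complexify]

lemma hat_add (f g : L2) : hat (f + g) = hat f + hat g := hatₗᵢ.map_add f g
lemma hat_sub (f g : L2) : hat (f - g) = hat f - hat g := hatₗᵢ.map_sub f g
lemma hat_neg (f : L2) : hat (-f) = -hat f := hatₗᵢ.map_neg f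
lemma hat_smul (c : ℝ) (f : L2) : hat (c • f) = c • hat f := hatₗᵢ.map_smul c f
lemma norm_hat (f : L2) : ‖hat f‖ = ‖f‖ := hatₗᵢ.norm_map f
lemma hat_injective : Function.Injective hat := hatₗᵢ.injective

/-- Real fields are fixed by conjugation. With `exists_hat_eq` this Hermitian symmetry characterises
the range of `hat`, which is what allows multipliers to act on real fields. -/
lemma hat_reflect (f : L2) : ∀ᵐ ξ : R3, hat f (-ξ) = conjC (hat f ξ) := by
  have h1 : conjC.compLpL 2 volume (complexify.compLp f) = complexify.compLp f := by
    apply Lp.ext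
    filter_upwards [conjC.coeFn_compLpL (p := 2) (complexify.compLp f),
      complexify.coeFn_compLp f] with x h1 h2
    rw [h1, h2, conjC_complexify]
  have h2 : hat f = reflLp (conjC.compLpL 2 volume (hat f)) := by
    conv_lhs => rw [hat, ← h1, fourier_conjC]
    rfl
  have hn := (Measure.measurePreserving_neg (volume : Measure R3)).quasiMeasurePreserving
  have h3 : ∀ᵐ ξ : R3, hat f ξ = conjC (hat f (-ξ)) := by
    filter_upwards [coeFn_reflLp (conjC.compLpL 2 volume (hat f)),
      hn.ae (conjC.coeFn_compLpL (p := 2) (hat f))] with ξ h4 h5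
    rw [← h5, ← h4, ← h2]
  filter_upwards [hn.ae h3] with ξ h
  simpa using h

/-- The symmetry of `F` makes its inverse transform invariant under conjugation, hence equal to the
complexification of its own real part. -/
lemma exists_hat_eq (F : Lp C3 2 (volume : Measure R3))
    (hF : ∀ᵐ ξ : R3, F (-ξ) = conjC (F ξ)) : ∃ f : L2, hat f = F := by
  have hn := (Measure.measurePreserving_neg (volume : Measure R3)).quasiMeasurePreserving
  set g : Lp C3 2 (volume : Measure R3) := 𝓕⁻ F with hg
  have hgF : 𝓕 g = F := FourierTransform.fourier_fourierInv_eq F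
  have h1 : conjC.compLpL 2 volume g = g := by
    refine (Lp.fourierTransformₗᵢ R3 C3).injective
      (show (𝓕 (conjC.compLpL 2 volume g) : Lp C3 2 (volume : Measure R3)) = 𝓕 g from ?_)
    rw [fourier_conjC, hgF]
    apply Lp.ext
    filter_upwards [coeFn_reflLp (conjC.compLpL 2 volume F),
      hn.ae (conjC.coeFn_compLpL (p := 2) F), hn.ae hF] with ξ h4 h5 h6
    rw [h4, h5, ← h6, neg_neg]
  refine ⟨reC.compLp g, ?_⟩
  rw [hat]
  convert hgF using 2
  apply Lp.ext
  filter_upwards [complexify.coeFn_compLp (reC.compLp g), reC.coeFn_compLp g,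
    conjC.coeFn_compLpL (p := 2) g] with x h2 h3 h4
  rw [h1] at h4
  rw [h2, h3, complexify_reC h4.symm]

/-! ### Calculus of Fourier multipliers -/

/-- Symbols of multipliers which map real fields to real fields. -/
structure IsSymbol (w : R3 → ℂ) : Prop where
  meas : Measurable w
  herm : ∀ ξ, w (-ξ) = (starRingEnd ℂ) (w ξ)

lemma IsMultiplier.unique {w : R3 → ℂ} {f g g' : L2} (h : IsMultiplier w f g)
    (h' : IsMultiplier w f g') : g = g' := by
  apply hat_injective
  apply Lp.ext
  filter_upwards [h, h'] with ξ h1 h2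
  rw [h1, h2]

/-- A Hermitian symbol preserves the symmetry of `hat f`, so the product is again the transform of a
real field. Finiteness of `multNorm` is thus the domain condition. -/
lemma exists_isMultiplier {w : R3 → ℂ} (hw : IsSymbol w) {f : L2} (hf : multNorm w f < ⊤) :
    ∃ g, IsMultiplier w f g := by
  have hm : MemLp (fun ξ => w ξ • hat f ξ) 2 (volume : Measure R3) :=
    ⟨hw.meas.aestronglyMeasurable.smul (Lp.aestronglyMeasurable _), hf⟩
  obtain ⟨g, hg⟩ := exists_hat_eq (hm.toLp _) (by
    have hn := (Measure.measurePreserving_neg (volume : Measure R3)).quasiMeasurePreserving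
    filter_upwards [hm.coeFn_toLp, hn.ae hm.coeFn_toLp, hat_reflect f] with ξ h1 h2 h3
    rw [h1, h2, h3, hw.herm, conjC_smul])
  refine ⟨g, ?_⟩
  rw [IsMultiplier, hg]
  exact hm.coeFn_toLp

lemma IsMultiplier.enorm_eq {w : R3 → ℂ} {f g : L2} (h : IsMultiplier w f g) :
    ‖g‖ₑ = multNorm w f := by
  have h1 : ‖g‖ₑ = ‖hat g‖ₑ := by
    rw [← ofReal_norm, ← ofReal_norm, norm_hat]
  rw [h1, Lp.enorm_def, multNorm]
  exact eLpNorm_congr_ae h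

lemma IsSymbol.ofReal {a : R3 → ℝ} (ha : Measurable a) (he : ∀ ξ, a (-ξ) = a ξ) :
    IsSymbol (fun ξ => (a ξ : ℂ)) :=
  ⟨Complex.measurable_ofReal.comp ha, fun ξ => by rw [he, Complex.conj_ofReal]⟩

lemma IsSymbol.mul {w w' : R3 → ℂ} (h : IsSymbol w) (h' : IsSymbol w') :
    IsSymbol (fun ξ => w ξ * w' ξ) :=
  ⟨h.meas.mul h'.meas, fun ξ => by rw [h.herm, h'.herm, map_mul]⟩

lemma isMultiplier_add {w : R3 → ℂ} {f f' g g' : L2} (h : IsMultiplier w f g)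
    (h' : IsMultiplier w f' g') : IsMultiplier w (f + f') (g + g') := by
  rw [IsMultiplier, hat_add, hat_add]
  filter_upwards [h, h', Lp.coeFn_add (hat f) (hat f'), Lp.coeFn_add (hat g) (hat g')]
    with ξ h1 h2 h3 h4
  rw [h3, h4, Pi.add_apply, Pi.add_apply, h1, h2, smul_add]

lemma isMultiplier_smul {w : R3 → ℂ} {f g : L2} (c : ℝ) (h : IsMultiplier w f g) :
    IsMultiplier w (c • f) (c • g) := by
  rw [IsMultiplier, hat_smul, hat_smul]
  filter_upwards [h, Lp.coeFn_smul c (hat f), Lp.coeFn_smul c (hat g)] with ξ h1 h3 h4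
  rw [h3, h4, Pi.smul_apply, Pi.smul_apply, h1, smul_comm]

lemma isMultiplier_sub {w : R3 → ℂ} {f f' g g' : L2} (h : IsMultiplier w f g)
    (h' : IsMultiplier w f' g') : IsMultiplier w (f - f') (g - g') := by
  have := isMultiplier_add h (isMultiplier_smul (-1) h')
  simpa [sub_eq_add_neg] using this

lemma IsMultiplier.comp {w w' : R3 → ℂ} {f g k : L2} (h : IsMultiplier w f g)
    (h' : IsMultiplier w' g k) : IsMultiplier (fun ξ => w' ξ * w ξ) f k := by
  filter_upwards [h, h'] with ξ h1 h2
  rw [h2, h1, smul_smul]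

lemma IsMultiplier.congr {w w' : R3 → ℂ} {f g : L2} (h : IsMultiplier w f g)
    (hw : ∀ ξ, w ξ = w' ξ) : IsMultiplier w' f g := by
  rwa [← show w = w' from funext hw]

lemma multNorm_comp {w w' : R3 → ℂ} {f g : L2} (h : IsMultiplier w f g) :
    multNorm w' g = multNorm (fun ξ => w' ξ * w ξ) f := by
  apply eLpNorm_congr_ae
  filter_upwards [h] with ξ h1
  rw [h1, smul_smul]

lemma multNorm_le_mul {w w' : R3 → ℂ} {c : ℝ} (f : L2)
    (h : ∀ ξ, ‖w ξ‖ ≤ c * ‖w' ξ‖) :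
    multNorm w f ≤ ENNReal.ofReal c * multNorm w' f := by
  apply eLpNorm_le_mul_eLpNorm_of_ae_le_mul
  refine Eventually.of_forall fun ξ => ?_
  rw [norm_smul, norm_smul, ← mul_assoc]
  exact mul_le_mul_of_nonneg_right (h ξ) (norm_nonneg _)

lemma multNorm_mono {w w' : R3 → ℂ} (f : L2) (h : ∀ ξ, ‖w ξ‖ ≤ ‖w' ξ‖) :
    multNorm w f ≤ multNorm w' f := by
  simpa using multNorm_le_mul (c := 1) f (by simpa using h)

lemma multNorm_one (f : L2) : multNorm (fun _ => 1) f = ‖f‖ₑ := by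
  have : IsMultiplier (fun _ => 1) f f := Eventually.of_forall fun ξ => by simp
  rw [this.enorm_eq]

lemma multNorm_le_of_bdd {w : R3 → ℂ} {c : ℝ} (f : L2) (h : ∀ ξ, ‖w ξ‖ ≤ c) :
    multNorm w f ≤ ENNReal.ofReal c * ‖f‖ₑ := by
  rw [← multNorm_one]
  exact multNorm_le_mul f (by simpa using h)

lemma multNorm_smul_hat_meas {w : R3 → ℂ} (hw : Measurable w) (f : L2) :
    AEStronglyMeasurable (fun ξ => w ξ • hat f ξ) (volume : Measure R3) :=
  hw.aestronglyMeasurable.smul (Lp.aestronglyMeasurable _)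

lemma multNorm_le_add {w w₁ w₂ : R3 → ℂ} (f : L2) (h₁ : Measurable w₁) (h₂ : Measurable w₂)
    (h : ∀ ξ, ‖w ξ‖ ≤ ‖w₁ ξ‖ + ‖w₂ ξ‖) : multNorm w f ≤ multNorm w₁ f + multNorm w₂ f := by
  have e1 : multNorm w₁ f = eLpNorm (fun ξ => ‖w₁ ξ • hat f ξ‖) 2 (volume : Measure R3) :=
    (eLpNorm_norm _).symm
  have e2 : multNorm w₂ f = eLpNorm (fun ξ => ‖w₂ ξ • hat f ξ‖) 2 (volume : Measure R3) :=
    (eLpNorm_norm _).symm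
  rw [e1, e2]
  refine le_trans ?_ (eLpNorm_add_le (multNorm_smul_hat_meas h₁ f).norm
    (multNorm_smul_hat_meas h₂ f).norm one_le_two)
  apply eLpNorm_mono
  intro ξ
  simp only [Pi.add_apply, norm_smul]
  rw [Real.norm_of_nonneg (by positivity), ← add_mul]
  exact mul_le_mul_of_nonneg_right (h ξ) (norm_nonneg _)

lemma multNorm_add_le {w : R3 → ℂ} (hw : Measurable w) (f g : L2) :
    multNorm w (f + g) ≤ multNorm w f + multNorm w g := by
  refine le_trans (le_of_eq ?_) (eLpNorm_add_le (multNorm_smul_hat_meas hw f)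
    (multNorm_smul_hat_meas hw g) one_le_two)
  apply eLpNorm_congr_ae
  rw [hat_add]
  filter_upwards [Lp.coeFn_add (hat f) (hat g)] with ξ h
  rw [h, Pi.add_apply, Pi.add_apply, smul_add]

/-- Fatou's lemma. It removes frequency cut-offs and truncations of weights from uniform estimates,
without knowing that the limiting norm is finite. -/
lemma multNorm_le_of_tendsto {w : R3 → ℂ} {v : ℕ → R3 → ℂ} (hv : ∀ n, Measurable (v n)) (f : L2)
    (h : ∀ ξ, Tendsto (fun n => v n ξ) atTop (𝓝 (w ξ))) {c : ℝ≥0∞}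
    (hc : ∀ n, multNorm (v n) f ≤ c) : multNorm w f ≤ c := by
  refine (Lp.eLpNorm_lim_le_liminf_eLpNorm (fun n => multNorm_smul_hat_meas (hv n) f) _
    (Eventually.of_forall fun ξ => (h ξ).smul_const _)).trans ?_
  exact liminf_le_of_le (by isBoundedDefault) fun b hb => by
    obtain ⟨n, hn⟩ := hb.exists
    exact hn.trans (hc n)

/-- Bounded symbols. -/
structure IsBddSymbol (w : R3 → ℂ) : Prop extends IsSymbol w where
  bdd : ∃ c, ∀ ξ, ‖w ξ‖ ≤ c

lemma IsBddSymbol.multNorm_lt_top {w : R3 → ℂ} (h : IsBddSymbol w) (f : L2) :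
    multNorm w f < ⊤ := by
  obtain ⟨c, hc⟩ := h.bdd
  exact (multNorm_le_of_bdd f hc).trans_lt (ENNReal.mul_lt_top ENNReal.ofReal_lt_top enorm_lt_top)

lemma IsMultiplier.norm_le {w : R3 → ℂ} {f g : L2} (h : IsMultiplier w f g) {c : ℝ}
    (hc : ∀ ξ, ‖w ξ‖ ≤ c) : ‖g‖ ≤ c * ‖f‖ := by
  have hc0 : 0 ≤ c := (norm_nonneg _).trans (hc 0)
  have h1 := h.enorm_eq.trans_le (multNorm_le_of_bdd f hc)
  rw [← ofReal_norm, ← ofReal_norm, ← ENNReal.ofReal_mul hc0] at h1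
  exact (ENNReal.ofReal_le_ofReal_iff (by positivity)).1 h1

open Classical in
/-- The Fourier multiplier with bounded symbol `w` (and `0` if `w` is not a bounded symbol). -/
def D (w : R3 → ℂ) : L2 →L[ℝ] L2 :=
  if h : IsBddSymbol w then
    LinearMap.mkContinuous
      { toFun := fun f => (exists_isMultiplier h.toIsSymbol (h.multNorm_lt_top f)).choose
        map_add' := fun f g => (exists_isMultiplier h.toIsSymbol (h.multNorm_lt_top _)).choose_spec.unique
          (isMultiplier_add (exists_isMultiplier h.toIsSymbol (h.multNorm_lt_top f)).choose_spec
            (exists_isMultiplier h.toIsSymbol (h.multNorm_lt_top g)).choose_spec)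
        map_smul' := fun c f => (exists_isMultiplier h.toIsSymbol (h.multNorm_lt_top _)).choose_spec.unique
          (isMultiplier_smul c
            (exists_isMultiplier h.toIsSymbol (h.multNorm_lt_top f)).choose_spec) }
      h.bdd.choose (fun f =>
        (exists_isMultiplier h.toIsSymbol (h.multNorm_lt_top f)).choose_spec.norm_le
          h.bdd.choose_spec)
  else 0

lemma isMultiplier_D {w : R3 → ℂ} (h : IsBddSymbol w) (f : L2) : IsMultiplier w f (D w f) := by
  rw [D, dif_pos h]
  exact (exists_isMultiplier h.toIsSymbol (h.multNorm_lt_top f)).choose_spec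

lemma norm_D_le {w : R3 → ℂ} (h : IsBddSymbol w) {c : ℝ} (hc : ∀ ξ, ‖w ξ‖ ≤ c) : ‖D w‖ ≤ c :=
  ContinuousLinearMap.opNorm_le_bound _ ((norm_nonneg _).trans (hc 0))
    fun f => (isMultiplier_D h f).norm_le hc

lemma IsBddSymbol.mul {w w' : R3 → ℂ} (h : IsBddSymbol w) (h' : IsBddSymbol w') :
    IsBddSymbol (fun ξ => w ξ * w' ξ) := by
  obtain ⟨c, hc⟩ := h.bdd
  obtain ⟨c', hc'⟩ := h'.bdd
  refine ⟨h.toIsSymbol.mul h'.toIsSymbol, c * c', fun ξ => ?_⟩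
  rw [norm_mul]
  exact mul_le_mul (hc ξ) (hc' ξ) (norm_nonneg _) ((norm_nonneg _).trans (hc ξ))

lemma IsBddSymbol.ofReal {a : R3 → ℝ} (ha : Measurable a) (he : ∀ ξ, a (-ξ) = a ξ) {c : ℝ}
    (hc : ∀ ξ, |a ξ| ≤ c) : IsBddSymbol (fun ξ => (a ξ : ℂ)) :=
  ⟨IsSymbol.ofReal ha he, c, fun ξ => by simpa using hc ξ⟩

lemma D_add {w w' : R3 → ℂ} (h : IsBddSymbol w) (h' : IsBddSymbol w') :
    D (fun ξ => w ξ + w' ξ) = D w + D w' := by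
  obtain ⟨c, hc⟩ := h.bdd
  obtain ⟨c', hc'⟩ := h'.bdd
  have hs : IsBddSymbol (fun ξ => w ξ + w' ξ) :=
    ⟨⟨h.meas.add h'.meas, fun ξ => by rw [h.herm, h'.herm, map_add]⟩, c + c',
      fun ξ => (norm_add_le _ _).trans (add_le_add (hc ξ) (hc' ξ))⟩
  ext1 f
  refine (isMultiplier_D hs f).unique ?_
  rw [add_apply, IsMultiplier, hat_add]
  filter_upwards [isMultiplier_D h f, isMultiplier_D h' f,
    Lp.coeFn_add (hat (D w f)) (hat (D w' f))] with ξ h1 h2 h3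
  rw [h3, Pi.add_apply, h1, h2, add_smul]

lemma D_real_smul {w : R3 → ℂ} (h : IsBddSymbol w) (r : ℝ) :
    D (fun ξ => r * w ξ) = r • D w := by
  obtain ⟨c, hc⟩ := h.bdd
  have hs : IsBddSymbol (fun ξ => r * w ξ) :=
    ⟨⟨h.meas.const_mul _, fun ξ => by rw [h.herm, map_mul, Complex.conj_ofReal]⟩, |r| * c,
      fun ξ => by
        rw [norm_mul, Complex.norm_real, Real.norm_eq_abs]
        exact mul_le_mul_of_nonneg_left (hc ξ) (abs_nonneg _)⟩
  ext1 f
  refine (isMultiplier_D hs f).unique ?_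
  rw [smul_apply, IsMultiplier, hat_smul]
  filter_upwards [isMultiplier_D h f, Lp.coeFn_smul r (hat (D w f))] with ξ h1 h3
  rw [h3, Pi.smul_apply, h1, mul_smul, Complex.coe_smul]

lemma D_sub {w w' : R3 → ℂ} (h : IsBddSymbol w) (h' : IsBddSymbol w') :
    D (fun ξ => w ξ - w' ξ) = D w - D w' := by
  have h2 : IsBddSymbol (fun ξ => ((-1 : ℝ) : ℂ) * w' ξ) := by
    obtain ⟨c', hc'⟩ := h'.bdd
    exact ⟨⟨h'.meas.const_mul _, fun ξ => by rw [h'.herm, map_mul, Complex.conj_ofReal]⟩, c',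
      fun ξ => by simpa using hc' ξ⟩
  have := D_add h h2
  rw [D_real_smul h'] at this
  simpa [sub_eq_add_neg] using this

lemma D_comp {w w' : R3 → ℂ} (h : IsBddSymbol w) (h' : IsBddSymbol w') (f : L2) :
    D w (D w' f) = D (fun ξ => w ξ * w' ξ) f :=
  ((isMultiplier_D h' f).comp (isMultiplier_D h _)).unique (isMultiplier_D (h.mul h') f)

/-! ### Fibered projections -/

lemma norm_proj_le {P : L2 →L[ℝ] L2} (hP : IsStarProjection P) (f : L2) : ‖P f‖ ≤ ‖f‖ := by
  have h1 : ⟪P f, P f⟫_ℝ = ⟪f, P f⟫_ℝ := by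
    rw [← ContinuousLinearMap.adjoint_inner_right, ← ContinuousLinearMap.star_eq_adjoint,
      hP.isSelfAdjoint.star_eq, ← mul_apply_eq_comp, hP.isIdempotentElem.eq]
  rw [real_inner_self_eq_norm_sq] at h1
  have h2 := real_inner_le_norm f (P f)
  by_contra! h3
  nlinarith [norm_nonneg f]

/-- The matrix `σ ξ` commutes with the scalar `w ξ`. This is the only use of the fibered structure;
it lets `P` drop out of every weighted norm. -/
lemma IsFiberedProjection.isMultiplier {P : L2 →L[ℝ] L2} (hP : IsFiberedProjection P)
    {w : R3 → ℂ} {f g : L2} (h : IsMultiplier w f g) : IsMultiplier w (P f) (P g) := by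
  obtain ⟨σ, hσ⟩ := hP.fibered
  filter_upwards [h, hσ f, hσ g] with ξ h1 h2 h3
  rw [h2, h3, h1]
  ext i
  simp [Matrix.mulVec_smul]

lemma IsFiberedProjection.multNorm_le {P : L2 →L[ℝ] L2} (hP : IsFiberedProjection P)
    {w : R3 → ℂ} (hw : IsSymbol w) (f : L2) : multNorm w (P f) ≤ multNorm w f := by
  by_cases h : multNorm w f < ⊤
  · obtain ⟨g, hg⟩ := exists_isMultiplier hw h
    rw [← hg.enorm_eq, ← (hP.isMultiplier hg).enorm_eq, ← ofReal_norm, ← ofReal_norm]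
    exact ENNReal.ofReal_le_ofReal (norm_proj_le hP.proj g)
  · rw [not_lt, top_le_iff] at h
    rw [h]; exact le_top

/-! ### Fourier transform of products, and Fourier inversion -/

/-- `F ↦ F (ξ - ·)` on `L²`. -/
def flipLp (ξ : R3) : Lp C3 2 (volume : Measure R3) →ₗᵢ[ℂ] Lp C3 2 (volume : Measure R3) :=
  Lp.compMeasurePreservingₗᵢ ℂ (fun η => ξ - η) (Measure.measurePreserving_sub_left volume ξ)

lemma coeFn_flipLp (ξ : R3) (F : Lp C3 2 (volume : Measure R3)) :
    ∀ᵐ η : R3, flipLp ξ F η = F (ξ - η) :=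
  Lp.coeFn_compMeasurePreserving F (Measure.measurePreserving_sub_left volume ξ)

/-- `SchwartzMap.convolution` unfolds to the inverse transform of the pairing of the transforms.
Applying it to 𝓕⁻ φ and 𝓕⁻ ψ and evaluating at -ξ turns this into the formula for the direct
transform. -/
lemma fourier_bilin_schwartz (B : C3 →L[ℂ] C3 →L[ℂ] C3) (φ ψ : 𝓢(R3, C3)) (ξ : R3) :
    𝓕 (fun x => B (φ x) (ψ x)) ξ = ∫ η : R3, B ((𝓕 φ) η) ((𝓕 ψ) (ξ - η)) := by
  have h1 : SchwartzMap.convolution B (𝓕⁻ φ) (𝓕⁻ ψ) (-ξ)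
      = (𝓕⁻ (SchwartzMap.pairing B φ ψ)) (-ξ) := by
    simp [SchwartzMap.convolution]
  rw [SchwartzMap.convolution_apply, SchwartzMap.fourierInv_coe (SchwartzMap.pairing B φ ψ),
    Real.fourierInv_eq_fourier_neg, neg_neg] at h1
  rw [show (fun x => B (φ x) (ψ x)) = (SchwartzMap.pairing B φ ψ : R3 → C3) from rfl, ← h1,
    MeasureTheory.convolution_def, ← integral_neg_eq_self]
  congr 1; ext1 η
  have e1 : (𝓕⁻ φ) (-η) = (𝓕 φ) η := by
    rw [SchwartzMap.fourierInv_coe, Real.fourierInv_eq_fourier_neg, neg_neg]; rfl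
  have e2 : (𝓕⁻ ψ) (-ξ - -η) = (𝓕 ψ) (ξ - η) := by
    rw [SchwartzMap.fourierInv_coe, Real.fourierInv_eq_fourier_neg, SchwartzMap.fourier_coe,
      show -(-ξ - -η) = ξ - η by abel]
  rw [e1, e2]

lemma continuous_fourier_holder (B : C3 →L[ℂ] C3 →L[ℂ] C3) (ξ : R3) :
    Continuous fun q : Lp C3 2 (volume : Measure R3) × Lp C3 2 (volume : Measure R3) =>
      Real.Lp.fourierTransformCLM R3 C3 (B.holderL volume 2 2 1 q.1 q.2) ξ := by
  have c1 : Continuous fun h : Lp C3 1 (volume : Measure R3) =>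
      Real.Lp.fourierTransformCLM R3 C3 h ξ :=
    ((BoundedContinuousFunction.evalCLM ℂ ξ).comp (Real.Lp.fourierTransformCLM R3 C3)).continuous
  have c2 : Continuous fun q : Lp C3 2 (volume : Measure R3) × Lp C3 2 (volume : Measure R3) =>
      B.holderL (volume : Measure R3) 2 2 1 q.1 q.2 := (B.holderL volume 2 2 1).continuous₂
  exact c1.comp c2

lemma continuous_lpPairing_fourier (B : C3 →L[ℂ] C3 →L[ℂ] C3) (ξ : R3) :
    Continuous fun q : Lp C3 2 (volume : Measure R3) × Lp C3 2 (volume : Measure R3) =>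
      B.lpPairing (volume : Measure R3) 2 2 (𝓕 q.1) (flipLp ξ (𝓕 q.2)) := by
  have cF : Continuous (fun f : Lp C3 2 (volume : Measure R3) =>
      (𝓕 f : Lp C3 2 (volume : Measure R3))) := FourierTransform.continuous_fourier
  have cF2 : Continuous (fun f : Lp C3 2 (volume : Measure R3) =>
      flipLp ξ (𝓕 f : Lp C3 2 (volume : Measure R3))) := (flipLp ξ).continuous.comp cF
  have c3 : Continuous (fun f : Lp C3 2 (volume : Measure R3) =>
      B.lpPairing (volume : Measure R3) 2 2 (𝓕 f)) := (B.lpPairing volume 2 2).continuous.comp cF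
  have c4 := c3.comp (continuous_fst (X := Lp C3 2 (volume : Measure R3))
    (Y := Lp C3 2 (volume : Measure R3)))
  have c5 := cF2.comp (continuous_snd (X := Lp C3 2 (volume : Measure R3))
    (Y := Lp C3 2 (volume : Measure R3)))
  simpa only [Function.comp_def] using c4.clm_apply c5

/-- The Fourier transform of a product of square integrable functions is a convolution. -/
theorem fourier_bilin_eq_integral (B : C3 →L[ℂ] C3 →L[ℂ] C3)
    (f g : Lp C3 2 (volume : Measure R3)) (ξ : R3) :
    𝓕 (fun x => B (f x) (g x)) ξ
      = ∫ η : R3, B ((𝓕 f : Lp C3 2 (volume : Measure R3)) η)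
        ((𝓕 g : Lp C3 2 (volume : Measure R3)) (ξ - η)) := by
  set L : Lp C3 2 (volume : Measure R3) → Lp C3 2 (volume : Measure R3) → C3 := fun f g =>
    Real.Lp.fourierTransformCLM R3 C3 (B.holderL volume 2 2 1 f g) ξ with hL
  set R : Lp C3 2 (volume : Measure R3) → Lp C3 2 (volume : Measure R3) → C3 := fun f g =>
    B.lpPairing volume 2 2 (𝓕 f) (flipLp ξ (𝓕 g)) with hR
  have eL : ∀ f g, L f g = 𝓕 (fun x => B (f x) (g x)) ξ := by
    intro f g
    simp only [hL, Real.Lp.fourierTransformCLM_apply, Real.Lp.fourierTransform_apply]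
    exact Real.fourier_congr_ae (B.coeFn_holder f g) ξ
  have eR : ∀ f g, R f g = ∫ η : R3, B ((𝓕 f : Lp C3 2 (volume : Measure R3)) η)
        ((𝓕 g : Lp C3 2 (volume : Measure R3)) (ξ - η)) := by
    intro f g
    simp only [hR, ContinuousLinearMap.lpPairing_eq_integral]
    apply integral_congr_ae
    filter_upwards [coeFn_flipLp ξ (𝓕 g)] with η h
    rw [h]
  -- `L` and `R` are jointly continuous on L² × L²: the first factors through L¹ and its bounded
  -- continuous transform, the second is a pairing with a reflected translate. So Schwartz functions
  -- suffice.
  rw [← eL, ← eR]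
  refine DenseRange.induction_on₂ (p := fun f g => L f g = R f g)
    (SchwartzMap.denseRange_toLpCLM (F := C3) (p := 2)
      (μ := (volume : Measure R3)) ENNReal.ofNat_ne_top) ?_ ?_ f g
  · exact isClosed_eq (continuous_fourier_holder B ξ) (continuous_lpPairing_fourier B ξ)
  · intro φ ψ
    rw [eL, eR, SchwartzMap.toLpCLM_apply, SchwartzMap.toLpCLM_apply, SchwartzMap.toLp_fourier_eq,
      SchwartzMap.toLp_fourier_eq]
    have h1 : (fun x => B ((φ.toLp 2 (volume : Measure R3)) x) ((ψ.toLp 2 (volume : Measure R3)) x))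
        =ᵐ[volume] fun x => B (φ x) (ψ x) := by
      filter_upwards [φ.coeFn_toLp 2 volume, ψ.coeFn_toLp 2 volume] with x h1 h2
      rw [h1, h2]
    rw [Real.fourier_congr_ae h1, fourier_bilin_schwartz]
    apply integral_congr_ae
    have hq := (Measure.measurePreserving_sub_left (volume : Measure R3) ξ).quasiMeasurePreserving
    filter_upwards [(𝓕 φ).coeFn_toLp 2 volume, hq.ae ((𝓕 ψ).coeFn_toLp 2 volume)] with η h2 h3
    rw [h2, h3]

lemma integral_fourier_smul_flip {f : R3 → ℂ} {g : R3 → C3} (hf : Integrable f)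
    (hg : Integrable g) : ∫ ξ, (𝓕 f ξ) • g ξ = ∫ x, f x • 𝓕 g x := by
  simpa using! VectorFourier.integral_fourierIntegral_smul_eq_flip (L := innerₗ R3)
    Real.continuous_fourierChar continuous_inner hf hg

lemma ae_eq_of_forall_schwartz {f g : R3 → C3} (hf : LocallyIntegrable f)
    (hg : LocallyIntegrable g)
    (h : ∀ ψ : 𝓢(R3, ℂ), ∫ x, (𝓕 ψ) x • f x = ∫ x, (𝓕 ψ) x • g x) : f =ᵐ[volume] g := by
  apply ae_eq_of_integral_contDiff_smul_eq hf hg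
  intro χ hχ hc
  have h1 : HasCompactSupport (Complex.ofRealCLM ∘ χ) := hc.comp_left rfl
  have h2 : ContDiff ℝ ∞ (Complex.ofRealCLM ∘ χ) := by fun_prop
  have := h (𝓕⁻ (h1.toSchwartzMap h2))
  rw [FourierTransform.fourier_fourierInv_eq] at this
  simpa using this

lemma integral_fourier_smul_Lp (f : Lp C3 2 (volume : Measure R3)) (ψ : 𝓢(R3, ℂ)) :
    ∫ x, (𝓕 ψ) x • f x = ∫ ξ, ψ ξ • (𝓕 f : Lp C3 2 (volume : Measure R3)) ξ := by
  have := congrArg (fun T => T ψ) (Lp.fourier_toTemperedDistribution_eq f)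
  simpa using this

/-- A product of two L² fields is a priori only in L¹. This recovers its square integrability from a
bound on its L¹ transform, by comparing both sides as tempered distributions. -/
lemma ae_eq_Lp_of_fourier_ae_eq {h : R3 → C3} (hh : Integrable h)
    (F : Lp C3 2 (volume : Measure R3)) (hF : 𝓕 h =ᵐ[volume] F) :
    (𝓕⁻ F : Lp C3 2 (volume : Measure R3)) =ᵐ[volume] h := by
  apply ae_eq_of_forall_schwartz
    ((Lp.memLp _).locallyIntegrable one_le_two) hh.locallyIntegrable
  intro ψ
  rw [integral_fourier_smul_Lp, FourierTransform.fourier_fourierInv_eq, SchwartzMap.fourier_coe,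
    integral_fourier_smul_flip ψ.integrable hh]
  apply integral_congr_ae
  filter_upwards [hF] with x hx
  rw [hx]

/-- Fourier inversion for an `L²` function with integrable transform. -/
lemma ae_eq_fourierInv_of_integrable (f : Lp C3 2 (volume : Measure R3))
    (hf : Integrable (𝓕 f : Lp C3 2 (volume : Measure R3))) :
    f =ᵐ[volume] 𝓕⁻ ((𝓕 f : Lp C3 2 (volume : Measure R3)) : R3 → C3) := by
  set F : Lp C3 2 (volume : Measure R3) := 𝓕 f with hF
  have hc : Continuous (𝓕⁻ (F : R3 → C3)) := by
    rw [Real.fourierInv_eq_fourier_comp_neg]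
    exact VectorFourier.fourierIntegral_continuous Real.continuous_fourierChar
      (innerSL ℝ).continuous₂ hf.comp_neg
  apply ae_eq_of_forall_schwartz
    ((Lp.memLp _).locallyIntegrable one_le_two) hc.locallyIntegrable
  intro ψ
  rw [integral_fourier_smul_Lp, ← hF, Real.fourierInv_eq_fourier_comp_neg]
  have h1 := integral_fourier_smul_flip (𝓕 ψ).integrable hf.comp_neg
  rw [← h1, ← integral_neg_eq_self]
  congr 1; ext1 ξ
  congr 1
  have h2 : (𝓕⁻ (𝓕 ψ)) (-ξ) = ψ (-ξ) := by rw [FourierTransform.fourierInv_fourier_eq]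
  rw [SchwartzMap.fourierInv_coe, Real.fourierInv_eq_fourier_neg, neg_neg] at h2
  exact h2.symm

/-! ### The convolution estimate with homogeneous kernels -/

/-- The homogeneous kernel `‖η‖ ^ (-a)`. -/
def riesz (a : ℝ) (η : R3) : ℝ≥0∞ := ENNReal.ofReal (‖η‖ ^ (-a))

lemma measurable_riesz (a : ℝ) : Measurable (riesz a) := by
  unfold riesz; fun_prop

lemma riesz_sq (a : ℝ) (η : R3) : riesz a η ^ 2 = riesz (2 * a) η := by
  rw [riesz, riesz, ← ENNReal.ofReal_pow (by positivity), ← Real.rpow_natCast,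
    ← Real.rpow_mul (norm_nonneg _)]
  congr 2; push_cast; ring

lemma lintegral_comp_smul_R3 {g : R3 → ℝ≥0∞} (hg : Measurable g) {R : ℝ} (hR : 0 < R) :
    ∫⁻ η, g η = ENNReal.ofReal (R ^ 3) * ∫⁻ η, g (R • η) := by
  have h := Measure.map_addHaar_smul (volume : Measure R3) hR.ne'
  have h1 : ∫⁻ η, g (R • η) = ENNReal.ofReal |(R ^ 3)⁻¹| * ∫⁻ η, g η := by
    rw [← lintegral_map (f := g) hg (measurable_const_smul R), h, lintegral_smul_measure]
    simp
  rw [h1, ← mul_assoc, ← ENNReal.ofReal_mul (by positivity), abs_of_pos (by positivity),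
    mul_inv_cancel₀ (by positivity), ENNReal.ofReal_one, one_mul]

/-- In polar coordinates the integrand is y^(2-a), which is integrable at 0 exactly when a < 3. -/
lemma lintegral_riesz_ball_one {a : ℝ} (ha : a < 3) :
    ∫⁻ η in Metric.ball (0 : R3) 1, riesz a η < ⊤ := by
  have h : IntegrableOn (fun x : R3 => (fun y : ℝ => y ^ (-a)) ‖x‖) (Metric.ball (0 : R3) 1) := by
    refine (integrableOn_fun_norm_addHaar volume (f := fun y : ℝ => y ^ (-a))).2 ?_
    have h2 : IntegrableOn (fun y : ℝ => y ^ (2 - a)) (Ioo 0 1) :=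
      (intervalIntegral.integrableOn_Ioo_rpow_iff one_pos).2 (by linarith)
    refine h2.congr_fun (fun y hy => ?_) measurableSet_Ioo
    simp only [finrank_euclideanSpace, Fintype.card_fin, smul_eq_mul]
    rw [← Real.rpow_natCast, ← Real.rpow_add hy.1]
    norm_num [sub_eq_add_neg]
  have := h.lintegral_lt_top
  exact this

lemma lintegral_riesz_ball {a : ℝ} (ha : a < 3) :
    ∃ K : ℝ≥0∞, K ≠ ⊤ ∧ ∀ R : ℝ, 0 < R → ∫⁻ η in Metric.ball (0 : R3) R, riesz a η
      ≤ K * ENNReal.ofReal (R ^ (3 - a)) := by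
  refine ⟨_, (lintegral_riesz_ball_one ha).ne, fun R hR => le_of_eq ?_⟩
  rw [← lintegral_indicator measurableSet_ball, lintegral_comp_smul_R3
    ((measurable_riesz a).indicator measurableSet_ball) hR, ← lintegral_indicator measurableSet_ball]
  have h : ∀ η : R3, (Metric.ball (0 : R3) R).indicator (riesz a) (R • η)
      = ENNReal.ofReal (R ^ (-a)) * (Metric.ball (0 : R3) 1).indicator (riesz a) η := by
    intro η
    have hm : R • η ∈ Metric.ball (0 : R3) R ↔ η ∈ Metric.ball (0 : R3) 1 := by
      rw [mem_ball_zero_iff, mem_ball_zero_iff, norm_smul, Real.norm_of_nonneg hR.le]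
      exact mul_lt_iff_lt_one_right hR
    by_cases hη : η ∈ Metric.ball (0 : R3) 1
    · rw [indicator_of_mem hη, indicator_of_mem (hm.2 hη), riesz, riesz, norm_smul,
        Real.norm_of_nonneg hR.le, Real.mul_rpow hR.le (norm_nonneg _),
        ENNReal.ofReal_mul (by positivity)]
    · rw [indicator_of_notMem hη, indicator_of_notMem (fun h => hη (hm.1 h)), mul_zero]
  simp_rw [h]
  rw [lintegral_const_mul _ ((measurable_riesz a).indicator measurableSet_ball), ← mul_assoc,
    ← ENNReal.ofReal_mul (by positivity), mul_comm, ← Real.rpow_natCast, ← Real.rpow_add hR]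
  norm_num [sub_eq_add_neg]

lemma lintegral_mul_sq_le {f g : R3 → ℝ≥0∞} (hf : Measurable f) (hg : Measurable g) :
    (∫⁻ x, f x * g x) ^ 2 ≤ (∫⁻ x, f x ^ 2) * ∫⁻ x, g x ^ 2 := by
  have h := ENNReal.lintegral_mul_le_Lp_mul_Lq (volume : Measure R3) Real.HolderConjugate.two_two
    hf.aemeasurable hg.aemeasurable
  have h2 := pow_le_pow_left' h 2
  refine h2.trans (le_of_eq ?_)
  rw [mul_pow, ← ENNReal.rpow_natCast, ← ENNReal.rpow_natCast, ← ENNReal.rpow_mul,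
    ← ENNReal.rpow_mul]
  norm_num

lemma lintegral_conv_sq {G H : R3 → ℝ≥0∞} (hG : Measurable G) (hH : Measurable H) :
    ∫⁻ ξ : R3, ∫⁻ η : R3, G η * H (ξ - η) = (∫⁻ η, G η) * ∫⁻ η, H η := by
  rw [lintegral_lintegral_swap]
  · have : ∀ η : R3, ∫⁻ ξ : R3, G η * H (ξ - η) = G η * ∫⁻ ξ, H ξ := by
      intro η
      rw [lintegral_const_mul _ (by fun_prop), lintegral_sub_right_eq_self H η]
    simp_rw [this]
    rw [lintegral_mul_const _ hG]
  · apply Measurable.aemeasurable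
    fun_prop

/-- The two singularities η = 0 and η = ξ are separated: at least one of ‖η‖ and ‖ξ - η‖ is ≥ ‖ξ‖/2,
and the corresponding factor is replaced by its value there. -/
lemma riesz_mul_le {ξ η : R3} (hξ : ξ ≠ 0) (h : ‖η‖ < 2 * ‖ξ‖) :
    riesz (5 / 2) η * riesz (1 / 2) (ξ - η) ≤
      ENNReal.ofReal ((‖ξ‖ / 2) ^ (-(1 / 2) : ℝ)) *
        (Metric.ball (0 : R3) (2 * ‖ξ‖)).indicator (riesz (5 / 2)) η +
      ENNReal.ofReal ((‖ξ‖ / 2) ^ (-(5 / 2) : ℝ)) *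
        (Metric.ball (0 : R3) (3 * ‖ξ‖)).indicator (riesz (1 / 2)) (ξ - η) := by
  have hξ' : 0 < ‖ξ‖ := norm_pos_iff.2 hξ
  have htri : ‖ξ - η‖ ≤ ‖ξ‖ + ‖η‖ := norm_sub_le _ _
  rw [indicator_of_mem (by simpa using h), indicator_of_mem (by
    rw [mem_ball_zero_iff]; linarith)]
  rcases le_or_gt (‖ξ‖ / 2) ‖ξ - η‖ with h1 | h1
  · refine le_trans ?_ le_self_add
    rw [mul_comm]
    gcongr
    exact ENNReal.ofReal_le_ofReal (Real.rpow_le_rpow_of_nonpos (by positivity) h1 (by norm_num))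
  · refine le_trans ?_ le_add_self
    gcongr
    have h2 : ‖ξ‖ / 2 ≤ ‖η‖ := by
      have : ‖ξ‖ ≤ ‖ξ - η‖ + ‖η‖ := by simpa using norm_add_le (ξ - η) η
      linarith
    exact ENNReal.ofReal_le_ofReal (Real.rpow_le_rpow_of_nonpos (by positivity) h2 (by norm_num))

/-- The exponents add up to the dimension, 5/2 + 1/2 = 3, so all powers of ‖ξ‖ cancel and the bound
is uniform. For the same reason the integral over the whole space would diverge logarithmically,
which forces the restriction to a ball. -/
lemma lintegral_riesz_near : ∃ K : ℝ≥0∞, K ≠ ⊤ ∧ ∀ ξ : R3, ξ ≠ 0 →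
    ∫⁻ η : R3, (Metric.ball (0 : R3) (2 * ‖ξ‖)).indicator
      (fun η => riesz (5 / 2) η * riesz (1 / 2) (ξ - η)) η ≤ K := by
  obtain ⟨K₁, hK₁, h₁⟩ := lintegral_riesz_ball (a := 5 / 2) (by norm_num)
  obtain ⟨K₂, hK₂, h₂⟩ := lintegral_riesz_ball (a := 1 / 2) (by norm_num)
  refine ⟨K₁ * ENNReal.ofReal ((1 / 2 : ℝ) ^ (-(1 / 2) : ℝ) * (2 : ℝ) ^ (3 - 5 / 2 : ℝ)) +
    K₂ * ENNReal.ofReal ((1 / 2 : ℝ) ^ (-(5 / 2) : ℝ) * (3 : ℝ) ^ (3 - 1 / 2 : ℝ)),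
    by finiteness, fun ξ hξ => ?_⟩
  have hξ' : 0 < ‖ξ‖ := norm_pos_iff.2 hξ
  have hm1 := (measurable_riesz (5 / 2)).indicator
    (measurableSet_ball (x := (0 : R3)) (ε := 2 * ‖ξ‖))
  have hm2 := (measurable_riesz (1 / 2)).indicator
    (measurableSet_ball (x := (0 : R3)) (ε := 3 * ‖ξ‖))
  calc _ ≤ ∫⁻ η : R3, (ENNReal.ofReal ((‖ξ‖ / 2) ^ (-(1 / 2) : ℝ)) *
        (Metric.ball (0 : R3) (2 * ‖ξ‖)).indicator (riesz (5 / 2)) η +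
      ENNReal.ofReal ((‖ξ‖ / 2) ^ (-(5 / 2) : ℝ)) *
        (Metric.ball (0 : R3) (3 * ‖ξ‖)).indicator (riesz (1 / 2)) (ξ - η)) := by
        apply lintegral_mono
        intro η
        by_cases hη : η ∈ Metric.ball (0 : R3) (2 * ‖ξ‖)
        · rw [indicator_of_mem hη]
          exact riesz_mul_le hξ (by simpa using hη)
        · rw [indicator_of_notMem hη]; exact zero_le
    _ ≤ _ := by
        rw [lintegral_add_left (by fun_prop), lintegral_const_mul _ hm1,
          lintegral_const_mul _ (by fun_prop),
          lintegral_sub_left_eq_self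
            ((Metric.ball (0 : R3) (3 * ‖ξ‖)).indicator (riesz (1 / 2))) ξ,
          lintegral_indicator measurableSet_ball, lintegral_indicator measurableSet_ball]
        have key : ∀ (c a : ℝ) (K : ℝ≥0∞), 0 < c → ENNReal.ofReal ((‖ξ‖ / 2) ^ (-(3 - a)))
            * (K * ENNReal.ofReal ((c * ‖ξ‖) ^ (3 - a)))
            = K * ENNReal.ofReal ((1 / 2 : ℝ) ^ (-(3 - a)) * c ^ (3 - a)) := by
          intro c a K hc
          rw [mul_left_comm, ← ENNReal.ofReal_mul (by positivity)]
          congr 2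
          rw [Real.mul_rpow hc.le hξ'.le, div_eq_mul_one_div, Real.mul_rpow hξ'.le (by norm_num),
            Real.rpow_neg hξ'.le]
          field_simp
        refine add_le_add ?_ ?_
        · refine (mul_le_mul_right (h₁ (2 * ‖ξ‖) (by positivity)) _).trans (le_of_eq ?_)
          have := key 2 (5 / 2) K₁ (by norm_num)
          norm_num at this ⊢
          exact this
        · refine (mul_le_mul_right (h₂ (3 * ‖ξ‖) (by positivity)) _).trans (le_of_eq ?_)
          have := key 3 (1 / 2) K₂ (by norm_num)
          norm_num at this ⊢
          exact this

lemma riesz_far {ξ η : R3} (h : 2 * ‖ξ‖ ≤ ‖η‖) :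
    riesz (5 / 4) η * riesz (1 / 4) (ξ - η) ≤
      ENNReal.ofReal (2 ^ (1 / 4 : ℝ)) * (riesz (3 / 4) η * riesz (3 / 4) η) := by
  -- At the origin the left side vanishes, because `0 ^ (-(5 / 4)) = 0` in `Real.rpow`.
  rcases eq_or_ne η 0 with rfl | hη
  · rw [riesz, norm_zero, Real.zero_rpow (by norm_num)]; simp
  have hη' : 0 < ‖η‖ := norm_pos_iff.2 hη
  have h1 : ‖η‖ / 2 ≤ ‖ξ - η‖ := by
    have := norm_sub_norm_le η ξ
    rw [norm_sub_rev] at this; linarith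
  have h2 : riesz (1 / 4) (ξ - η) ≤ ENNReal.ofReal ((‖η‖ / 2) ^ (-(1 / 4) : ℝ)) :=
    ENNReal.ofReal_le_ofReal (Real.rpow_le_rpow_of_nonpos (by positivity) h1 (by norm_num))
  refine (mul_le_mul_right h2 _).trans (le_of_eq ?_)
  rw [riesz, riesz, ← ENNReal.ofReal_mul (by positivity), ← ENNReal.ofReal_mul (by positivity),
    ← ENNReal.ofReal_mul (by positivity), ← Real.rpow_add hη', Real.div_rpow hη'.le (by norm_num),
    Real.rpow_neg (by norm_num : (0 : ℝ) ≤ 2), div_inv_eq_mul, ← mul_assoc, ← Real.rpow_add hη',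
    mul_comm]
  norm_num

/-- The Sobolev type product estimate behind `‖(f · ∇) g‖ ≤ K ‖A ^ (5/4) f‖ ‖A ^ (5/4) g‖`. -/
theorem lintegral_riesz_conv_sq_le : ∃ K : ℝ≥0∞, K ≠ ⊤ ∧ ∀ G H : R3 → ℝ≥0∞,
    Measurable G → Measurable H →
    ∫⁻ ξ : R3, (∫⁻ η : R3, riesz (5 / 4) η * riesz (1 / 4) (ξ - η) * (G η * H (ξ - η))) ^ 2
      ≤ K * ((∫⁻ η, G η ^ 2) * ∫⁻ η, H η ^ 2) := by
  obtain ⟨K₁, hK₁, h₁⟩ := lintegral_riesz_near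
  obtain ⟨K₂, hK₂, h₂⟩ := lintegral_riesz_ball (a := 3 / 2) (by norm_num)
  set c : ℝ≥0∞ := ENNReal.ofReal (2 ^ (1 / 4 : ℝ)) with hc
  refine ⟨4 * (K₁ + c ^ 2 * K₂), by finiteness, fun G H hG hH => ?_⟩
  have hr := measurable_riesz
  set S : R3 → Set R3 := fun ξ => Metric.ball (0 : R3) (2 * ‖ξ‖) with hS
  have hSm : ∀ ξ, MeasurableSet (S ξ) := fun ξ => measurableSet_ball
  set I := ∫⁻ η, G η ^ 2
  set J := ∫⁻ η, H η ^ 2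
  -- the part near the origin
  set T₁ : R3 → ℝ≥0∞ := fun ξ => ∫⁻ η in S ξ,
    riesz (5 / 4) η * riesz (1 / 4) (ξ - η) * (G η * H (ξ - η)) with hT₁
  set T₂ : R3 → ℝ≥0∞ := fun ξ => ∫⁻ η in (S ξ)ᶜ,
    riesz (5 / 4) η * riesz (1 / 4) (ξ - η) * (G η * H (ξ - η)) with hT₂
  -- Cauchy–Schwarz with the whole kernel on one side; its square is integrable on the ball,
  -- uniformly in ξ.
  have hb₁ : ∀ ξ, ξ ≠ 0 → T₁ ξ ^ 2 ≤ K₁ * ∫⁻ η, G η ^ 2 * H (ξ - η) ^ 2 := by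
    intro ξ hξ
    have e : T₁ ξ = ∫⁻ η, (S ξ).indicator
        (fun η => riesz (5 / 4) η * riesz (1 / 4) (ξ - η)) η * (G η * H (ξ - η)) := by
      rw [hT₁]
      simp only
      rw [← lintegral_indicator (hSm ξ)]
      congr 1; ext1 η
      by_cases hη : η ∈ S ξ <;> simp [hη]
    rw [e]
    refine (lintegral_mul_sq_le (Measurable.indicator (by fun_prop) (hSm ξ)) (by fun_prop)).trans ?_
    simp_rw [mul_pow]
    refine mul_le_mul_left ?_ _
    refine le_trans (le_of_eq ?_) (h₁ ξ hξ)
    congr 1; ext1 η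
    by_cases hη : η ∈ S ξ
    · simp only [hη, indicator_of_mem, mul_pow, riesz_sq]
      rw [indicator_of_mem (show η ∈ Metric.ball (0 : R3) (2 * ‖ξ‖) from hη)]
      norm_num
    · simp only [hη, not_false_eq_true, indicator_of_notMem]
      rw [indicator_of_notMem (show η ∉ Metric.ball (0 : R3) (2 * ‖ξ‖) from hη)]
      simp
  -- Far out the kernel is at most c ‖η‖^(-3/2) ≤ c ‖ξ‖^(-3/4) ‖η‖^(-3/4). Cauchy–Schwarz now leaves
  -- `H` alone on one side. The factor ‖ξ‖^(-3/2) on ‖ξ‖ < ‖η‖ integrates to a multiple of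
  -- ‖η‖^(3/2), which cancels ‖η‖^(-3/2) in `hI₂`.
  have hb₂ : ∀ ξ, ξ ≠ 0 → T₂ ξ ^ 2 ≤ c ^ 2 * ((∫⁻ η, (Metric.ball (0 : R3) ‖η‖).indicator
      (riesz (3 / 2)) ξ * (riesz (3 / 2) η * G η ^ 2)) * J) := by
    intro ξ hξ
    have e : T₂ ξ ≤ c * ∫⁻ η, (S ξ)ᶜ.indicator
        (fun η => riesz (3 / 4) ξ * (riesz (3 / 4) η * G η)) η * H (ξ - η) := by
      rw [hT₂]
      simp only
      rw [← lintegral_indicator (hSm ξ).compl, ← lintegral_const_mul' _ _ ENNReal.ofReal_ne_top]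
      apply lintegral_mono
      intro η
      by_cases hη : η ∈ (S ξ)ᶜ
      · simp only [hη, indicator_of_mem]
        have hη2 : 2 * ‖ξ‖ ≤ ‖η‖ := by simpa [hS] using hη
        have h3 : riesz (3 / 4) η ≤ riesz (3 / 4) ξ := by
          refine ENNReal.ofReal_le_ofReal (Real.rpow_le_rpow_of_nonpos
            (norm_pos_iff.2 hξ) ?_ (by norm_num))
          linarith [norm_nonneg ξ]
        calc _ ≤ c * (riesz (3 / 4) η * riesz (3 / 4) η) * (G η * H (ξ - η)) :=
              mul_le_mul_left (riesz_far hη2) _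
          _ ≤ c * (riesz (3 / 4) ξ * riesz (3 / 4) η) * (G η * H (ξ - η)) := by gcongr
          _ = _ := by ring
      · simp [hη]
    refine (pow_le_pow_left' e 2).trans ?_
    rw [mul_pow]
    refine mul_le_mul_right ((lintegral_mul_sq_le (Measurable.indicator (by fun_prop) (hSm ξ).compl)
      (by fun_prop)).trans ?_) _
    rw [lintegral_sub_left_eq_self (fun x => H x ^ 2) ξ]
    refine mul_le_mul_left (lintegral_mono fun η => ?_) _
    by_cases hη : η ∈ (S ξ)ᶜ
    · have hη2 : 2 * ‖ξ‖ ≤ ‖η‖ := by simpa [hS] using hη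
      have hξ' := norm_pos_iff.2 hξ
      have hm : ξ ∈ Metric.ball (0 : R3) ‖η‖ := by rw [mem_ball_zero_iff]; linarith
      simp only [hη, hm, indicator_of_mem, mul_pow, riesz_sq]
      norm_num
    · simp [hη]
  have hmeasI : Measurable (fun p : R3 × R3 => (Metric.ball (0 : R3) ‖p.2‖).indicator
      (riesz (3 / 2)) p.1) := by
    have : (fun p : R3 × R3 => (Metric.ball (0 : R3) ‖p.2‖).indicator (riesz (3 / 2)) p.1)
        = {p : R3 × R3 | ‖p.1‖ < ‖p.2‖}.indicator (fun p => riesz (3 / 2) p.1) := by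
      ext p; simp [indicator]
    rw [this]
    exact Measurable.indicator (by fun_prop) (measurableSet_lt (by fun_prop) (by fun_prop))
  have hmeasK : Measurable (fun p : R3 × R3 => (Metric.ball (0 : R3) ‖p.2‖).indicator
      (riesz (3 / 2)) p.1 * (riesz (3 / 2) p.2 * G p.2 ^ 2)) := hmeasI.mul (by fun_prop)
  have hmeasGH : Measurable (fun p : R3 × R3 => G p.2 ^ 2 * H (p.1 - p.2) ^ 2) := by fun_prop
  have hI₁ : ∫⁻ ξ : R3, ∫⁻ η : R3, G η ^ 2 * H (ξ - η) ^ 2 = I * J :=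
    lintegral_conv_sq (hG.pow_const 2) (hH.pow_const 2)
  have hI₂ : ∫⁻ ξ : R3, ∫⁻ η, (Metric.ball (0 : R3) ‖η‖).indicator
      (riesz (3 / 2)) ξ * (riesz (3 / 2) η * G η ^ 2) ≤ K₂ * I := by
    rw [lintegral_lintegral_swap hmeasK.aemeasurable, ← lintegral_const_mul _ (by fun_prop)]
    apply lintegral_mono
    intro η
    simp only
    rw [lintegral_mul_const _ ((hr _).indicator measurableSet_ball),
      lintegral_indicator measurableSet_ball]
    rcases eq_or_ne η 0 with rfl | hη
    · simp
    have hη' := norm_pos_iff.2 hη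
    refine (mul_le_mul_left (h₂ ‖η‖ hη') _).trans (le_of_eq ?_)
    have : ENNReal.ofReal (‖η‖ ^ (3 - 3 / 2 : ℝ)) * riesz (3 / 2) η = 1 := by
      rw [riesz, ← ENNReal.ofReal_mul (by positivity), ← Real.rpow_add hη']
      norm_num
    calc _ = K₂ * (ENNReal.ofReal (‖η‖ ^ (3 - 3 / 2 : ℝ)) * riesz (3 / 2) η) * G η ^ 2 := by ring
      _ = _ := by rw [this, mul_one]
  have hsq : ∀ a b : ℝ≥0∞, (a + b) ^ 2 ≤ 4 * (a ^ 2 + b ^ 2) := by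
    intro a b
    have h1 : a + b ≤ 2 * max a b := by
      rw [two_mul]; exact add_le_add (le_max_left _ _) (le_max_right _ _)
    refine (pow_le_pow_left' h1 2).trans ?_
    rw [mul_pow]
    norm_num
    gcongr
    rcases le_total a b with h | h
    · rw [max_eq_right h]; exact le_add_self
    · rw [max_eq_left h]; exact le_self_add
  have hmT1 : Measurable fun ξ : R3 => ∫⁻ η, G η ^ 2 * H (ξ - η) ^ 2 :=
    hmeasGH.lintegral_prod_right'
  have hmT2 : Measurable fun ξ : R3 => ∫⁻ η, (Metric.ball (0 : R3) ‖η‖).indicator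
      (riesz (3 / 2)) ξ * (riesz (3 / 2) η * G η ^ 2) := hmeasK.lintegral_prod_right'
  calc _ ≤ ∫⁻ ξ : R3, 4 * (K₁ * (∫⁻ η, G η ^ 2 * H (ξ - η) ^ 2) +
        c ^ 2 * ((∫⁻ η, (Metric.ball (0 : R3) ‖η‖).indicator
      (riesz (3 / 2)) ξ * (riesz (3 / 2) η * G η ^ 2)) * J)) := by
        apply lintegral_mono_ae
        filter_upwards [Measure.ae_ne volume (0 : R3)] with ξ hξ
        rw [← lintegral_add_compl _ (hSm ξ)]
        exact (hsq _ _).trans (mul_le_mul_right (add_le_add (hb₁ ξ hξ) (hb₂ ξ hξ)) _)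
    _ = 4 * (K₁ * (I * J) + c ^ 2 * ((∫⁻ ξ : R3, ∫⁻ η, (Metric.ball (0 : R3) ‖η‖).indicator
      (riesz (3 / 2)) ξ * (riesz (3 / 2) η * G η ^ 2)) * J)) := by
        rw [lintegral_const_mul _ (by fun_prop), lintegral_add_left (by fun_prop),
          lintegral_const_mul _ hmT1, hI₁, lintegral_const_mul _ (by fun_prop),
          lintegral_mul_const _ hmT2]
    _ ≤ 4 * (K₁ * (I * J) + c ^ 2 * ((K₂ * I) * J)) := by gcongr
    _ = _ := by ring

/-! ### The product estimate in weighted norms -/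

lemma eLpNorm_two_sq {F : Type*} [NormedAddCommGroup F] (f : R3 → F) :
    eLpNorm f 2 (volume : Measure R3) ^ 2 = ∫⁻ x, ‖f x‖ₑ ^ 2 := by
  rw [eLpNorm_eq_lintegral_rpow_enorm_toReal two_ne_zero ENNReal.ofNat_ne_top,
    ← ENNReal.rpow_natCast, ← ENNReal.rpow_mul]
  norm_num

lemma multNorm_sq (w : R3 → ℂ) (f : L2) :
    multNorm w f ^ 2 = ∫⁻ ξ, ‖w ξ • hat f ξ‖ₑ ^ 2 := eLpNorm_two_sq _

lemma measurable_hat (f : L2) : Measurable (hat f) := (Lp.stronglyMeasurable _).measurable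

lemma measurable_symA (s : ℝ) : Measurable (symA s) := by
  unfold symA; fun_prop

lemma measurable_symD (j : Fin 3) : Measurable (symD j) := by
  unfold symD; fun_prop

lemma isSymbol_symD (j : Fin 3) : IsSymbol (symD j) :=
  ⟨measurable_symD j, fun ξ => by simp [symD, Complex.conj_ofNat]⟩

lemma isSymbol_symA (s : ℝ) : IsSymbol (symA s) :=
  IsSymbol.ofReal (a := fun ξ => (2 * Real.pi * ‖ξ‖) ^ s) (by fun_prop) (by simp)

lemma norm_symA (s : ℝ) (ξ : R3) : ‖symA s ξ‖ = (2 * Real.pi * ‖ξ‖) ^ s := by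
  rw [symA, Complex.norm_real, Real.norm_of_nonneg (by positivity)]

lemma norm_symD_le (j : Fin 3) (ξ : R3) : ‖symD j ξ‖ ≤ 2 * Real.pi * ‖ξ‖ := by
  rw [symD]
  simp only [norm_mul, Complex.norm_real, Complex.norm_I, mul_one, Complex.norm_ofNat,
    Real.norm_eq_abs, abs_of_pos Real.pi_pos]
  exact mul_le_mul_of_nonneg_left (by simpa using PiLp.norm_apply_le ξ j) (by positivity)

/-- The pointwise product of two real fields given by a bilinear map of `ℂ³`. -/
def prodFun (B : C3 →L[ℂ] C3 →L[ℂ] C3) (f g : L2) (x : R3) : R3 :=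
  reC (B (complexify (f x)) (complexify (g x)))

/-- Bilinear maps of `ℂ³` which map real vectors to real vectors. -/
def IsRealBilin (B : C3 →L[ℂ] C3 →L[ℂ] C3) : Prop :=
  ∀ x y : R3, conjC (B (complexify x) (complexify y)) = B (complexify x) (complexify y)

lemma complexify_prodFun {B : C3 →L[ℂ] C3 →L[ℂ] C3} (hB : IsRealBilin B) (f g : L2) :
    (fun x => complexify (prodFun B f g x)) =ᵐ[volume]
      fun x => B (complexify.compLp f x) (complexify.compLp g x) := by
  filter_upwards [complexify.coeFn_compLp f, complexify.coeFn_compLp g] with x h1 h2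
  rw [h1, h2, prodFun, complexify_reC (hB _ _)]

lemma integrable_complexify_prodFun {B : C3 →L[ℂ] C3 →L[ℂ] C3} (hB : IsRealBilin B) (f g : L2) :
    Integrable (fun x => complexify (prodFun B f g x)) := by
  refine Integrable.congr ?_ (complexify_prodFun hB f g).symm
  exact memLp_one_iff_integrable.1
    (B.memLp_of_bilin 1 (Lp.memLp (complexify.compLp f)) (Lp.memLp (complexify.compLp g)))

lemma fourier_prodFun {B : C3 →L[ℂ] C3 →L[ℂ] C3} (hB : IsRealBilin B) (f g : L2) (ξ : R3) :
    𝓕 (fun x => complexify (prodFun B f g x)) ξ = ∫ η : R3, B (hat f η) (hat g (ξ - η)) := by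
  rw [Real.fourier_congr_ae (complexify_prodFun hB f g), fourier_bilin_eq_integral]
  rfl

/-- Submultiplicative weights on the Fourier side. -/
structure IsWeight (W : R3 → ℝ) : Prop where
  meas : Measurable W
  nonneg : ∀ ξ, 0 ≤ W ξ
  le_mul : ∀ ξ η, W ξ ≤ W η * W (ξ - η)

lemma isWeight_one : IsWeight (fun _ => 1) := ⟨measurable_const, by simp, by simp⟩

/-- Extracts the kernels from A^(5/4): `a = 5 / 4` serves the undifferentiated factor, `a = 1 / 4`
the factor carrying one derivative. The powers of 2π are discarded using 2π ≥ 1. -/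
lemma enorm_smul_hat_le_riesz {a : ℝ} (ha : 0 ≤ a) (f : L2) {η : R3} (hη : η ≠ 0) (c : ℂ) :
    ENNReal.ofReal ((2 * Real.pi * ‖η‖) ^ (5 / 4 - a)) * ‖c • hat f η‖ₑ ≤
      riesz a η * ‖(c * symA (5 / 4) η) • hat f η‖ₑ := by
  have hη' : 0 < ‖η‖ := norm_pos_iff.2 hη
  have h2 : (1 : ℝ) ≤ 2 * Real.pi := by linarith [Real.pi_gt_three]
  rw [mul_comm c, mul_smul, enorm_smul (symA _ _), ← mul_assoc]
  refine mul_le_mul_left ?_ _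
  rw [riesz, ← ofReal_norm, ← ENNReal.ofReal_mul (by positivity), norm_symA]
  apply ENNReal.ofReal_le_ofReal
  rw [Real.mul_rpow (by positivity) hη'.le, Real.mul_rpow (by positivity) hη'.le, mul_left_comm,
    ← Real.rpow_add hη', show -a + 5 / 4 = 5 / 4 - a by ring]
  exact mul_le_mul_of_nonneg_right (Real.rpow_le_rpow_of_exponent_le h2 (by linarith))
    (by positivity)

lemma enorm_bilin_le (B : C3 →L[ℂ] C3 →L[ℂ] C3) (u v : C3) :
    ‖B u v‖ₑ ≤ ‖B‖ₑ * (‖u‖ₑ * ‖v‖ₑ) := by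
  rw [← ofReal_norm, ← ofReal_norm, ← ofReal_norm, ← ofReal_norm, ← ENNReal.ofReal_mul (norm_nonneg _),
    ← ENNReal.ofReal_mul (norm_nonneg _), ← mul_assoc]
  exact ENNReal.ofReal_le_ofReal (B.le_opNorm₂ u v)

/-- Submultiplicativity distributes the weight over the two factors of the convolution. All
cancellation is given up, so one estimate covers all weights, with a constant independent of `W`. -/
lemma enorm_weight_conv_le (B : C3 →L[ℂ] C3 →L[ℂ] C3) {W : R3 → ℝ} (hW : IsWeight W) {f g g' : L2}
    {j : Fin 3} (hg : IsMultiplier (symD j) g g') (ξ : R3) :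
    ‖(W ξ : ℂ) • ∫ η : R3, B (hat f η) (hat g' (ξ - η))‖ₑ ≤
      ‖B‖ₑ * ∫⁻ η : R3, riesz (5 / 4) η * riesz (1 / 4) (ξ - η) *
        (‖((W η : ℂ) * symA (5 / 4) η) • hat f η‖ₑ *
          ‖((W (ξ - η) : ℂ) * symA (5 / 4) (ξ - η)) • hat g (ξ - η)‖ₑ) := by
  have hWn : ∀ ξ, ‖(W ξ : ℂ)‖ₑ = ENNReal.ofReal (W ξ) := fun ξ => by
    rw [← ofReal_norm, Complex.norm_real, Real.norm_of_nonneg (hW.nonneg ξ)]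
  rw [enorm_smul, hWn]
  refine (mul_le_mul_right (enorm_integral_le_lintegral_enorm _) _).trans ?_
  rw [← lintegral_const_mul' _ _ ENNReal.ofReal_ne_top, ← lintegral_const_mul' _ _ (by finiteness)]
  apply lintegral_mono_ae
  have hq := (Measure.measurePreserving_sub_left (volume : Measure R3) ξ).quasiMeasurePreserving
  filter_upwards [Measure.ae_ne volume (0 : R3), hq.ae (Measure.ae_ne volume (0 : R3)), hq.ae hg]
    with η h1 h2 h3
  have e1 := enorm_smul_hat_le_riesz (a := 5 / 4) (by norm_num) f h1 (W η)
  have e2 := enorm_smul_hat_le_riesz (a := 1 / 4) (by norm_num) g h2 (W (ξ - η))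
  rw [enorm_smul (W _ : ℂ), hWn] at e1 e2
  norm_num at e1 e2
  have e3 : ‖hat g' (ξ - η)‖ₑ ≤ ENNReal.ofReal (2 * Real.pi * ‖ξ - η‖) * ‖hat g (ξ - η)‖ₑ := by
    rw [h3, enorm_smul]
    refine mul_le_mul_left ?_ _
    rw [← ofReal_norm]
    exact ENNReal.ofReal_le_ofReal (norm_symD_le j _)
  calc _ ≤ ENNReal.ofReal (W η * W (ξ - η)) * (‖B‖ₑ * (‖hat f η‖ₑ * ‖hat g' (ξ - η)‖ₑ)) :=
        mul_le_mul' (ENNReal.ofReal_le_ofReal (hW.le_mul ξ η)) (enorm_bilin_le B _ _)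
    _ ≤ ENNReal.ofReal (W η * W (ξ - η)) * (‖B‖ₑ * (‖hat f η‖ₑ *
          (ENNReal.ofReal (2 * Real.pi * ‖ξ - η‖) * ‖hat g (ξ - η)‖ₑ))) := by gcongr
    _ = ‖B‖ₑ * ((ENNReal.ofReal (W η) * ‖hat f η‖ₑ) * (ENNReal.ofReal (2 * Real.pi * ‖ξ - η‖) *
          (ENNReal.ofReal (W (ξ - η)) * ‖hat g (ξ - η)‖ₑ))) := by
        rw [ENNReal.ofReal_mul (hW.nonneg _)]; ring
    _ ≤ _ := by
        rw [mul_mul_mul_comm (riesz _ _)]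
        exact mul_le_mul_right (mul_le_mul' e1 e2) _

/-- The product estimate `‖W(D) (B (f, ∂ⱼ g))‖ ≤ K ‖W(D) A^(5/4) f‖ ‖W(D) A^(5/4) g‖` on the
Fourier side. -/
lemma eLpNorm_conv_le : ∃ K : ℝ, 0 < K ∧ ∀ (B : C3 →L[ℂ] C3 →L[ℂ] C3) (W : R3 → ℝ), IsWeight W →
    ∀ (f g g' : L2) (j : Fin 3), IsMultiplier (symD j) g g' →
    eLpNorm (fun ξ : R3 => (W ξ : ℂ) • ∫ η : R3, B (hat f η) (hat g' (ξ - η))) 2 volume ≤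
      ENNReal.ofReal (K * ‖B‖) * (multNorm (fun ξ => (W ξ : ℂ) * symA (5 / 4) ξ) f *
        multNorm (fun ξ => (W ξ : ℂ) * symA (5 / 4) ξ) g) := by
  obtain ⟨K, hK, h⟩ := lintegral_riesz_conv_sq_le
  refine ⟨K.toReal + 1, by positivity, fun B W hW f g g' j hg => ?_⟩
  have hBn : ENNReal.ofReal ‖B‖ = ‖B‖ₑ := ofReal_norm B
  rw [ENNReal.ofReal_mul (by positivity), hBn]
  have hWm := Complex.measurable_ofReal.comp hW.meas
  have hm : ∀ f : L2, Measurable fun η => ‖((W η : ℂ) * symA (5 / 4) η) • hat f η‖ₑ := fun f =>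
    ((hWm.mul (measurable_symA _)).smul (measurable_hat f)).enorm
  -- The kernel estimate is quadratic; K ≤ (K+1)² avoids taking a square root of the constant.
  have hKK : K ≤ ENNReal.ofReal (K.toReal + 1) ^ 2 := by
    rw [← ENNReal.ofReal_toReal hK, ENNReal.toReal_ofReal (by positivity), ← ENNReal.ofReal_pow
      (by positivity)]
    apply ENNReal.ofReal_le_ofReal
    nlinarith [ENNReal.toReal_nonneg (a := K)]
  rw [← ENNReal.pow_le_pow_left_iff two_ne_zero, eLpNorm_two_sq]
  calc _ ≤ ∫⁻ ξ : R3, ‖B‖ₑ ^ 2 * (∫⁻ η : R3, riesz (5 / 4) η * riesz (1 / 4) (ξ - η) *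
        (‖((W η : ℂ) * symA (5 / 4) η) • hat f η‖ₑ *
          ‖((W (ξ - η) : ℂ) * symA (5 / 4) (ξ - η)) • hat g (ξ - η)‖ₑ)) ^ 2 := by
        apply lintegral_mono
        intro ξ
        simp only
        rw [← mul_pow]
        exact pow_le_pow_left' (enorm_weight_conv_le B hW hg ξ) 2
    _ ≤ ‖B‖ₑ ^ 2 * (K * (multNorm (fun ξ => (W ξ : ℂ) * symA (5 / 4) ξ) f ^ 2 *
        multNorm (fun ξ => (W ξ : ℂ) * symA (5 / 4) ξ) g ^ 2)) := by
        rw [lintegral_const_mul' _ _ (by finiteness), multNorm_sq, multNorm_sq]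
        exact mul_le_mul_right (h _ _ (hm f) (hm g)) _
    _ ≤ _ := by
        rw [mul_pow, mul_pow, mul_pow, mul_comm (_ ^ 2) (‖B‖ₑ ^ 2), mul_assoc]
        gcongr

/-- From x ≤ 1 + x^(5/4). Hence `partialD` is the true derivative, never its default value, whenever
A^(5/4) f ∈ L². -/
lemma multNorm_symD_lt_top {f : L2} (hf : normA (5 / 4) f < ⊤) (j : Fin 3) :
    multNorm (symD j) f < ⊤ := by
  have h := multNorm_le_add (w := symD j) (w₁ := fun _ => 1) (w₂ := symA (5 / 4)) f
    measurable_const (measurable_symA _) (fun ξ => by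
      refine (norm_symD_le j ξ).trans ?_
      rw [norm_symA, norm_one]
      set x := 2 * Real.pi * ‖ξ‖
      have hx : 0 ≤ x := by positivity
      rcases le_total x 1 with h | h
      · linarith [Real.rpow_nonneg hx (5 / 4)]
      · have := Real.rpow_le_rpow_of_exponent_le h (show (1 : ℝ) ≤ 5 / 4 by norm_num)
        rw [Real.rpow_one] at this; linarith)
  rw [multNorm_one] at h
  exact h.trans_lt (ENNReal.add_lt_top.2 ⟨enorm_lt_top, hf⟩)

lemma isMultiplier_partialD {f : L2} (hf : normA (5 / 4) f < ⊤) (j : Fin 3) :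
    IsMultiplier (symD j) f (partialD j f) := by
  have h := exists_isMultiplier (isSymbol_symD j) (multNorm_symD_lt_top hf j)
  rw [partialD, dif_pos h]
  exact h.choose_spec

/-- Products `B (f, ∂ⱼ g)` of fields with `A ^ (5/4) f, A ^ (5/4) g ∈ L²` are square integrable. -/
lemma exists_prodFun_partialD {B : C3 →L[ℂ] C3 →L[ℂ] C3} (hB : IsRealBilin B) {f g : L2}
    (hf : normA (5 / 4) f < ⊤) (hg : normA (5 / 4) g < ⊤) (j : Fin 3) :
    MemLp (prodFun B f (partialD j g)) 2 volume ∧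
    ∀ᵐ ξ, hat (toL2 (prodFun B f (partialD j g))) ξ
      = ∫ η : R3, B (hat f η) (hat (partialD j g) (ξ - η)) := by
  obtain ⟨K, -, hK⟩ := eLpNorm_conv_le
  have hD := isMultiplier_partialD hg j
  have hi := integrable_complexify_prodFun hB f (partialD j g)
  have hc : Continuous (𝓕 (fun x => complexify (prodFun B f (partialD j g) x))) :=
    VectorFourier.fourierIntegral_continuous Real.continuous_fourierChar
      (innerSL ℝ).continuous₂ hi
  -- The estimate with the trivial weight puts the transform of the L¹ product in L²; inversion then
  -- carries this over to the product itself.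
  have hm : MemLp (𝓕 (fun x => complexify (prodFun B f (partialD j g) x))) 2 volume := by
    refine ⟨hc.aestronglyMeasurable, ?_⟩
    have := hK B _ isWeight_one f g _ j hD
    simp only [Complex.ofReal_one, one_smul, one_mul] at this
    simp_rw [← fourier_prodFun hB] at this
    exact this.trans_lt (ENNReal.mul_lt_top ENNReal.ofReal_lt_top (ENNReal.mul_lt_top hf hg))
  have h1 := ae_eq_Lp_of_fourier_ae_eq hi (hm.toLp _) hm.coeFn_toLp.symm
  have h2 : MemLp (prodFun B f (partialD j g)) 2 volume := by
    have h3 := reC.comp_memLp (𝓕⁻ (hm.toLp _) : Lp C3 2 (volume : Measure R3))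
    refine (memLp_congr_ae ?_).1 h3
    filter_upwards [h1] with x hx
    simp only [Function.comp_apply, hx, reC_complexify]
  refine ⟨h2, ?_⟩
  rw [toL2, dif_pos h2]
  have h4 : complexify.compLp (h2.toLp _) = (𝓕⁻ (hm.toLp _) : Lp C3 2 (volume : Measure R3)) := by
    apply Lp.ext
    filter_upwards [complexify.coeFn_compLp (h2.toLp _), h1, h2.coeFn_toLp] with x h5 h6 h7
    rw [h5, h6, h7]
  rw [hat, h4, FourierTransform.fourier_fourierInv_eq]
  filter_upwards [hm.coeFn_toLp] with ξ h5
  rw [h5, fourier_prodFun hB]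

lemma toL2_ae {h : R3 → R3} (hh : MemLp h 2 volume) : toL2 h =ᵐ[volume] h := by
  rw [toL2, dif_pos hh]; exact hh.coeFn_toLp

lemma multNorm_prod_le : ∃ K : ℝ, 0 < K ∧ ∀ (B : C3 →L[ℂ] C3 →L[ℂ] C3), IsRealBilin B →
    ∀ (W : R3 → ℝ), IsWeight W → ∀ (f g : L2) (j : Fin 3), normA (5 / 4) f < ⊤ →
    normA (5 / 4) g < ⊤ → multNorm (fun ξ => (W ξ : ℂ)) (toL2 (prodFun B f (partialD j g))) ≤
      ENNReal.ofReal (K * ‖B‖) * (multNorm (fun ξ => (W ξ : ℂ) * symA (5 / 4) ξ) f *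
        multNorm (fun ξ => (W ξ : ℂ) * symA (5 / 4) ξ) g) := by
  obtain ⟨K, hK0, hK⟩ := eLpNorm_conv_le
  refine ⟨K, hK0, fun B hB W hW f g j hf hg => ?_⟩
  refine le_trans (le_of_eq ?_) (hK B W hW f g _ j (isMultiplier_partialD hg j))
  apply eLpNorm_congr_ae
  filter_upwards [(exists_prodFun_partialD hB hf hg j).2] with ξ h
  rw [h]

/-! ### Bessel weights and the nonlinearity as a bounded bilinear map -/

lemma norm_symBessel (s : ℝ) (ξ : R3) :
    ‖symBessel s ξ‖ = (1 + (2 * Real.pi * ‖ξ‖) ^ 2) ^ (s / 2) := by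
  rw [symBessel, Complex.norm_real, Real.norm_of_nonneg (by positivity)]

lemma measurable_symBessel (s : ℝ) : Measurable (symBessel s) := by
  unfold symBessel; fun_prop

lemma isSymbol_symBessel (s : ℝ) : IsSymbol (symBessel s) :=
  IsSymbol.ofReal (a := fun ξ => (1 + (2 * Real.pi * ‖ξ‖) ^ 2) ^ (s / 2)) (by fun_prop) (by simp)

lemma symBessel_mul (a b : ℝ) (ξ : R3) : symBessel a ξ * symBessel b ξ = symBessel (a + b) ξ := by
  rw [symBessel, symBessel, symBessel, ← Complex.ofReal_mul, ← Real.rpow_add (by positivity)]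
  congr 3; ring

lemma symBessel_zero (ξ : R3) : symBessel 0 ξ = 1 := by simp [symBessel]

lemma norm_symBessel_mono {a b : ℝ} (h : a ≤ b) (ξ : R3) : ‖symBessel a ξ‖ ≤ ‖symBessel b ξ‖ := by
  rw [norm_symBessel, norm_symBessel]
  exact Real.rpow_le_rpow_of_exponent_le (by nlinarith [sq_nonneg (2 * Real.pi * ‖ξ‖)])
    (by linarith)

lemma isBddSymbol_symBessel {s : ℝ} (hs : s ≤ 0) : IsBddSymbol (symBessel s) :=
  ⟨isSymbol_symBessel s, 1, fun ξ => by
    simpa [symBessel_zero] using norm_symBessel_mono hs ξ⟩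

lemma norm_symA_le_symBessel {s : ℝ} (hs : 0 ≤ s) (ξ : R3) : ‖symA s ξ‖ ≤ ‖symBessel s ξ‖ := by
  rw [norm_symA, norm_symBessel]
  set x := 2 * Real.pi * ‖ξ‖
  have hx : 0 ≤ x := by positivity
  calc x ^ s = (x ^ 2) ^ (s / 2) := by
        rw [← Real.rpow_natCast, ← Real.rpow_mul hx]; congr 1; push_cast; ring
    _ ≤ _ := Real.rpow_le_rpow (by positivity) (by linarith) (by linarith)

/-- The submultiplicative multiple of the Bessel weight. -/
def besselWeight (s : ℝ) (ξ : R3) : ℝ := 2 ^ (s / 2) * (1 + (2 * Real.pi * ‖ξ‖) ^ 2) ^ (s / 2)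

lemma ofReal_besselWeight (s : ℝ) (ξ : R3) :
    (besselWeight s ξ : ℂ) = ((2 ^ (s / 2) : ℝ) : ℂ) * symBessel s ξ := by
  rw [besselWeight, symBessel, Complex.ofReal_mul]

lemma isWeight_besselWeight {s : ℝ} (hs : 0 ≤ s) : IsWeight (besselWeight s) := by
  refine ⟨by unfold besselWeight; fun_prop, fun ξ => by unfold besselWeight; positivity,
    fun ξ η => ?_⟩
  unfold besselWeight
  set a := 2 * Real.pi * ‖η‖ with ha
  set b := 2 * Real.pi * ‖ξ - η‖ with hb
  have h : 2 * Real.pi * ‖ξ‖ ≤ a + b := by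
    rw [ha, hb, ← mul_add]
    refine mul_le_mul_of_nonneg_left ?_ (by positivity)
    simpa using norm_add_le η (ξ - η)
  have hc : 0 ≤ 2 * Real.pi * ‖ξ‖ := by positivity
  -- The factor 2 here is what the prefactor 2^(s/2) in `besselWeight` compensates.
  have h2 : 1 + (2 * Real.pi * ‖ξ‖) ^ 2 ≤ 2 * ((1 + a ^ 2) * (1 + b ^ 2)) := by
    nlinarith [pow_le_pow_left₀ hc h 2, sq_nonneg (a - b), mul_nonneg (sq_nonneg a) (sq_nonneg b)]
  have h3 := Real.rpow_le_rpow (by positivity) h2 (show 0 ≤ s / 2 by linarith)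
  rw [Real.mul_rpow (by norm_num) (by positivity), Real.mul_rpow (by positivity) (by positivity)]
    at h3
  calc _ ≤ 2 ^ (s / 2) * (2 ^ (s / 2) * ((1 + a ^ 2) ^ (s / 2) * (1 + b ^ 2) ^ (s / 2))) := by gcongr
    _ = _ := by ring

/-- The linear form `z ↦ (M z)ⱼ`. -/
def rowForm (M : Matrix (Fin 3) (Fin 3) ℝ) (j : Fin 3) : C3 →L[ℂ] ℂ :=
  LinearMap.toContinuousLinearMap
    { toFun := fun z => ∑ k, (M j k : ℂ) * z k
      map_add' := fun x y => by simp [mul_add, Finset.sum_add_distrib]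
      map_smul' := fun c x => by
        simp only [PiLp.smul_apply, smul_eq_mul, RingHom.id_apply, Finset.mul_sum]
        exact Finset.sum_congr rfl fun i _ => by ring }

/-- The bilinear map `(z, w) ↦ (M z)ⱼ w`. -/
def convBilin (M : Matrix (Fin 3) (Fin 3) ℝ) (j : Fin 3) : C3 →L[ℂ] C3 →L[ℂ] C3 :=
  (ContinuousLinearMap.lsmul ℂ ℂ).comp (rowForm M j)

lemma convBilin_apply (M : Matrix (Fin 3) (Fin 3) ℝ) (j : Fin 3) (z w : C3) :
    convBilin M j z w = (∑ k, (M j k : ℂ) * z k) • w := rfl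

lemma rowForm_complexify (M : Matrix (Fin 3) (Fin 3) ℝ) (j : Fin 3) (x : R3) :
    (∑ k, (M j k : ℂ) * complexify x k) = ((matVec M x j : ℝ) : ℂ) := by
  simp [matVec, Matrix.mulVec, dotProduct]

lemma convBilin_complexify (M : Matrix (Fin 3) (Fin 3) ℝ) (j : Fin 3) (x y : R3) :
    convBilin M j (complexify x) (complexify y) = complexify (matVec M x j • y) := by
  rw [convBilin_apply, rowForm_complexify]
  ext i; simp

lemma isRealBilin_convBilin (M : Matrix (Fin 3) (Fin 3) ℝ) (j : Fin 3) :
    IsRealBilin (convBilin M j) := fun x y => by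
  rw [convBilin_complexify, conjC_complexify]

lemma prodFun_convBilin (M : Matrix (Fin 3) (Fin 3) ℝ) (j : Fin 3) (f g : L2) (x : R3) :
    prodFun (convBilin M j) f g x = matVec M (f x) j • g x := by
  rw [prodFun, convBilin_complexify, reC_complexify]

/-- The bilinear form `((M f) · ∇) g` of the nonlinearity. -/
def Nl (M : Matrix (Fin 3) (Fin 3) ℝ) (f g : L2) : L2 :=
  ∑ j : Fin 3, toL2 (prodFun (convBilin M j) f (partialD j g))

lemma toL2_convection (M : Matrix (Fin 3) (Fin 3) ℝ) {f : L2} (hf : normA (5 / 4) f < ⊤) :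
    toL2 (convection M f) = Nl M f f := by
  have hm : ∀ j, MemLp (prodFun (convBilin M j) f (partialD j f)) 2 volume := fun j =>
    (exists_prodFun_partialD (isRealBilin_convBilin M j) hf hf j).1
  have e : convection M f = fun x => ∑ j, prodFun (convBilin M j) f (partialD j f) x := by
    ext1 x; simp only [convection, prodFun_convBilin]
  have hs : MemLp (convection M f) 2 volume := by
    rw [e]; exact memLp_finsetSum _ fun j _ => hm j
  apply Lp.ext
  filter_upwards [toL2_ae hs, toL2_ae (hm 0), toL2_ae (hm 1), toL2_ae (hm 2),
    Lp.coeFn_add (toL2 (prodFun (convBilin M 0) f (partialD 0 f)) +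
      toL2 (prodFun (convBilin M 1) f (partialD 1 f)))
      (toL2 (prodFun (convBilin M 2) f (partialD 2 f))),
    Lp.coeFn_add (toL2 (prodFun (convBilin M 0) f (partialD 0 f)))
      (toL2 (prodFun (convBilin M 1) f (partialD 1 f)))] with x h h0 h1 h2 h3 h4
  rw [h, Nl, Fin.sum_univ_three, h3, Pi.add_apply, h4, Pi.add_apply, h0, h1, h2, e]
  simp only [Fin.sum_univ_three]

lemma normA_add_lt_top {s : ℝ} {f g : L2} (hf : normA s f < ⊤) (hg : normA s g < ⊤) :
    normA s (f + g) < ⊤ :=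
  (multNorm_add_le (measurable_symA s) f g).trans_lt (ENNReal.add_lt_top.2 ⟨hf, hg⟩)

lemma multNorm_real_smul (w : R3 → ℂ) (c : ℝ) (f : L2) :
    multNorm w (c • f) = ‖c‖ₑ * multNorm w f := by
  rw [multNorm, multNorm, hat_smul, ← eLpNorm_const_smul]
  apply eLpNorm_congr_ae
  filter_upwards [Lp.coeFn_smul c (hat f)] with ξ h
  rw [h, Pi.smul_apply, Pi.smul_apply, smul_comm]

lemma normA_smul_lt_top {s : ℝ} {f : L2} (c : ℝ) (hf : normA s f < ⊤) : normA s (c • f) < ⊤ := by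
  rw [normA, multNorm_real_smul]
  exact ENNReal.mul_lt_top enorm_lt_top hf

lemma partialD_add {f g : L2} (hf : normA (5 / 4) f < ⊤) (hg : normA (5 / 4) g < ⊤) (j : Fin 3) :
    partialD j (f + g) = partialD j f + partialD j g :=
  (isMultiplier_partialD (normA_add_lt_top hf hg) j).unique
    (isMultiplier_add (isMultiplier_partialD hf j) (isMultiplier_partialD hg j))

lemma partialD_smul {f : L2} (c : ℝ) (hf : normA (5 / 4) f < ⊤) (j : Fin 3) :
    partialD j (c • f) = c • partialD j f :=
  (isMultiplier_partialD (normA_smul_lt_top c hf) j).unique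
    (isMultiplier_smul c (isMultiplier_partialD hf j))

lemma toL2_add {h h₁ h₂ : R3 → R3} (m₁ : MemLp h₁ 2 volume) (m₂ : MemLp h₂ 2 volume)
    (e : ∀ᵐ x, h x = h₁ x + h₂ x) : toL2 h = toL2 h₁ + toL2 h₂ := by
  have m : MemLp h 2 volume := (memLp_congr_ae e).2 (m₁.add m₂)
  apply Lp.ext
  filter_upwards [toL2_ae m, toL2_ae m₁, toL2_ae m₂, Lp.coeFn_add (toL2 h₁) (toL2 h₂), e]
    with x a b c d f
  rw [a, d, Pi.add_apply, b, c, f]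

lemma toL2_smul {h h₁ : R3 → R3} {c : ℝ} (m₁ : MemLp h₁ 2 volume)
    (e : ∀ᵐ x, h x = c • h₁ x) : toL2 h = c • toL2 h₁ := by
  have m : MemLp h 2 volume := (memLp_congr_ae e).2 (m₁.const_smul c)
  apply Lp.ext
  filter_upwards [toL2_ae m, toL2_ae m₁, Lp.coeFn_smul c (toL2 h₁), e] with x a b d f
  rw [a, d, Pi.smul_apply, b, f]

lemma Nl_add_left (M : Matrix (Fin 3) (Fin 3) ℝ) {f f' g : L2} (hf : normA (5 / 4) f < ⊤)
    (hf' : normA (5 / 4) f' < ⊤) (hg : normA (5 / 4) g < ⊤) :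
    Nl M (f + f') g = Nl M f g + Nl M f' g := by
  rw [Nl, Nl, Nl, ← Finset.sum_add_distrib]
  refine Finset.sum_congr rfl fun j _ => ?_
  refine toL2_add (exists_prodFun_partialD (isRealBilin_convBilin M j) hf hg j).1
    (exists_prodFun_partialD (isRealBilin_convBilin M j) hf' hg j).1 ?_
  filter_upwards [Lp.coeFn_add f f'] with x h
  simp only [prodFun, h, Pi.add_apply, map_add, add_apply]

lemma Nl_add_right (M : Matrix (Fin 3) (Fin 3) ℝ) {f g g' : L2} (hf : normA (5 / 4) f < ⊤)
    (hg : normA (5 / 4) g < ⊤) (hg' : normA (5 / 4) g' < ⊤) :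
    Nl M f (g + g') = Nl M f g + Nl M f g' := by
  rw [Nl, Nl, Nl, ← Finset.sum_add_distrib]
  refine Finset.sum_congr rfl fun j _ => ?_
  refine toL2_add (exists_prodFun_partialD (isRealBilin_convBilin M j) hf hg j).1
    (exists_prodFun_partialD (isRealBilin_convBilin M j) hf hg' j).1 ?_
  rw [partialD_add hg hg']
  filter_upwards [Lp.coeFn_add (partialD j g) (partialD j g')] with x h
  simp only [prodFun, h, Pi.add_apply, map_add]

lemma Nl_smul_left (M : Matrix (Fin 3) (Fin 3) ℝ) {f g : L2} (c : ℝ) (hf : normA (5 / 4) f < ⊤)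
    (hg : normA (5 / 4) g < ⊤) : Nl M (c • f) g = c • Nl M f g := by
  rw [Nl, Nl, Finset.smul_sum]
  refine Finset.sum_congr rfl fun j _ => ?_
  refine toL2_smul (exists_prodFun_partialD (isRealBilin_convBilin M j) hf hg j).1 ?_
  filter_upwards [Lp.coeFn_smul c f] with x h
  simp only [prodFun_convBilin, h, Pi.smul_apply, smul_smul]
  simp [matVec, Matrix.mulVec_smul]

lemma Nl_smul_right (M : Matrix (Fin 3) (Fin 3) ℝ) {f g : L2} (c : ℝ) (hf : normA (5 / 4) f < ⊤)
    (hg : normA (5 / 4) g < ⊤) : Nl M f (c • g) = c • Nl M f g := by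
  rw [Nl, Nl, Finset.smul_sum]
  refine Finset.sum_congr rfl fun j _ => ?_
  refine toL2_smul (exists_prodFun_partialD (isRealBilin_convBilin M j) hf hg j).1 ?_
  rw [partialD_smul c hg]
  filter_upwards [Lp.coeFn_smul c (partialD j g)] with x h
  simp only [prodFun_convBilin, h, Pi.smul_apply, smul_comm c]

lemma multNorm_Nl_le (M : Matrix (Fin 3) (Fin 3) ℝ) : ∃ K : ℝ, 0 < K ∧ ∀ (W : R3 → ℝ), IsWeight W →
    ∀ (f g : L2), normA (5 / 4) f < ⊤ → normA (5 / 4) g < ⊤ →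
    multNorm (fun ξ => (W ξ : ℂ)) (Nl M f g) ≤
      ENNReal.ofReal K * (multNorm (fun ξ => (W ξ : ℂ) * symA (5 / 4) ξ) f *
        multNorm (fun ξ => (W ξ : ℂ) * symA (5 / 4) ξ) g) := by
  obtain ⟨K, hK0, hK⟩ := multNorm_prod_le
  refine ⟨K * ‖convBilin M 0‖ + K * ‖convBilin M 1‖ + K * ‖convBilin M 2‖ + 1, by positivity,
    fun W hW f g hf hg => ?_⟩
  have hm : Measurable fun ξ => (W ξ : ℂ) := Complex.measurable_ofReal.comp hW.meas
  have h := fun j => hK _ (isRealBilin_convBilin M j) W hW f g j hf hg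
  rw [Nl, Fin.sum_univ_three]
  refine ((multNorm_add_le hm _ _).trans (add_le_add_left (multNorm_add_le hm _ _) _)).trans ?_
  refine (add_le_add (add_le_add (h 0) (h 1)) (h 2)).trans ?_
  rw [← add_mul, ← add_mul, ← ENNReal.ofReal_add (by positivity) (by positivity),
    ← ENNReal.ofReal_add (by positivity) (by positivity)]
  exact mul_le_mul_left (ENNReal.ofReal_le_ofReal (by linarith)) _

open Classical in
/-- The result of applying the multiplier with symbol `w`, if `f` is in its domain. -/
def op (w : R3 → ℂ) (f : L2) : L2 := if h : ∃ g : L2, IsMultiplier w f g then h.choose else 0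

lemma isMultiplier_op {w : R3 → ℂ} (hw : IsSymbol w) {f : L2} (hf : multNorm w f < ⊤) :
    IsMultiplier w f (op w f) := by
  have h := exists_isMultiplier hw hf
  rw [op, dif_pos h]
  exact h.choose_spec

/-- Conjugation with Bessel potentials turns the nonlinearity into a bounded bilinear map on L²
itself, so that its continuity and differentiability in time come from the calculus of continuous
bilinear maps. -/
lemma exists_bilin_Nl (M : Matrix (Fin 3) (Fin 3) ℝ) {s : ℝ} (hs : 0 ≤ s) :
    ∃ Q : L2 →L[ℝ] L2 →L[ℝ] L2, ∀ f g F G : L2, IsMultiplier (symBessel (s + 5 / 4)) f F →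
      IsMultiplier (symBessel (s + 5 / 4)) g G → IsMultiplier (symBessel s) (Nl M f g) (Q F G) := by
  obtain ⟨K, hK0, hK⟩ := multNorm_Nl_le M
  have hW := isWeight_besselWeight hs
  have hJb : IsBddSymbol (symBessel (-(s + 5 / 4))) := isBddSymbol_symBessel (by linarith)
  set J := D (symBessel (-(s + 5 / 4))) with hJ
  have hJm := isMultiplier_D hJb
  set c : ℝ := 2 ^ (s / 2) with hc
  have hc1 : 1 ≤ c := Real.one_le_rpow (by norm_num) (by linarith)
  have hJA : ∀ F, normA (5 / 4) (J F) < ⊤ := by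
    intro F
    rw [normA, multNorm_comp (hJm F)]
    refine (multNorm_le_of_bdd (c := 1) F fun ξ => ?_).trans_lt
      (ENNReal.mul_lt_top ENNReal.ofReal_lt_top enorm_lt_top)
    rw [norm_mul]
    refine (mul_le_mul_of_nonneg_right (norm_symA_le_symBessel (by norm_num) ξ)
      (norm_nonneg _)).trans ?_
    rw [← norm_mul, symBessel_mul]
    refine (norm_symBessel_mono (b := 0) (by linarith) ξ).trans ?_
    simp [symBessel_zero]
  have hJW : ∀ F, multNorm (fun ξ => (besselWeight s ξ : ℂ) * symA (5 / 4) ξ) (J F)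
      ≤ ENNReal.ofReal c * ‖F‖ₑ := by
    intro F
    rw [multNorm_comp (hJm F)]
    refine multNorm_le_of_bdd F fun ξ => ?_
    rw [ofReal_besselWeight, norm_mul, norm_mul, norm_mul, Complex.norm_real,
      Real.norm_of_nonneg (by positivity), mul_assoc, mul_assoc]
    refine mul_le_of_le_one_right (by positivity) ?_
    calc _ ≤ ‖symBessel s ξ‖ * (‖symBessel (5 / 4) ξ‖ * ‖symBessel (-(s + 5 / 4)) ξ‖) := by
          gcongr
          exact norm_symA_le_symBessel (by norm_num) ξ
      _ = 1 := by
          rw [← norm_mul, ← norm_mul, symBessel_mul, symBessel_mul,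
            show s + (5 / 4 + -(s + 5 / 4)) = 0 by ring, symBessel_zero, norm_one]
  have hbd : ∀ F G, multNorm (symBessel s) (Nl M (J F) (J G))
      ≤ ENNReal.ofReal (K * c ^ 2) * (‖F‖ₑ * ‖G‖ₑ) := by
    intro F G
    have h1 : multNorm (symBessel s) (Nl M (J F) (J G))
        ≤ multNorm (fun ξ => (besselWeight s ξ : ℂ)) (Nl M (J F) (J G)) := by
      refine multNorm_mono _ fun ξ => ?_
      rw [ofReal_besselWeight, norm_mul, Complex.norm_real, Real.norm_of_nonneg (by positivity)]
      exact le_mul_of_one_le_left (norm_nonneg _) hc1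
    refine (h1.trans (hK _ hW _ _ (hJA F) (hJA G))).trans ?_
    refine (mul_le_mul_right (mul_le_mul' (hJW F) (hJW G)) _).trans (le_of_eq ?_)
    rw [ENNReal.ofReal_mul hK0.le, ENNReal.ofReal_pow (by positivity)]
    ring
  have hop : ∀ F G, IsMultiplier (symBessel s) (Nl M (J F) (J G))
      (op (symBessel s) (Nl M (J F) (J G))) := fun F G =>
    isMultiplier_op (isSymbol_symBessel s) ((hbd F G).trans_lt (by finiteness))
  set Q : L2 →L[ℝ] L2 →L[ℝ] L2 := LinearMap.mkContinuous₂
    (LinearMap.mk₂ ℝ (fun F G => op (symBessel s) (Nl M (J F) (J G)))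
      (fun F F' G => by
        refine (hop _ _).unique ?_
        rw [map_add, Nl_add_left M (hJA _) (hJA _) (hJA _)]
        exact isMultiplier_add (hop _ _) (hop _ _))
      (fun r F G => by
        refine (hop _ _).unique ?_
        rw [map_smul, Nl_smul_left M r (hJA _) (hJA _)]
        exact isMultiplier_smul r (hop _ _))
      (fun F G G' => by
        refine (hop _ _).unique ?_
        rw [map_add, Nl_add_right M (hJA _) (hJA _) (hJA _)]
        exact isMultiplier_add (hop _ _) (hop _ _))
      (fun r F G => by
        refine (hop _ _).unique ?_
        rw [map_smul, Nl_smul_right M r (hJA _) (hJA _)]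
        exact isMultiplier_smul r (hop _ _)))
    (K * c ^ 2) (fun F G => by
      have h := (hop F G).enorm_eq.trans_le (hbd F G)
      rw [← ofReal_norm, ← ofReal_norm, ← ofReal_norm, ← ENNReal.ofReal_mul (norm_nonneg _),
        ← ENNReal.ofReal_mul (by positivity), ← mul_assoc] at h
      exact (ENNReal.ofReal_le_ofReal_iff (by positivity)).1 h) with hQ
  refine ⟨Q, fun f g F G hF hG => ?_⟩
  have hinv : ∀ f F, IsMultiplier (symBessel (s + 5 / 4)) f F → f = J F := by
    intro f F hF
    have h2 := (hF.comp (hJm F)).congr (w' := fun _ => 1) (fun ξ => by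
      rw [symBessel_mul, show -(s + 5 / 4) + (s + 5 / 4) = 0 by ring, symBessel_zero])
    exact ((show IsMultiplier (fun _ => 1) f f from Eventually.of_forall fun ξ => by simp).unique h2)
  rw [hinv f F hF, hinv g G hG]
  exact hop F G

/-! ### From the weak equation to the Fourier side -/

lemma pair_eq_inner (f : L2) (φ : 𝓢(R3, R3)) : pair f φ = ⟪f, φ.toLp 2 volume⟫_ℝ := by
  rw [L2.inner_def, pair]
  apply integral_congr_ae
  filter_upwards [φ.coeFn_toLp 2 volume] with x h
  rw [h]

/-- The field `x ↦ (p (ψ x)) eᵢ`. -/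
def testField (i : Fin 3) (p : ℂ →L[ℝ] ℝ) (ψ : 𝓢(R3, ℂ)) : 𝓢(R3, R3) :=
  SchwartzMap.postcompCLM
    ((ContinuousLinearMap.toSpanSingleton ℝ (EuclideanSpace.single i (1 : ℝ))).comp p) ψ

lemma testField_apply (i : Fin 3) (p : ℂ →L[ℝ] ℝ) (ψ : 𝓢(R3, ℂ)) (x : R3) :
    testField i p ψ x = p (ψ x) • EuclideanSpace.single i (1 : ℝ) := by
  simp [testField]

lemma laplacian_testField (i : Fin 3) (p : ℂ →L[ℝ] ℝ) (ψ : 𝓢(R3, ℂ)) :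
    Δ (testField i p ψ) = testField i p (Δ ψ) := by
  ext1 x
  rw [SchwartzMap.laplacian_apply, testField_apply, SchwartzMap.laplacian_apply]
  have h : ContDiffAt ℝ 2 (ψ : R3 → ℂ) x := (ψ.smooth 2).contDiffAt
  have := h.laplacian_CLM_comp_left
    (l := (ContinuousLinearMap.toSpanSingleton ℝ (EuclideanSpace.single i (1 : ℝ))).comp p)
  simp only [ContinuousLinearMap.comp_apply, ContinuousLinearMap.toSpanSingleton_apply,
    Function.comp_apply] at this
  rw [← this]
  congr 1

lemma integrable_smul_complexify (f : L2) (ψ : 𝓢(R3, ℂ)) :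
    Integrable (fun x => ψ x • complexify.compLp f x) :=
  memLp_one_iff_integrable.1 ((ContinuousLinearMap.lsmul ℂ ℂ).memLp_of_bilin (p := 2) (q := 2) 1
    (ψ.memLp 2 volume) (Lp.memLp (complexify.compLp f)))

/-- With `p` the real or imaginary part, real test fields recover every component of the complex
pairing, which is the one compatible with the Fourier transform. -/
lemma pair_testField (f : L2) (i : Fin 3) (p : ℂ →L[ℝ] ℝ) (ψ : 𝓢(R3, ℂ)) :
    pair f (testField i p ψ) = p ((∫ x, ψ x • complexify.compLp f x) i) := by
  set q : C3 →L[ℝ] ℝ := p.comp ((EuclideanSpace.proj i : C3 →L[ℂ] ℂ).restrictScalars ℝ) with hq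
  rw [show p ((∫ x, ψ x • complexify.compLp f x) i) = q (∫ x, ψ x • complexify.compLp f x) from rfl,
    ← q.integral_comp_comm (integrable_smul_complexify f ψ), pair]
  apply integral_congr_ae
  filter_upwards [complexify.coeFn_compLp f] with x h
  rw [testField_apply, h, inner_smul_right, EuclideanSpace.inner_single_right]
  rw [show q (ψ x • complexify (f x)) = p ((ψ x • complexify (f x)) i) from rfl]
  simp only [PiLp.smul_apply, complexify_apply, smul_eq_mul]
  rw [mul_comm (ψ x), ← Complex.real_smul, map_smul]
  simp [mul_comm]

lemma integral_smul_eq_of_pair {a b : L2} {ψ ψ' : 𝓢(R3, ℂ)}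
    (h : ∀ i p, pair a (testField i p ψ) = pair b (testField i p ψ')) :
    ∫ x, ψ x • complexify.compLp a x = ∫ x, ψ' x • complexify.compLp b x := by
  ext i
  apply Complex.ext
  · simpa [pair_testField] using h i Complex.reCLM
  · simpa [pair_testField] using h i Complex.imCLM

lemma locallyIntegrable_smul_hat {c : R3 → ℂ} (hc : Continuous c) (f : L2) :
    LocallyIntegrable (fun ξ => c ξ • hat f ξ) := by
  have h1 : LocallyIntegrable (hat f : R3 → C3) := (Lp.memLp (hat f)).locallyIntegrable one_le_two
  rw [← locallyIntegrableOn_univ] at h1 ⊢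
  exact h1.continuousOn_smul isOpen_univ.isLocallyClosed hc.continuousOn

/-- If `a = Δ b` in the sense of distributions, then the transforms are related accordingly. -/
lemma isMultiplier_of_pair_laplacian {a b : L2} (h : ∀ φ : 𝓢(R3, R3), pair a φ = pair b (Δ φ)) :
    IsMultiplier (fun ξ => ((-(2 * Real.pi * ‖ξ‖) ^ 2 : ℝ) : ℂ)) b a := by
  have h1 : ((complexify.compLp a : Lp C3 2 (volume : Measure R3)) : 𝓢'(R3, C3))
      = Δ ((complexify.compLp b : Lp C3 2 (volume : Measure R3)) : 𝓢'(R3, C3)) := by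
    ext1 ψ
    rw [TemperedDistribution.laplacian_apply_apply, Lp.toTemperedDistribution_apply,
      Lp.toTemperedDistribution_apply]
    exact integral_smul_eq_of_pair fun i p => by rw [h, laplacian_testField]
  have h3 := locallyIntegrable_smul_hat (c := fun ξ => ((-(2 * Real.pi * ‖ξ‖) ^ 2 : ℝ) : ℂ))
    (by fun_prop) b
  refine ae_eq_of_integral_contDiff_smul_eq ((Lp.memLp (hat a)).locallyIntegrable one_le_two) h3 ?_
  intro χ hχ hc
  have hc1 : HasCompactSupport (Complex.ofRealCLM ∘ χ) := hc.comp_left rfl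
  have hc2 : ContDiff ℝ ∞ (Complex.ofRealCLM ∘ χ) := by fun_prop
  set χ' := hc1.toSchwartzMap hc2 with hχ'
  have hχa : ∀ x, χ' x = (χ x : ℂ) := fun x => rfl
  have hg : (fun x : R3 => Complex.ofReal (‖x‖ ^ 2)).HasTemperateGrowth := by fun_prop
  -- Testing with the transform of a bump function tests the transforms of `a` and `b` with the bump
  -- function itself.
  have h4 := congrArg (fun T : 𝓢'(R3, C3) => T (𝓕 χ')) h1
  simp only [Lp.toTemperedDistribution_apply, TemperedDistribution.laplacian_eq_fourierMultiplierCLM,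
    smul_apply, TemperedDistribution.fourierMultiplierCLM_apply_apply,
    FourierTransform.fourierInv_fourier_eq, integral_fourier_smul_Lp,
    SchwartzMap.smulLeftCLM_apply_apply hg] at h4
  rw [← integral_smul] at h4
  simp only [hχa, Complex.coe_smul] at h4
  refine h4.trans (integral_congr_ae (Eventually.of_forall fun x => ?_))
  simp only [hat, ← Complex.coe_smul, smul_smul]
  congr 1
  simp only [smul_eq_mul]
  push_cast
  ring

/-! ### Mild solutions and Duhamel's formula -/

/-- `u` solves `∂ₜ u = Δ u - b` weakly on `]0, T[`, is continuous on `[0, T]`, and the forcing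
is continuous on `]0, T]` with an integrable singularity at `0`. -/
structure IsMild (T : ℝ) (u b : ℝ → L2) : Prop where
  cont : ContinuousOn u (Icc 0 T)
  cont_force : ContinuousOn b (Ioc 0 T)
  bound : ∃ c : ℝ, ∀ t ∈ Ioc 0 T, ‖b t‖ ≤ c * t ^ (-(3 / 4) : ℝ)
  deriv : ∀ φ : 𝓢(R3, R3), ∀ t ∈ Ioo 0 T,
    HasDerivAt (fun s => pair (u s) φ) (pair (u t) (Δ φ) - pair (b t) φ) t

/-- The indicator of the frequencies below `R`. -/
def symCut (R : ℝ) (ξ : R3) : ℂ := ({ξ : R3 | 2 * Real.pi * ‖ξ‖ ≤ R}.indicator 1 ξ : ℝ)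

/-- The symbol of `exp (τ Δ)`. -/
def symHeat (τ : ℝ) (ξ : R3) : ℂ := (Real.exp (-(τ * (2 * Real.pi * ‖ξ‖) ^ 2)) : ℝ)

/-- The symbol of `-Δ`. -/
def symLap (ξ : R3) : ℂ := ((2 * Real.pi * ‖ξ‖) ^ 2 : ℝ)

lemma isSymbol_symCut (R : ℝ) : IsSymbol (symCut R) :=
  IsSymbol.ofReal (a := fun ξ => {ξ : R3 | 2 * Real.pi * ‖ξ‖ ≤ R}.indicator 1 ξ)
    (measurable_one.indicator (measurableSet_le (by fun_prop) (by fun_prop)))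
    (fun ξ => by simp [indicator])

lemma isSymbol_symHeat (τ : ℝ) : IsSymbol (symHeat τ) :=
  IsSymbol.ofReal (a := fun ξ => Real.exp (-(τ * (2 * Real.pi * ‖ξ‖) ^ 2))) (by fun_prop) (by simp)

lemma isSymbol_symLap : IsSymbol symLap :=
  IsSymbol.ofReal (a := fun ξ => (2 * Real.pi * ‖ξ‖) ^ 2) (by fun_prop) (by simp)

lemma symCut_of_le {R : ℝ} {ξ : R3} (h : 2 * Real.pi * ‖ξ‖ ≤ R) : symCut R ξ = 1 := by
  simp [symCut, h]

lemma symCut_of_gt {R : ℝ} {ξ : R3} (h : R < 2 * Real.pi * ‖ξ‖) : symCut R ξ = 0 := by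
  simp [symCut, h]

lemma symCut_mul_self (R : ℝ) (ξ : R3) : symCut R ξ * symCut R ξ = symCut R ξ := by
  rcases le_or_gt (2 * Real.pi * ‖ξ‖) R with h | h
  · rw [symCut_of_le h, one_mul]
  · rw [symCut_of_gt h, zero_mul]

lemma isBddSymbol_symCut_mul {R : ℝ} {w : R3 → ℂ} (hw : IsSymbol w) {c : ℝ}
    (hc : ∀ ξ, 2 * Real.pi * ‖ξ‖ ≤ R → ‖w ξ‖ ≤ c) :
    IsBddSymbol (fun ξ => symCut R ξ * w ξ) := by
  refine ⟨(isSymbol_symCut R).mul hw, |c|, fun ξ => ?_⟩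
  rcases le_or_gt (2 * Real.pi * ‖ξ‖) R with h | h
  · rw [symCut_of_le h, one_mul]
    exact (hc ξ h).trans (le_abs_self c)
  · rw [symCut_of_gt h, zero_mul, norm_zero]
    exact abs_nonneg c

lemma isBddSymbol_symCut (R : ℝ) : IsBddSymbol (symCut R) := by
  have := isBddSymbol_symCut_mul (R := R) (w := fun _ => 1)
    (IsSymbol.ofReal (a := fun _ => 1) measurable_const (by simp)) (c := 1) (by simp)
  simpa using this

lemma norm_symHeat (τ : ℝ) (ξ : R3) :
    ‖symHeat τ ξ‖ = Real.exp (-(τ * (2 * Real.pi * ‖ξ‖) ^ 2)) := by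
  rw [symHeat, Complex.norm_real, Real.norm_of_nonneg (Real.exp_pos _).le]

lemma isBddSymbol_symCut_mul_symHeat (R τ : ℝ) :
    IsBddSymbol (fun ξ => symCut R ξ * symHeat τ ξ) := by
  refine isBddSymbol_symCut_mul (isSymbol_symHeat τ) (c := Real.exp (|τ| * R ^ 2)) fun ξ hξ => ?_
  rw [norm_symHeat]
  apply Real.exp_le_exp.2
  have h0 : 0 ≤ 2 * Real.pi * ‖ξ‖ := by positivity
  have h1 := pow_le_pow_left₀ h0 hξ 2
  have h2 := neg_abs_le τ
  nlinarith [abs_nonneg τ, sq_nonneg (2 * Real.pi * ‖ξ‖)]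

lemma isBddSymbol_symCut_mul_symLap (R : ℝ) : IsBddSymbol (fun ξ => symCut R ξ * symLap ξ) := by
  refine isBddSymbol_symCut_mul isSymbol_symLap (c := R ^ 2) fun ξ hξ => ?_
  rw [symLap, Complex.norm_real, Real.norm_of_nonneg (by positivity)]
  exact pow_le_pow_left₀ (by positivity) hξ 2

lemma isBddSymbol_symCut_lap_heat (R τ : ℝ) :
    IsBddSymbol (fun ξ => symCut R ξ * symLap ξ * symHeat τ ξ) := by
  have h := (isBddSymbol_symCut_mul_symLap R).mul (isBddSymbol_symCut_mul_symHeat R τ)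
  convert h using 2 with ξ
  rw [mul_mul_mul_comm, symCut_mul_self, mul_assoc]

/-- The band-limited backward heat operators are differentiable in time. -/
lemma hasDerivAt_D_heat (R t s : ℝ) :
    HasDerivAt (fun s => D (fun ξ => symCut R ξ * symHeat (t - s) ξ))
      (D (fun ξ => symCut R ξ * symLap ξ * symHeat (t - s) ξ)) s := by
  rw [hasDerivAt_iff_isLittleO_nhds_zero]
  -- The cut-off keeps the symbol bounded even for negative heat times. The quadratic remainder is
  -- exp(-(t-s)x) (exp(hx) - 1 - hx) with x ≤ R², and |exp(y) - 1 - y| ≤ y² once |y| ≤ 1.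
  set C : ℝ := Real.exp (|t - s| * R ^ 2) * (R ^ 2) ^ 2 with hC
  refine Asymptotics.IsBigO.trans_isLittleO (g := fun h : ℝ => h ^ 2) ?_
    (Asymptotics.isLittleO_pow_id one_lt_two)
  refine Asymptotics.IsBigO.of_bound C ?_
  have hnear : ∀ᶠ h : ℝ in 𝓝 0, |h| * R ^ 2 ≤ 1 := by
    have : Tendsto (fun h : ℝ => |h| * R ^ 2) (𝓝 0) (𝓝 0) := by
      have h0 : Continuous (fun h : ℝ => |h| * R ^ 2) := by fun_prop
      simpa using h0.tendsto 0
    exact this.eventually (ge_mem_nhds one_pos)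
  filter_upwards [hnear] with h hh
  have b1 := isBddSymbol_symCut_mul_symHeat R (t - (s + h))
  have b2 := isBddSymbol_symCut_mul_symHeat R (t - s)
  have b3 := isBddSymbol_symCut_lap_heat R (t - s)
  have b12 : IsBddSymbol (fun ξ => symCut R ξ * symHeat (t - (s + h)) ξ
      - symCut R ξ * symHeat (t - s) ξ) := by
    obtain ⟨c, hc⟩ := b1.bdd
    obtain ⟨c', hc'⟩ := b2.bdd
    exact ⟨⟨b1.meas.sub b2.meas, fun ξ => by rw [b1.herm, b2.herm, map_sub]⟩, c + c',
      fun ξ => (norm_sub_le _ _).trans (add_le_add (hc ξ) (hc' ξ))⟩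
  have b3h : IsBddSymbol (fun ξ => h * (symCut R ξ * symLap ξ * symHeat (t - s) ξ)) := by
    obtain ⟨c, hc⟩ := b3.bdd
    refine ⟨⟨b3.meas.const_mul _, fun ξ => by
      rw [b3.herm, map_mul (starRingEnd ℂ) (h : ℂ), Complex.conj_ofReal]⟩, |h| * c,
      fun ξ => ?_⟩
    rw [norm_mul, Complex.norm_real, Real.norm_eq_abs]
    exact mul_le_mul_of_nonneg_left (hc ξ) (abs_nonneg _)
  rw [← D_sub b1 b2, ← D_real_smul b3, ← D_sub b12 b3h]
  have b4 : IsBddSymbol (fun ξ => (symCut R ξ * symHeat (t - (s + h)) ξ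
      - symCut R ξ * symHeat (t - s) ξ) - h * (symCut R ξ * symLap ξ * symHeat (t - s) ξ)) := by
    obtain ⟨c, hc⟩ := b12.bdd
    obtain ⟨c', hc'⟩ := b3h.bdd
    exact ⟨⟨b12.meas.sub b3h.meas, fun ξ => by
      rw [b12.herm, b3h.herm]; exact (map_sub _ _ _).symm⟩, c + c',
      fun ξ => (norm_sub_le _ _).trans (add_le_add (hc ξ) (hc' ξ))⟩
  rw [Real.norm_of_nonneg (sq_nonneg h)]
  refine norm_D_le b4 fun ξ => ?_
  rcases le_or_gt (2 * Real.pi * ‖ξ‖) R with hξ | hξ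
  · rw [symCut_of_le hξ, one_mul, one_mul, one_mul]
    set x := (2 * Real.pi * ‖ξ‖) ^ 2 with hx
    have hx0 : 0 ≤ x := by positivity
    have hxR : x ≤ R ^ 2 := pow_le_pow_left₀ (by positivity) hξ 2
    have e : symHeat (t - (s + h)) ξ - symHeat (t - s) ξ - h * (symLap ξ * symHeat (t - s) ξ)
        = ((Real.exp (-((t - s) * x)) * (Real.exp (h * x) - 1 - h * x) : ℝ) : ℂ) := by
      rw [symHeat, symHeat, symLap, ← hx, show -((t - (s + h)) * x) = -((t - s) * x) + h * x by ring,
        Real.exp_add]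
      push_cast; ring
    rw [e, Complex.norm_real, norm_mul, Real.norm_of_nonneg (Real.exp_pos _).le]
    have h1 : |h * x| ≤ 1 := by
      rw [abs_mul, abs_of_nonneg hx0]
      exact (mul_le_mul_of_nonneg_left hxR (abs_nonneg h)).trans hh
    have h2 := Real.abs_exp_sub_one_sub_id_le h1
    have h3 : (h * x) ^ 2 ≤ (R ^ 2) ^ 2 * h ^ 2 := by
      rw [mul_pow, mul_comm]
      exact mul_le_mul_of_nonneg_right (pow_le_pow_left₀ hx0 hxR 2) (sq_nonneg h)
    have h4 : Real.exp (-((t - s) * x)) ≤ Real.exp (|t - s| * R ^ 2) := by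
      apply Real.exp_le_exp.2
      nlinarith [neg_abs_le (t - s), abs_nonneg (t - s)]
    rw [hC, mul_assoc]
    exact mul_le_mul h4 (h2.trans h3) (norm_nonneg _) (Real.exp_pos _).le
  · rw [symCut_of_gt hξ]
    simp only [zero_mul, mul_zero, sub_zero, norm_zero]
    positivity

section Mild

variable {T : ℝ} {u b : ℝ → L2}

lemma IsMild.intervalIntegrable_rpow {a t₀ t : ℝ} (ha : -1 < a) :
    IntervalIntegrable (fun s : ℝ => s ^ a) volume t₀ t :=
  intervalIntegral.intervalIntegrable_rpow' ha

lemma IsMild.intervalIntegrable_clm (h : IsMild T u b) {F : Type*} [NormedAddCommGroup F]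
    [NormedSpace ℝ F] {L : ℝ → L2 →L[ℝ] F} (hL : ContinuousOn L (Icc 0 T)) {t₀ t : ℝ}
    (ht₀ : 0 ≤ t₀) (ht : t₀ ≤ t) (htT : t ≤ T) :
    IntervalIntegrable (fun s => L s (b s)) volume t₀ t := by
  obtain ⟨c, hc⟩ := h.bound
  obtain ⟨C, hC⟩ := (isCompact_Icc (a := (0 : ℝ)) (b := T)).exists_bound_of_continuousOn hL
  have hsub : Ioc t₀ t ⊆ Ioc 0 T := Ioc_subset_Ioc ht₀ htT
  have hi := ((IsMild.intervalIntegrable_rpow (a := -(3 / 4)) (t₀ := t₀) (t := t)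
    (by norm_num)).const_mul (C * c))
  rw [intervalIntegrable_iff_integrableOn_Ioc_of_le ht] at hi ⊢
  refine Integrable.mono' hi ?_ ?_
  · apply ContinuousOn.aestronglyMeasurable _ measurableSet_Ioc
    exact ((hL.mono (hsub.trans Ioc_subset_Icc_self)).clm_apply (h.cont_force.mono hsub))
  · refine (ae_restrict_iff' measurableSet_Ioc).2 (Eventually.of_forall fun s hs => ?_)
    have hs' := hsub hs
    have h1 := hC s (Ioc_subset_Icc_self hs')
    calc _ ≤ ‖L s‖ * ‖b s‖ := (L s).le_opNorm _
      _ ≤ C * (c * s ^ (-(3 / 4) : ℝ)) :=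
        mul_le_mul h1 (hc s hs') (norm_nonneg _) ((norm_nonneg _).trans h1)
      _ = _ := by ring

lemma IsMild.intervalIntegrable_force (h : IsMild T u b) {t₀ t : ℝ}
    (ht₀ : 0 ≤ t₀) (ht : t₀ ≤ t) (htT : t ≤ T) : IntervalIntegrable b volume t₀ t :=
  h.intervalIntegrable_clm (L := fun _ => ContinuousLinearMap.id ℝ L2) continuousOn_const ht₀ ht htT

lemma IsMild.intervalIntegrable (h : IsMild T u b) {t₀ t : ℝ}
    (ht₀ : 0 ≤ t₀) (ht : t₀ ≤ t) (htT : t ≤ T) : IntervalIntegrable u volume t₀ t := by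
  apply ContinuousOn.intervalIntegrable
  rw [uIcc_of_le ht]
  exact h.cont.mono (Icc_subset_Icc ht₀ htT)

/-- The time-integrated equation. -/
lemma IsMild.isMultiplier_integral (h : IsMild T u b) {t₀ t : ℝ}
    (ht₀ : 0 ≤ t₀) (ht : t₀ ≤ t) (htT : t ≤ T) :
    IsMultiplier (fun ξ => ((-(2 * Real.pi * ‖ξ‖) ^ 2 : ℝ) : ℂ)) (∫ s in t₀..t, u s)
      (u t - u t₀ + ∫ s in t₀..t, b s) := by
  apply isMultiplier_of_pair_laplacian
  intro φ
  set L : L2 →L[ℝ] ℝ := innerSL ℝ (φ.toLp 2 (volume : Measure R3)) with hLdef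
  set L' : L2 →L[ℝ] ℝ := innerSL ℝ ((Δ φ).toLp 2 (volume : Measure R3)) with hLdef'
  have hL : ∀ f, pair f φ = L f := fun f => by
    rw [pair_eq_inner, real_inner_comm, hLdef, innerSL_apply_apply]
  have hL' : ∀ f, pair f (Δ φ) = L' f := fun f => by
    rw [pair_eq_inner, real_inner_comm, hLdef', innerSL_apply_apply]
  have i1 := h.intervalIntegrable ht₀ ht htT
  have i2 := h.intervalIntegrable_force ht₀ ht htT
  have j1 : IntervalIntegrable (fun s => L' (u s)) volume t₀ t := by
    apply ContinuousOn.intervalIntegrable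
    rw [uIcc_of_le ht]
    exact L'.continuous.comp_continuousOn (h.cont.mono (Icc_subset_Icc ht₀ htT))
  have j2 : IntervalIntegrable (fun s => L (b s)) volume t₀ t :=
    h.intervalIntegrable_clm (L := fun _ => L) continuousOn_const ht₀ ht htT
  have hftc : ∫ s in t₀..t, (L' (u s) - L (b s)) = L (u t) - L (u t₀) := by
    refine intervalIntegral.integral_eq_sub_of_hasDerivAt_of_le ht
      (L.continuous.comp_continuousOn (h.cont.mono (Icc_subset_Icc ht₀ htT))) (fun s hs => ?_)
      (j1.sub j2)
    have := h.deriv φ s ⟨ht₀.trans_lt hs.1, hs.2.trans_le htT⟩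
    simp only [hL, hL'] at this
    exact this
  rw [intervalIntegral.integral_sub j1 j2, L'.intervalIntegral_comp_comm i1,
    L.intervalIntegral_comp_comm i2] at hftc
  rw [hL, hL', map_add, map_sub]
  linarith

/-- The band-limited equation in integrated form. -/
lemma IsMild.cut_eq (h : IsMild T u b) (R : ℝ) {t₀ t : ℝ}
    (ht₀ : 0 ≤ t₀) (ht : t₀ ≤ t) (htT : t ≤ T) :
    D (symCut R) (u t) = D (symCut R) (u t₀) -
      ∫ s in t₀..t, (D (fun ξ => symCut R ξ * symLap ξ) (u s) + D (symCut R) (b s)) := by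
  have hm := h.isMultiplier_integral ht₀ ht htT
  have bE := isBddSymbol_symCut R
  have bL := isBddSymbol_symCut_mul_symLap R
  have i1 := h.intervalIntegrable ht₀ ht htT
  have i2 := h.intervalIntegrable_force ht₀ ht htT
  have e : D (symCut R) (u t - u t₀ + ∫ s in t₀..t, b s)
      = -D (fun ξ => symCut R ξ * symLap ξ) (∫ s in t₀..t, u s) := by
    have h1 := (hm.comp (isMultiplier_D bE _))
    have h2 := isMultiplier_smul (-1) (isMultiplier_D bL (∫ s in t₀..t, u s))
    refine h1.unique ?_
    rw [neg_one_smul, neg_one_smul] at h2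
    have h3 : hat (-(∫ s in t₀..t, u s)) = - hat (∫ s in t₀..t, u s) := hat_neg _
    rw [IsMultiplier, h3] at h2
    filter_upwards [h2, Lp.coeFn_neg (hat (∫ s in t₀..t, u s))] with ξ h4 h5
    rw [h4, h5, Pi.neg_apply, smul_neg, ← neg_smul]
    congr 1
    rw [symLap]; push_cast; ring
  have j1 : IntervalIntegrable (fun s => D (fun ξ => symCut R ξ * symLap ξ) (u s)) volume t₀ t := by
    apply ContinuousOn.intervalIntegrable
    rw [uIcc_of_le ht]
    exact (ContinuousLinearMap.continuous _).comp_continuousOn (h.cont.mono (Icc_subset_Icc ht₀ htT))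
  have j2 : IntervalIntegrable (fun s => D (symCut R) (b s)) volume t₀ t :=
    h.intervalIntegrable_clm (L := fun _ => D (symCut R)) continuousOn_const ht₀ ht htT
  rw [intervalIntegral.integral_add j1 j2, ContinuousLinearMap.intervalIntegral_comp_comm _ i1,
    ContinuousLinearMap.intervalIntegral_comp_comm _ i2]
  rw [map_add, map_sub] at e
  have e2 := congrArg (fun x => x + D (symCut R) (u t₀) - D (symCut R) (∫ s in t₀..t, b s)) e
  calc D (symCut R) (u t) = _ := by abel
    _ = _ := e2
    _ = _ := by abel

lemma IsMild.hasDerivAt_cut (h : IsMild T u b) (R : ℝ) {s : ℝ} (hs : s ∈ Ioo 0 T) :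
    HasDerivAt (fun s => D (symCut R) (u s))
      (-(D (fun ξ => symCut R ξ * symLap ξ) (u s) + D (symCut R) (b s))) s := by
  set g : ℝ → L2 := fun s => D (fun ξ => symCut R ξ * symLap ξ) (u s) + D (symCut R) (b s) with hg
  have hT : 0 < T := hs.1.trans hs.2
  have hgc : ContinuousOn g (Ioc 0 T) :=
    ((ContinuousLinearMap.continuous _).comp_continuousOn (h.cont.mono Ioc_subset_Icc_self)).add
      ((ContinuousLinearMap.continuous _).comp_continuousOn h.cont_force)
  have hnhds : Ioo 0 T ∈ 𝓝 s := isOpen_Ioo.mem_nhds hs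
  have hgs : ContinuousAt g s := hgc.continuousAt (mem_of_superset hnhds Ioo_subset_Ioc_self)
  have hint : IntervalIntegrable g volume 0 s := by
    refine IntervalIntegrable.add ?_ ?_
    · apply ContinuousOn.intervalIntegrable
      rw [uIcc_of_le hs.1.le]
      exact (ContinuousLinearMap.continuous _).comp_continuousOn
        (h.cont.mono (Icc_subset_Icc le_rfl hs.2.le))
    · exact h.intervalIntegrable_clm (L := fun _ => D (symCut R)) continuousOn_const le_rfl hs.1.le
        hs.2.le
  have hd := intervalIntegral.integral_hasDerivAt_right hint
    (hgc.mono Ioo_subset_Ioc_self |>.stronglyMeasurableAtFilter isOpen_Ioo s hs) hgs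
  refine ((hd.const_sub (D (symCut R) (u 0)))).congr_of_eventuallyEq ?_
  filter_upwards [hnhds] with s' hs'
  exact h.cut_eq R le_rfl hs'.1.le hs'.2.le

/-- Duhamel's formula for the band-limited solution. -/
theorem IsMild.duhamel (h : IsMild T u b) (R : ℝ) {t₀ t : ℝ}
    (ht₀ : 0 ≤ t₀) (ht : t₀ ≤ t) (htT : t ≤ T) :
    D (symCut R) (u t) = D (fun ξ => symCut R ξ * symHeat (t - t₀) ξ) (u t₀) -
      ∫ s in t₀..t, D (fun ξ => symCut R ξ * symHeat (t - s) ξ) (b s) := by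
  set G : ℝ → L2 →L[ℝ] L2 := fun s => D (fun ξ => symCut R ξ * symHeat (t - s) ξ) with hG
  have hGd := hasDerivAt_D_heat R t
  have hGc : Continuous G := continuous_iff_continuousAt.2 fun s => (hGd s).continuousAt
  have bE := isBddSymbol_symCut R
  have hGE : ∀ s f, G s (D (symCut R) f) = G s f := fun s f => by
    rw [hG]
    simp only
    rw [D_comp (isBddSymbol_symCut_mul_symHeat R _) bE]
    congr 2; ext ξ
    rw [mul_right_comm, symCut_mul_self]
  have hi := h.intervalIntegrable_clm (L := G) hGc.continuousOn ht₀ ht htT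
  -- The Laplacian terms cancel in the derivative of s ↦ exp((t-s)Δ) u(s). Both are bounded
  -- operators because of the cut-off, so the product rule applies.
  have hftc : ∫ s in t₀..t, -(G s (b s)) = G t (D (symCut R) (u t)) - G t₀ (D (symCut R) (u t₀)) := by
    refine intervalIntegral.integral_eq_sub_of_hasDerivAt_of_le ht
      (hGc.continuousOn.clm_apply ((D (symCut R)).continuous.comp_continuousOn
        (h.cont.mono (Icc_subset_Icc ht₀ htT)))) (fun s hs => ?_) hi.neg
    have hs' : s ∈ Ioo 0 T := ⟨ht₀.trans_lt hs.1, hs.2.trans_le htT⟩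
    have hd : HasDerivAt (fun s => G s (D (symCut R) (u s))) _ s :=
      (hGd s).clm_apply (h.hasDerivAt_cut R hs')
    refine hd.congr_deriv ?_
    change _ + G s (-(D (fun ξ => symCut R ξ * symLap ξ) (u s) + D (symCut R) (b s))) = _
    rw [D_comp (isBddSymbol_symCut_lap_heat R _) bE, map_neg, map_add, hGE s (b s)]
    have e : D (fun ξ => symCut R ξ * symLap ξ * symHeat (t - s) ξ * symCut R ξ) (u s)
        = G s (D (fun ξ => symCut R ξ * symLap ξ) (u s)) := by
      rw [hG]
      simp only
      rw [D_comp (isBddSymbol_symCut_mul_symHeat R _) (isBddSymbol_symCut_mul_symLap R)]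
      congr 2; ext ξ; ring
    rw [e]; abel
  rw [intervalIntegral.integral_neg, hGE, hGE] at hftc
  have e0 : G t (u t) = D (symCut R) (u t) := by
    rw [hG]
    simp only [sub_self]
    congr 2; ext ξ; simp [symHeat]
  rw [e0] at hftc
  rw [sub_eq_add_neg, hftc]; abel

/-- Weighted form of Duhamel's formula. -/
theorem IsMild.multNorm_le (h : IsMild T u b) {w : R3 → ℂ} (hw : IsSymbol w)
    (hb : ∀ R : ℝ, ∃ c, ∀ ξ, 2 * Real.pi * ‖ξ‖ ≤ R → ‖w ξ‖ ≤ c) {t₀ t : ℝ}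
    (ht₀ : 0 ≤ t₀) (ht : t₀ ≤ t) (htT : t ≤ T) :
    multNorm w (u t) ≤ multNorm (fun ξ => w ξ * symHeat (t - t₀) ξ) (u t₀) +
      ∫⁻ s in Ioc t₀ t, multNorm (fun ξ => w ξ * symHeat (t - s) ξ) (b s) := by
  -- `hb` makes the weight bounded below each frequency `n`, where Duhamel's formula is available;
  -- Fatou's lemma removes the cut-off.
  refine multNorm_le_of_tendsto (v := fun (n : ℕ) ξ => symCut n ξ * w ξ)
    (fun n => ((isSymbol_symCut n).mul hw).meas) (u t) (fun ξ => ?_) (fun n => ?_)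
  · apply tendsto_const_nhds.congr'
    filter_upwards [eventually_ge_atTop ⌈2 * Real.pi * ‖ξ‖⌉₊] with n hn
    rw [symCut_of_le (Nat.ceil_le.1 hn), one_mul]
  · obtain ⟨c, hc⟩ := hb n
    have bw := isBddSymbol_symCut_mul hw hc
    have bE := isBddSymbol_symCut n
    set W := D (fun ξ => symCut n ξ * w ξ) with hW
    have e1 : multNorm (fun ξ => symCut n ξ * w ξ) (u t) = ‖W (D (symCut n) (u t))‖ₑ := by
      rw [D_comp bw bE, (isMultiplier_D (bw.mul bE) _).enorm_eq]
      congr 1; ext ξ; rw [mul_right_comm, symCut_mul_self]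
    have e2 : ∀ τ f, ‖W (D (fun ξ => symCut n ξ * symHeat τ ξ) f)‖ₑ
        ≤ multNorm (fun ξ => w ξ * symHeat τ ξ) f := by
      intro τ f
      have bh := isBddSymbol_symCut_mul_symHeat n τ
      rw [D_comp bw bh, (isMultiplier_D (bw.mul bh) _).enorm_eq]
      refine multNorm_mono f fun ξ => ?_
      rw [mul_mul_mul_comm, symCut_mul_self, norm_mul]
      refine mul_le_of_le_one_left (norm_nonneg _) ?_
      rcases le_or_gt (2 * Real.pi * ‖ξ‖) n with h | h
      · rw [symCut_of_le h, norm_one]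
      · rw [symCut_of_gt h, norm_zero]; exact zero_le_one
    have hGc : Continuous fun s => D (fun ξ => symCut n ξ * symHeat (t - s) ξ) :=
      continuous_iff_continuousAt.2 fun s => (hasDerivAt_D_heat n t s).continuousAt
    rw [e1, h.duhamel n ht₀ ht htT, map_sub, ← ContinuousLinearMap.intervalIntegral_comp_comm _
      (h.intervalIntegrable_clm hGc.continuousOn ht₀ ht htT), intervalIntegral.integral_of_le ht]
    refine enorm_sub_le.trans (add_le_add (e2 _ _) ?_)
    exact (enorm_integral_le_lintegral_enorm _).trans (lintegral_mono fun s => e2 _ _)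

end Mild

/-! ### Strong solutions are mild solutions -/

/-- The projected nonlinearity `P ((M f) · ∇) f`. -/
def force (M : Matrix (Fin 3) (Fin 3) ℝ) (P : L2 →L[ℝ] L2) (f : L2) : L2 :=
  P (toL2 (convection M f))

lemma multNorm_lt_top_of_isMultiplier {w : R3 → ℂ} {f g : L2} (h : IsMultiplier w f g) :
    multNorm w f < ⊤ := by
  rw [← h.enorm_eq]; exact enorm_lt_top

lemma normA_lt_top_of_isMultiplier_symBessel {s a : ℝ} (ha : 0 ≤ a) (has : a ≤ s) {f F : L2}
    (h : IsMultiplier (symBessel s) f F) : normA a f < ⊤ :=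
  (multNorm_mono f fun ξ => (norm_symA_le_symBessel ha ξ).trans (norm_symBessel_mono has ξ)).trans_lt
    (multNorm_lt_top_of_isMultiplier h)

lemma multNorm_force_le (M : Matrix (Fin 3) (Fin 3) ℝ) {P : L2 →L[ℝ] L2}
    (hP : IsFiberedProjection P) : ∃ K : ℝ, 0 < K ∧ ∀ (W : R3 → ℝ), IsWeight W →
      (∀ ξ, W (-ξ) = W ξ) → ∀ f : L2, normA (5 / 4) f < ⊤ →
      multNorm (fun ξ => (W ξ : ℂ)) (force M P f) ≤
        ENNReal.ofReal K * multNorm (fun ξ => (W ξ : ℂ) * symA (5 / 4) ξ) f ^ 2 := by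
  obtain ⟨K, hK0, hK⟩ := multNorm_Nl_le M
  refine ⟨K, hK0, fun W hW he f hf => ?_⟩
  rw [force, toL2_convection M hf, sq]
  exact (hP.multNorm_le (IsSymbol.ofReal hW.meas he) _).trans (hK W hW f f hf hf)

lemma exists_bilin_force (M : Matrix (Fin 3) (Fin 3) ℝ) {P : L2 →L[ℝ] L2}
    (hP : IsFiberedProjection P) {s : ℝ} (hs : 0 ≤ s) :
    ∃ Q : L2 →L[ℝ] L2 →L[ℝ] L2, ∀ f F : L2, IsMultiplier (symBessel (s + 5 / 4)) f F →
      IsMultiplier (symBessel s) (force M P f) (P (Q F F)) := by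
  obtain ⟨Q, hQ⟩ := exists_bilin_Nl M hs
  refine ⟨Q, fun f F hF => ?_⟩
  rw [force, toL2_convection M (normA_lt_top_of_isMultiplier_symBessel (by norm_num)
    (by linarith) hF)]
  exact hP.isMultiplier (hQ f f F F hF hF)

lemma isMultiplier_symBessel_zero {f g : L2} : IsMultiplier (symBessel 0) f g ↔ g = f := by
  have h1 : IsMultiplier (symBessel 0) f f := Eventually.of_forall fun ξ => by
    rw [symBessel_zero, one_smul]
  exact ⟨fun h => h.unique h1, fun h => h ▸ h1⟩

lemma one_add_sq_rpow_le {x s : ℝ} (hx : 0 ≤ x) (hs : 0 ≤ s) (hs' : s ≤ 2) :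
    (1 + x ^ 2) ^ (s / 2) ≤ 1 + x ^ s := by
  have h := Real.rpow_add_le_add_rpow zero_le_one (sq_nonneg x) (p := s / 2) (by linarith)
    (by linarith)
  rwa [Real.one_rpow, ← Real.rpow_natCast_mul hx, Nat.cast_ofNat, mul_div_cancel₀ _ two_ne_zero] at h

lemma norm_symBessel_le_one_add {s : ℝ} (hs : 0 ≤ s) (hs' : s ≤ 2) (ξ : R3) :
    ‖symBessel s ξ‖ ≤ 1 + ‖symA s ξ‖ := by
  rw [norm_symBessel, norm_symA]
  exact one_add_sq_rpow_le (by positivity) hs hs'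

/-- The symbol of the operator sending `f + A ^ s f` to `⟨A⟩ ^ s f`. -/
def symQuot (s : ℝ) (ξ : R3) : ℂ :=
  (((1 + (2 * Real.pi * ‖ξ‖) ^ 2) ^ (s / 2) / (1 + (2 * Real.pi * ‖ξ‖) ^ s) : ℝ) : ℂ)

lemma isBddSymbol_symQuot {s : ℝ} (hs : 0 ≤ s) (hs' : s ≤ 2) : IsBddSymbol (symQuot s) := by
  refine IsBddSymbol.ofReal (by fun_prop) (fun ξ => by rw [norm_neg]) (c := 1) fun ξ => ?_
  have h0 : 0 ≤ 2 * Real.pi * ‖ξ‖ := by positivity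
  rw [abs_of_nonneg (by positivity), div_le_one (by positivity)]
  exact one_add_sq_rpow_le h0 hs hs'

lemma isMultiplier_symBessel_of_symA {s : ℝ} (hs : 0 ≤ s) (hs' : s ≤ 2) {f g : L2}
    (h : IsMultiplier (symA s) f g) : IsMultiplier (symBessel s) f (D (symQuot s) (f + g)) := by
  have h1 := isMultiplier_D (isBddSymbol_symQuot hs hs') (f + g)
  rw [IsMultiplier, hat_add] at h1
  filter_upwards [h, h1, Lp.coeFn_add (hat f) (hat g)] with ξ h2 h3 h4
  rw [h3, h4, Pi.add_apply, h2, ← one_smul ℂ (hat f ξ), smul_smul, smul_smul, mul_one, mul_one,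
    ← add_smul, smul_smul]
  congr 1
  rw [symQuot, symBessel, symA, ← Complex.ofReal_one, ← Complex.ofReal_add, ← Complex.ofReal_mul,
    div_mul_cancel₀ _ (by positivity)]

section Strong

variable {M : Matrix (Fin 3) (Fin 3) ℝ} {P : L2 →L[ℝ] L2} {r T : ℝ} {u : ℝ → L2}

lemma IsStrongSolution.continuousOn (h : IsStrongSolution M P r T u) (hr : 0 ≤ r) :
    ContinuousOn u (Icc 0 T) := by
  obtain ⟨v, hv, hc⟩ := h.continuous
  refine ((D (symBessel (-r))).continuous.comp_continuousOn hc.continuousOn).congr fun t ht => ?_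
  have hb : IsBddSymbol (symBessel (-r)) := isBddSymbol_symBessel (by linarith)
  exact (isMultiplier_symBessel_zero.1 (((hv t ht).comp (isMultiplier_D hb _)).congr fun ξ => by
    rw [symBessel_mul, neg_add_cancel])).symm

lemma IsStrongSolution.normA_lt_top (h : IsStrongSolution M P r T u) {t : ℝ} (ht : t ∈ Ioc 0 T) :
    normA (5 / 4) (u t) < ⊤ := by
  obtain ⟨v, hv, -⟩ := h.continuous_crit
  exact multNorm_lt_top_of_isMultiplier (hv t ht)

lemma IsStrongSolution.normA_le (h : IsStrongSolution M P r T u) {t : ℝ} (ht : t ∈ Ioc 0 T) :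
    normA (5 / 4) (u t) ≤ ENNReal.ofReal ((critNorm T u).toReal * t ^ (-(3 / 8) : ℝ)) := by
  have h1 : ENNReal.ofReal (t ^ (3 / 8 : ℝ)) * normA (5 / 4) (u t) ≤ critNorm T u :=
    le_iSup₂ (f := fun t (_ : t ∈ Ioc 0 T) =>
      ENNReal.ofReal (t ^ (3 / 8 : ℝ)) * normA (5 / 4) (u t)) t ht
  have ht0 : 0 < t := ht.1
  rw [← ENNReal.ofReal_toReal h.bounded_crit.ne] at h1
  have h2 : normA (5 / 4) (u t) = ENNReal.ofReal (t ^ (-(3 / 8) : ℝ)) *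
      (ENNReal.ofReal (t ^ (3 / 8 : ℝ)) * normA (5 / 4) (u t)) := by
    rw [← mul_assoc, ← ENNReal.ofReal_mul (by positivity), ← Real.rpow_add ht0]
    simp
  rw [h2, mul_comm (critNorm T u).toReal, ENNReal.ofReal_mul (by positivity)]
  gcongr

lemma IsStrongSolution.exists_bessel (h : IsStrongSolution M P r T u) (hr : 0 ≤ r) :
    ∃ F : ℝ → L2, (∀ t ∈ Ioc 0 T, IsMultiplier (symBessel (5 / 4)) (u t) (F t)) ∧
      ContinuousOn F (Ioc 0 T) := by
  obtain ⟨v, hv, hc⟩ := h.continuous_crit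
  refine ⟨fun t => D (symQuot (5 / 4)) (u t + v t),
    fun t ht => isMultiplier_symBessel_of_symA (by norm_num) (by norm_num) (hv t ht), ?_⟩
  exact (D (symQuot (5 / 4))).continuous.comp_continuousOn
    (((h.continuousOn hr).mono Ioc_subset_Icc_self).add hc.continuousOn)

theorem IsStrongSolution.isMild (h : IsStrongSolution M P r T u) (hP : IsFiberedProjection P)
    (hr : 0 ≤ r) : IsMild T u (fun t => force M P (u t)) where
  cont := h.continuousOn hr
  cont_force := by
    obtain ⟨F, hF, hc⟩ := h.exists_bessel hr
    obtain ⟨Q, hQ⟩ := exists_bilin_force M hP le_rfl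
    refine ContinuousOn.congr (f := fun t => P (Q (F t) (F t)))
      (P.continuous.comp_continuousOn ((Q.continuous.comp_continuousOn hc).clm_apply hc))
      fun t ht => ?_
    exact (isMultiplier_symBessel_zero.1 (hQ _ _ (by simpa using hF t ht))).symm
  bound := by
    obtain ⟨K, hK0, hK⟩ := multNorm_force_le M hP
    -- The quadratic estimate squares ‖A^(5/4) u(t)‖ ≤ |u| t^(-3/8), whence the integrable
    -- singularity t^(-3/4).
    refine ⟨K * (critNorm T u).toReal ^ 2, fun t ht => ?_⟩
    have h1 := hK _ isWeight_one (fun _ => rfl) (u t) (h.normA_lt_top ht)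
    have ht0 : 0 < t := ht.1
    simp only [Complex.ofReal_one, one_mul] at h1
    rw [multNorm_one] at h1
    have h2 : normA (5 / 4) (u t) ^ 2 ≤ _ := pow_le_pow_left' (h.normA_le ht) 2
    replace h1 := h1.trans (mul_le_mul_right h2 _)
    rw [← ofReal_norm, ← ENNReal.ofReal_pow (by positivity), ← ENNReal.ofReal_mul hK0.le,
      ENNReal.ofReal_le_ofReal_iff (by positivity), mul_pow, ← Real.rpow_mul_natCast ht0.le,
      ← mul_assoc] at h1
    convert h1 using 3
    norm_num
  deriv φ t ht := (h.equation φ t (Ioo_subset_Ioc_self ht)).hasDerivAt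
    (mem_of_superset (isOpen_Ioo.mem_nhds ht) Ioo_subset_Ioc_self)

end Strong

/-! ### Exponential weights against the heat kernel -/

/-- The symbol of `exp (θ A)` as a real function. -/
def expWeight (θ : ℝ) (ξ : R3) : ℝ := Real.exp (θ * (2 * Real.pi * ‖ξ‖))

lemma one_le_expWeight {θ : ℝ} (hθ : 0 ≤ θ) (ξ : R3) : 1 ≤ expWeight θ ξ :=
  Real.one_le_exp (by positivity)

lemma expWeight_le_mul {θ : ℝ} (hθ : 0 ≤ θ) (ξ η : R3) :
    expWeight θ ξ ≤ expWeight θ η * expWeight θ (ξ - η) := by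
  rw [expWeight, expWeight, expWeight, ← Real.exp_add, ← mul_add, ← mul_add]
  apply Real.exp_le_exp.2
  have := norm_add_le η (ξ - η)
  rw [add_sub_cancel] at this
  gcongr

lemma measurable_expWeight (θ : ℝ) : Measurable (expWeight θ) := by
  unfold expWeight; fun_prop

lemma expWeight_neg (θ : ℝ) (ξ : R3) : expWeight θ (-ξ) = expWeight θ ξ := by
  rw [expWeight, expWeight, norm_neg]

lemma isWeight_expWeight {θ : ℝ} (hθ : 0 ≤ θ) : IsWeight (expWeight θ) :=
  ⟨measurable_expWeight θ, fun _ => (Real.exp_pos _).le, expWeight_le_mul hθ⟩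

lemma isWeight_min_expWeight {θ N : ℝ} (hθ : 0 ≤ θ) (hN : 1 ≤ N) :
    IsWeight (fun ξ => min (expWeight θ ξ) N) := by
  refine ⟨(measurable_expWeight θ).min measurable_const,
    fun _ => le_min (Real.exp_pos _).le (by linarith), fun ξ η => ?_⟩
  have h1 := one_le_expWeight hθ η
  have h2 := one_le_expWeight hθ (ξ - η)
  rcases le_total (expWeight θ η) N with h3 | h3 <;>
    rcases le_total (expWeight θ (ξ - η)) N with h4 | h4
  · rw [min_eq_left h3, min_eq_left h4]
    exact (min_le_left _ _).trans (expWeight_le_mul hθ ξ η)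
  · rw [min_eq_left h3, min_eq_right h4]
    exact (min_le_right _ _).trans (by nlinarith)
  · rw [min_eq_right h3, min_eq_left h4]
    exact (min_le_right _ _).trans (by nlinarith)
  · rw [min_eq_right h3, min_eq_right h4]
    exact (min_le_right _ _).trans (by nlinarith)

/-- The constant comes from x^a ≤ 1 + x² ≤ 4(1 + x² - x) ≤ 4 exp(x² - x). -/
lemma rpow_mul_exp_sub_sq_le {x a : ℝ} (hx : 0 ≤ x) (ha : 0 ≤ a) (ha' : a ≤ 2) :
    x ^ a * Real.exp (x - x ^ 2) ≤ 4 := by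
  have h1 : x ^ a ≤ 1 + x ^ 2 := by
    rcases le_total x 1 with h | h
    · exact (Real.rpow_le_one hx h ha).trans (by nlinarith)
    · have := Real.rpow_le_rpow_of_exponent_le h ha'
      rw [Real.rpow_two] at this
      linarith
  have h2 : 1 + x ^ 2 ≤ 4 * Real.exp (x ^ 2 - x) := by
    have h3 := Real.add_one_le_exp ((x ^ 2 - x))
    nlinarith [sq_nonneg (x - 1), sq_nonneg (3 * x - 2)]
  calc x ^ a * Real.exp (x - x ^ 2) ≤ (4 * Real.exp (x ^ 2 - x)) * Real.exp (x - x ^ 2) := by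
        gcongr; exact h1.trans h2
    _ = 4 := by rw [mul_assoc, ← Real.exp_add]; simp

/-- Parabolic smoothing of the symbols. -/
lemma rpow_mul_exp_mul_heat_le {τ l a : ℝ} (hτ : 0 < τ) (hl : 0 ≤ l) (ha : 0 ≤ a) (ha' : a ≤ 2) :
    l ^ a * (Real.exp (√τ * l) * Real.exp (-(τ * l ^ 2))) ≤ 4 * τ ^ (-(a / 2)) := by
  have h := rpow_mul_exp_sub_sq_le (x := √τ * l) (by positivity) ha ha'
  have e1 : (√τ * l) ^ a = τ ^ (a / 2) * l ^ a := by
    rw [Real.mul_rpow (by positivity) hl, Real.sqrt_eq_rpow, ← Real.rpow_mul hτ.le]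
    congr 2; ring
  rw [e1, mul_pow, Real.sq_sqrt hτ.le, sub_eq_add_neg, Real.exp_add] at h
  rw [Real.rpow_neg hτ.le, ← div_eq_mul_inv, le_div_iff₀ (by positivity)]
  linarith

/-- A Beta integral, bounded by splitting at the midpoint: on each half the nonsingular factor is at
most its value at distance (t-t₀)/2. -/
lemma lintegral_rpow_mul_rpow_le {α β : ℝ} (hα : 0 ≤ α) (hα' : α < 1) (hβ : 0 ≤ β) (hβ' : β < 1) :
    ∃ c : ℝ, 0 < c ∧ ∀ t₀ t : ℝ, t₀ < t →
      ∫⁻ s in Ioo t₀ t, ENNReal.ofReal ((t - s) ^ (-α) * (s - t₀) ^ (-β)) ≤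
        ENNReal.ofReal (c * (t - t₀) ^ (1 - α - β)) := by
  refine ⟨2 ^ α / (1 - β) + 2 ^ β / (1 - α), by
    have := sub_pos.2 hα'; have := sub_pos.2 hβ'; positivity, fun t₀ t ht => ?_⟩
  set τ := t - t₀ with hτ
  have hτ0 : 0 < τ := sub_pos.2 ht
  have hle : ∀ s ∈ Ioo t₀ t, (t - s) ^ (-α) * (s - t₀) ^ (-β) ≤
      (τ / 2) ^ (-α) * (s - t₀) ^ (-β) + (τ / 2) ^ (-β) * (t - s) ^ (-α) := by
    intro s hs
    have h1 : 0 < t - s := sub_pos.2 hs.2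
    have h2 : 0 < s - t₀ := sub_pos.2 hs.1
    rcases le_total (τ / 2) (t - s) with h | h
    · have := Real.rpow_le_rpow_of_nonpos (by positivity) h (neg_nonpos.2 hα)
      have h3 : 0 ≤ (τ / 2) ^ (-β) * (t - s) ^ (-α) := by positivity
      have h4 : 0 ≤ (s - t₀) ^ (-β) := by positivity
      nlinarith
    · have := Real.rpow_le_rpow_of_nonpos (x := τ / 2) (y := s - t₀) (by positivity) (by linarith)
        (neg_nonpos.2 hβ)
      have h3 : 0 ≤ (τ / 2) ^ (-α) * (s - t₀) ^ (-β) := by positivity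
      have h4 : 0 ≤ (t - s) ^ (-α) := by positivity
      nlinarith
  have i1 : IntervalIntegrable (fun s => (s - t₀) ^ (-β)) volume t₀ t := by
    have := (intervalIntegral.intervalIntegrable_rpow' (a := 0) (b := τ) (r := -β)
      (by linarith)).comp_sub_right t₀
    simpa [hτ] using this
  have i2 : IntervalIntegrable (fun s => (t - s) ^ (-α)) volume t₀ t := by
    have := (intervalIntegral.intervalIntegrable_rpow' (a := τ) (b := 0) (r := -α)
      (by linarith)).comp_sub_left t
    simpa [hτ] using this
  have v1 : ∫ s in t₀..t, (s - t₀) ^ (-β) = τ ^ (1 - β) / (1 - β) := by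
    rw [intervalIntegral.integral_comp_sub_right (fun s => s ^ (-β)), integral_rpow (by left; linarith),
      sub_self, Real.zero_rpow (by linarith), ← hτ]
    ring_nf
  have v2 : ∫ s in t₀..t, (t - s) ^ (-α) = τ ^ (1 - α) / (1 - α) := by
    rw [intervalIntegral.integral_comp_sub_left (fun s => s ^ (-α)), integral_rpow (by left; linarith),
      sub_self, Real.zero_rpow (by linarith), ← hτ]
    ring_nf
  have i3 := (i1.const_mul ((τ / 2) ^ (-α))).add (i2.const_mul ((τ / 2) ^ (-β)))
  calc _ ≤ ∫⁻ s in Ioo t₀ t, ENNReal.ofReal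
        ((τ / 2) ^ (-α) * (s - t₀) ^ (-β) + (τ / 2) ^ (-β) * (t - s) ^ (-α)) :=
        setLIntegral_mono' measurableSet_Ioo fun s hs => ENNReal.ofReal_le_ofReal (hle s hs)
    _ = ENNReal.ofReal (∫ s in t₀..t,
        ((τ / 2) ^ (-α) * (s - t₀) ^ (-β) + (τ / 2) ^ (-β) * (t - s) ^ (-α))) := by
        rw [intervalIntegral.integral_of_le ht.le, integral_Ioc_eq_integral_Ioo,
          ofReal_integral_eq_lintegral_ofReal]
        · exact (intervalIntegrable_iff_integrableOn_Ioo_of_le ht.le).1 i3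
        · refine (ae_restrict_iff' measurableSet_Ioo).2 (Eventually.of_forall fun s hs => ?_)
          have h1 : 0 < t - s := sub_pos.2 hs.2
          have h2 : 0 < s - t₀ := sub_pos.2 hs.1
          simp only [Pi.zero_apply]
          positivity
    _ = _ := by
        rw [intervalIntegral.integral_add (i1.const_mul _) (i2.const_mul _),
          intervalIntegral.integral_const_mul, intervalIntegral.integral_const_mul, v1, v2]
        congr 1
        have e2 : ∀ γ : ℝ, (τ / 2) ^ (-γ) = τ ^ (-γ) * 2 ^ γ := fun γ => by
          rw [Real.div_rpow hτ0.le zero_le_two, Real.rpow_neg zero_le_two, div_inv_eq_mul]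
        have e3 : τ ^ (1 - α - β) = τ ^ (-α) * τ ^ (1 - β) := by
          rw [← Real.rpow_add hτ0]; congr 1; ring
        have e4 : τ ^ (1 - α - β) = τ ^ (-β) * τ ^ (1 - α) := by
          rw [← Real.rpow_add hτ0]; congr 1; ring
        rw [e2, e2, add_mul]
        nth_rewrite 1 [e3]
        rw [e4]
        ring

lemma sqrt_sub_le {t₀ s t : ℝ} (h₁ : t₀ ≤ s) (h₂ : s ≤ t) : √(t - t₀) ≤ √(t - s) + √(s - t₀) := by
  refine Real.sqrt_le_iff.2 ⟨by positivity, ?_⟩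
  nlinarith [Real.sq_sqrt (sub_nonneg.2 h₁), Real.sq_sqrt (sub_nonneg.2 h₂),
    Real.sqrt_nonneg (t - s), Real.sqrt_nonneg (s - t₀),
    mul_nonneg (Real.sqrt_nonneg (t - s)) (Real.sqrt_nonneg (s - t₀))]

/-- Subadditivity of the square root. The first factor grows at the parabolic scale, so exp((t-s)Δ)
can absorb it; the second is the weight belonging to time `s`. -/
lemma expWeight_sqrt_le {t₀ s t : ℝ} (h₁ : t₀ ≤ s) (h₂ : s ≤ t) (ξ : R3) :
    expWeight √(t - t₀) ξ ≤ expWeight √(t - s) ξ * expWeight √(s - t₀) ξ := by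
  rw [expWeight, expWeight, expWeight, ← Real.exp_add, ← add_mul]
  apply Real.exp_le_exp.2
  have := sqrt_sub_le h₁ h₂
  gcongr

/-- The forcing is controlled quadratically in every submultiplicative weight. -/
def ForceBound (K T : ℝ) (u b : ℝ → L2) : Prop :=
  ∀ W : R3 → ℝ, IsWeight W → (∀ ξ, W (-ξ) = W ξ) → ∀ t ∈ Ioc 0 T,
    multNorm (fun ξ => (W ξ : ℂ)) (b t) ≤
      ENNReal.ofReal K * multNorm (fun ξ => (W ξ : ℂ) * symA (5 / 4) ξ) (u t) ^ 2

/-- Families of weights whose growth in time is absorbed by the heat flow. -/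
structure IsHeatWeight (t₀ : ℝ) (V : ℝ → R3 → ℝ) : Prop where
  isWeight : ∀ t, IsWeight (V t)
  even : ∀ t ξ, V t (-ξ) = V t ξ
  bdd : ∀ t R, ∃ c, ∀ ξ : R3, 2 * Real.pi * ‖ξ‖ ≤ R → V t ξ ≤ c
  growth : ∀ s t, t₀ ≤ s → s ≤ t → ∀ ξ, V t ξ ≤ expWeight √(t - s) ξ * V s ξ

lemma isHeatWeight_expWeight (t₀ : ℝ) : IsHeatWeight t₀ (fun t => expWeight √(t - t₀)) where
  isWeight t := isWeight_expWeight (Real.sqrt_nonneg _)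
  even t ξ := expWeight_neg _ ξ
  bdd t R := ⟨Real.exp (√(t - t₀) * R), fun ξ hξ => Real.exp_le_exp.2 (by gcongr)⟩
  growth s t h₁ h₂ ξ := expWeight_sqrt_le h₁ h₂ ξ

lemma isHeatWeight_min_expWeight (t₀ : ℝ) {N : ℝ} (hN : 1 ≤ N) :
    IsHeatWeight t₀ (fun t ξ => min (expWeight √(t - t₀) ξ) N) where
  isWeight t := isWeight_min_expWeight (Real.sqrt_nonneg _) hN
  even t ξ := by rw [expWeight_neg]
  bdd t R := ⟨N, fun ξ hξ => min_le_right _ _⟩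
  growth s t h₁ h₂ ξ := by
    have h3 := one_le_expWeight (Real.sqrt_nonneg (t - s)) ξ
    rw [mul_min_of_nonneg _ _ (by linarith)]
    exact min_le_min (expWeight_sqrt_le h₁ h₂ ξ) (by nlinarith)

lemma IsHeatWeight.norm_mul_heat_le {t₀ : ℝ} {V : ℝ → R3 → ℝ} (hV : IsHeatWeight t₀ V) {a : ℝ}
    (ha : 0 ≤ a) (ha' : a ≤ 2) {s t : ℝ} (h₁ : t₀ ≤ s) (h₂ : s < t) (ξ : R3) :
    ‖(V t ξ : ℂ) * symA a ξ * symHeat (t - s) ξ‖ ≤ 4 * (t - s) ^ (-(a / 2)) * ‖(V s ξ : ℂ)‖ := by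
  rw [norm_mul, norm_mul, norm_symA, norm_symHeat, Complex.norm_real, Complex.norm_real,
    Real.norm_of_nonneg ((hV.isWeight t).nonneg ξ), Real.norm_of_nonneg ((hV.isWeight s).nonneg ξ)]
  have h := rpow_mul_exp_mul_heat_le (sub_pos.2 h₂) (l := 2 * Real.pi * ‖ξ‖) (by positivity) ha ha'
  have h3 := hV.growth s t h₁ h₂.le ξ
  have h4 := (hV.isWeight s).nonneg ξ
  calc _ ≤ (expWeight √(t - s) ξ * V s ξ) * (2 * Real.pi * ‖ξ‖) ^ a *
        Real.exp (-((t - s) * (2 * Real.pi * ‖ξ‖) ^ 2)) := by gcongr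
    _ = ((2 * Real.pi * ‖ξ‖) ^ a * (Real.exp (√(t - s) * (2 * Real.pi * ‖ξ‖)) *
        Real.exp (-((t - s) * (2 * Real.pi * ‖ξ‖) ^ 2)))) * V s ξ := by rw [expWeight]; ring
    _ ≤ _ := by gcongr

/-! ### The Gevrey bootstrap -/

section Gevrey

variable {K T : ℝ} {u b : ℝ → L2}

/-- Duhamel's formula in weighted norms. -/
lemma IsMild.weighted_le (h : IsMild T u b) (hK0 : 0 ≤ K) (hK : ForceBound K T u b) {a c : ℝ}
    (ha : 0 ≤ a) (ha' : a ≤ 2)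
    (hc : ∀ t₀ t : ℝ, t₀ < t →
      ∫⁻ s in Ioo t₀ t, ENNReal.ofReal ((t - s) ^ (-(a / 2)) * (s - t₀) ^ (-(3 / 4) : ℝ)) ≤
        ENNReal.ofReal (c * (t - t₀) ^ (1 - a / 2 - 3 / 4)))
    {t₀ t B : ℝ} (ht₀ : 0 ≤ t₀) (ht : t₀ < t) (htT : t ≤ T) {V : ℝ → R3 → ℝ}
    (hV : IsHeatWeight t₀ V) (hB0 : 0 ≤ B)
    (hB : ∀ s ∈ Ioo t₀ t, multNorm (fun ξ => (V s ξ : ℂ) * symA (5 / 4) ξ) (u s) ≤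
      ENNReal.ofReal (B * (s - t₀) ^ (-(3 / 8) : ℝ))) :
    multNorm (fun ξ => (V t ξ : ℂ) * symA a ξ) (u t) ≤
      multNorm (fun ξ => (V t ξ : ℂ) * symA a ξ * symHeat (t - t₀) ξ) (u t₀) +
        ENNReal.ofReal (4 * K * B ^ 2 * (c * (t - t₀) ^ (1 - a / 2 - 3 / 4))) := by
  have hw : IsSymbol (fun ξ => (V t ξ : ℂ) * symA a ξ) :=
    (IsSymbol.ofReal (hV.isWeight t).meas (hV.even t)).mul (isSymbol_symA a)
  refine (h.multNorm_le hw (fun R => ?_) ht₀ ht.le htT).trans (add_le_add le_rfl ?_)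
  · obtain ⟨c, hc⟩ := hV.bdd t R
    refine ⟨c * R ^ a, fun ξ hξ => ?_⟩
    rw [norm_mul, norm_symA, Complex.norm_real, Real.norm_of_nonneg ((hV.isWeight t).nonneg ξ)]
    exact mul_le_mul (hc ξ hξ) (Real.rpow_le_rpow (by positivity) hξ ha) (by positivity)
      (((hV.isWeight t).nonneg ξ).trans (hc ξ hξ))
  · rw [setLIntegral_congr Ioo_ae_eq_Ioc.symm]
    -- Parabolic smoothing contributes 4(t-s)^(-a/2) and lowers the weight to time `s`; the
    -- quadratic force bound contributes K (B (s-t₀)^(-3/8))².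
    have hle : ∀ s ∈ Ioo t₀ t,
        multNorm (fun ξ => (V t ξ : ℂ) * symA a ξ * symHeat (t - s) ξ) (b s) ≤
          ENNReal.ofReal (4 * K * B ^ 2) *
            ENNReal.ofReal ((t - s) ^ (-(a / 2)) * (s - t₀) ^ (-(3 / 4) : ℝ)) := by
      intro s hs
      have h1 : 0 < t - s := sub_pos.2 hs.2
      have h2 : 0 < s - t₀ := sub_pos.2 hs.1
      have h3 := multNorm_le_mul (b s) (hV.norm_mul_heat_le ha ha' hs.1.le hs.2)
      have h4 := hK (V s) (hV.isWeight s) (hV.even s) s ⟨ht₀.trans_lt hs.1, hs.2.le.trans htT⟩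
      have h5 := pow_le_pow_left' (hB s hs) 2
      refine h3.trans ((mul_le_mul_right (h4.trans (mul_le_mul_right h5 _)) _).trans (le_of_eq ?_))
      rw [← ENNReal.ofReal_pow (by positivity), ← ENNReal.ofReal_mul hK0,
        ← ENNReal.ofReal_mul (by positivity), ← ENNReal.ofReal_mul (by positivity), mul_pow,
        ← Real.rpow_mul_natCast h2.le]
      congr 1
      norm_num
      ring
    refine (setLIntegral_mono' measurableSet_Ioo hle).trans ?_
    rw [lintegral_const_mul' _ _ ENNReal.ofReal_ne_top,
      ENNReal.ofReal_mul (p := 4 * K * B ^ 2) (by positivity)]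
    exact mul_le_mul_right (hc t₀ t ht) _

/-- The truncated Gevrey norms satisfy a uniform bound by bootstrapping in the truncation. -/
theorem IsMild.gevrey (h : IsMild T u b) (hK0 : 0 ≤ K) (hK : ForceBound K T u b) {c : ℝ}
    (hc : ∀ t₀ t : ℝ, t₀ < t →
      ∫⁻ s in Ioo t₀ t, ENNReal.ofReal ((t - s) ^ (-(5 / 4 / 2) : ℝ) * (s - t₀) ^ (-(3 / 4) : ℝ)) ≤
        ENNReal.ofReal (c * (t - t₀) ^ (1 - 5 / 4 / 2 - 3 / 4 : ℝ)))
    (hc0 : 0 ≤ c) {ε : ℝ} (hε : 0 ≤ ε) (hε' : 64 * K * c * ε ≤ 1) {t₀ t₁ : ℝ} (ht₀ : 0 ≤ t₀)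
    (ht₁ : t₁ ≤ T)
    (H1 : ∀ t ∈ Ioc t₀ t₁, multNorm (fun ξ => (expWeight √(t - t₀) ξ : ℂ) * symA (5 / 4) ξ *
      symHeat (t - t₀) ξ) (u t₀) ≤ ENNReal.ofReal (ε * (t - t₀) ^ (-(3 / 8) : ℝ)))
    (H2 : ∀ t ∈ Ioc t₀ t₁, normA (5 / 4) (u t) ≤
      ENNReal.ofReal (2 * ε * (t - t₀) ^ (-(3 / 8) : ℝ))) {t : ℝ} (ht : t ∈ Ioc t₀ t₁) :
    multNorm (fun ξ => (expWeight √(t - t₀) ξ : ℂ) * symA (5 / 4) ξ) (u t) ≤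
      ENNReal.ofReal (2 * ε * (t - t₀) ^ (-(3 / 8) : ℝ)) := by
  -- Truncation keeps the weight submultiplicative and compatible with the heat flow. At `n = 0` it
  -- is 1, where the bound is `H2`.
  set V : ℕ → ℝ → R3 → ℝ := fun n t ξ => min (expWeight √(t - t₀) ξ) (2 ^ n) with hVdef
  have hV : ∀ n, IsHeatWeight t₀ (V n) := fun n =>
    isHeatWeight_min_expWeight t₀ (one_le_pow₀ one_le_two)
  have main : ∀ n, ∀ t ∈ Ioc t₀ t₁, multNorm (fun ξ => (V n t ξ : ℂ) * symA (5 / 4) ξ) (u t) ≤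
      ENNReal.ofReal (2 * ε * (t - t₀) ^ (-(3 / 8) : ℝ)) := by
    intro n
    induction n with
    | zero =>
      intro t ht
      refine le_trans (le_of_eq ?_) (H2 t ht)
      congr 1; ext ξ
      rw [hVdef]
      simp only [pow_zero]
      rw [min_eq_right (one_le_expWeight (Real.sqrt_nonneg _) ξ), Complex.ofReal_one, one_mul]
    | succ n ih =>
      intro t ht
      have hτ : 0 < t - t₀ := sub_pos.2 ht.1
      -- Raising the truncation from 2^n to 2^(n+1) at most doubles the weight, so the bound 2ε
      -- becomes 4ε.
      have h4 : ∀ s ∈ Ioo t₀ t, multNorm (fun ξ => (V (n + 1) s ξ : ℂ) * symA (5 / 4) ξ) (u s) ≤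
          ENNReal.ofReal (4 * ε * (s - t₀) ^ (-(3 / 8) : ℝ)) := by
        intro s hs
        have h5 := multNorm_le_mul (c := 2) (w := fun ξ => (V (n + 1) s ξ : ℂ) * symA (5 / 4) ξ)
          (w' := fun ξ => (V n s ξ : ℂ) * symA (5 / 4) ξ) (u s) (fun ξ => by
            rw [norm_mul, norm_mul, ← mul_assoc, Complex.norm_real, Complex.norm_real,
              Real.norm_of_nonneg (((hV _).isWeight s).nonneg ξ),
              Real.norm_of_nonneg (((hV _).isWeight s).nonneg ξ)]
            refine mul_le_mul_of_nonneg_right ?_ (norm_nonneg _)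
            rw [hVdef]
            simp only
            rw [mul_min_of_nonneg _ _ zero_le_two, pow_succ']
            have := (isWeight_expWeight (Real.sqrt_nonneg (s - t₀))).nonneg ξ
            exact min_le_min (by linarith) le_rfl)
        refine h5.trans ((mul_le_mul_right (ih s ⟨hs.1, hs.2.le.trans ht.2⟩) _).trans (le_of_eq ?_))
        rw [← ENNReal.ofReal_mul zero_le_two]
        congr 1; ring
      refine (h.weighted_le hK0 hK (by norm_num) (by norm_num) hc ht₀ ht.1 (ht.2.trans ht₁)
        (hV (n + 1)) (by positivity) h4).trans ?_
      refine (add_le_add ((multNorm_mono (u t₀) fun ξ => ?_).trans (H1 t ht)) le_rfl).trans ?_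
      · rw [norm_mul, norm_mul, norm_mul, norm_mul, Complex.norm_real, Complex.norm_real,
          Real.norm_of_nonneg (((hV _).isWeight t).nonneg ξ),
          Real.norm_of_nonneg ((isWeight_expWeight (Real.sqrt_nonneg _)).nonneg ξ)]
        gcongr
        exact min_le_left _ _
      · rw [← ENNReal.ofReal_add (by positivity) (by positivity)]
        apply ENNReal.ofReal_le_ofReal
        rw [show (1 - 5 / 4 / 2 - 3 / 4 : ℝ) = -(3 / 8) by norm_num]
        have h6 : 0 < (t - t₀) ^ (-(3 / 8) : ℝ) := by positivity
        -- This is where 64 comes from: the Duhamel term costs at most ε, the heat term at most ε,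
        -- and the bound 2ε is restored.
        have h7 : 4 * K * (4 * ε) ^ 2 * c ≤ ε := by nlinarith
        nlinarith
  refine multNorm_le_of_tendsto (v := fun n ξ => (V n t ξ : ℂ) * symA (5 / 4) ξ)
    (fun n => (Complex.measurable_ofReal.comp ((hV n).isWeight t).meas).mul (measurable_symA _))
    (u t) (fun ξ => ?_) (fun n => main n t ht)
  apply tendsto_const_nhds.congr'
  obtain ⟨n₀, hn₀⟩ := pow_unbounded_of_one_lt (expWeight √(t - t₀) ξ) one_lt_two
  filter_upwards [eventually_ge_atTop n₀] with n hn
  rw [hVdef]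
  simp only
  rw [min_eq_left (hn₀.le.trans (pow_le_pow_right₀ one_le_two hn))]

end Gevrey

lemma isHeatWeight_one (t₀ : ℝ) : IsHeatWeight t₀ (fun _ _ => 1) where
  isWeight _ := isWeight_one
  even _ _ := rfl
  bdd _ _ := ⟨1, fun _ _ => le_rfl⟩
  growth s t _ _ ξ := by rw [mul_one]; exact one_le_expWeight (Real.sqrt_nonneg _) ξ

lemma norm_expWeight (θ : ℝ) (ξ : R3) : ‖(expWeight θ ξ : ℂ)‖ = expWeight θ ξ := by
  rw [Complex.norm_real]
  exact Real.norm_of_nonneg (Real.exp_pos _).le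

/-- Boundedness in time of the critical norm of the Duhamel integral with kernel of order `a`. -/
def KernelBound (a c : ℝ) : Prop := ∀ t₀ t : ℝ, t₀ < t →
  ∫⁻ s in Ioo t₀ t, ENNReal.ofReal ((t - s) ^ (-(a / 2)) * (s - t₀) ^ (-(3 / 4) : ℝ)) ≤
    ENNReal.ofReal (c * (t - t₀) ^ (1 - a / 2 - 3 / 4))

lemma exists_kernelBound {a : ℝ} (ha : 0 ≤ a) (ha' : a < 2) : ∃ c, 0 < c ∧ KernelBound a c :=
  lintegral_rpow_mul_rpow_le (by linarith) (by linarith) (by norm_num) (by norm_num)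

section Bootstrap

variable {K T : ℝ} {u b : ℝ → L2}

/-- Smallness of the heat evolution of the initial value propagates to the solution. -/
theorem IsMild.small_of_heat (h : IsMild T u b) (hK0 : 0 ≤ K) (hK : ForceBound K T u b) {c : ℝ}
    (hc : KernelBound (5 / 4) c) (hc0 : 0 ≤ c) {ε : ℝ} (hε : 0 < ε) (hε' : 64 * K * c * ε ≤ 1)
    (hcont : MultContDiffOn 0 (symA (5 / 4)) (Ioc 0 T) u)
    (hvan : Tendsto (fun t : ℝ => ENNReal.ofReal (t ^ (3 / 8 : ℝ)) * normA (5 / 4) (u t))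
      (𝓝[>] 0) (𝓝 0)) {t₁ : ℝ} (ht₁ : t₁ ≤ T)
    (H1 : ∀ t ∈ Ioc 0 t₁, multNorm (fun ξ => (expWeight √t ξ : ℂ) * symA (5 / 4) ξ *
      symHeat t ξ) (u 0) ≤ ENNReal.ofReal (ε * t ^ (-(3 / 8) : ℝ))) :
    ∀ t ∈ Ioc 0 t₁, normA (5 / 4) (u t) ≤ ENNReal.ofReal (2 * ε * t ^ (-(3 / 8) : ℝ)) := by
  obtain ⟨v, hv, hvc⟩ := hcont
  set g : ℝ → ℝ := fun t => t ^ (3 / 8 : ℝ) * ‖v t‖ with hg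
  have hgc : ContinuousOn g (Ioc 0 T) :=
    ((Real.continuous_rpow_const (by norm_num)).continuousOn).mul hvc.continuousOn.norm
  have hnv : ∀ t ∈ Ioc 0 T, normA (5 / 4) (u t) = ENNReal.ofReal ‖v t‖ := fun t ht => by
    rw [ofReal_norm, (hv t ht).enorm_eq, normA]
  -- `max B 0` accounts for `ENNReal.ofReal` sending negative numbers to 0.
  have hiff : ∀ t ∈ Ioc 0 T, ∀ B : ℝ,
      normA (5 / 4) (u t) ≤ ENNReal.ofReal (B * t ^ (-(3 / 8) : ℝ)) ↔ g t ≤ max B 0 := by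
    intro t ht B
    have ht0 : 0 < t := ht.1
    have hp : 0 < t ^ (3 / 8 : ℝ) := by positivity
    rw [hnv t ht, Real.rpow_neg ht0.le, ← div_eq_mul_inv, hg]
    rcases le_total 0 B with hB | hB
    · rw [ENNReal.ofReal_le_ofReal_iff (by positivity), le_div_iff₀ hp, mul_comm, max_eq_left hB]
    · rw [ENNReal.ofReal_of_nonpos (div_nonpos_of_nonpos_of_nonneg hB hp.le), max_eq_right hB,
        nonpos_iff_eq_zero, ENNReal.ofReal_eq_zero]
      constructor
      · intro h; exact mul_nonpos_of_nonneg_of_nonpos hp.le h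
      · intro h; by_contra! h2; exact absurd h (not_le.2 (mul_pos hp h2))
  obtain ⟨η, hη, hη'⟩ : ∃ η > 0, ∀ s ∈ Ioo 0 η, s ≤ T → g s < 2 * ε := by
    have h1 := hvan.eventually (gt_mem_nhds (ENNReal.ofReal_pos.2 (by positivity : 0 < 2 * ε)))
    obtain ⟨η, hη, h2⟩ := (mem_nhdsGT_iff_exists_Ioo_subset).1 h1
    refine ⟨η, hη, fun s hs hsT => ?_⟩
    have h3 := h2 hs
    simp only [mem_ofPred_eq] at h3
    have hs0 : 0 < s := hs.1
    rwa [hnv s ⟨hs.1, hsT⟩, ← ENNReal.ofReal_mul (by positivity),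
      ENNReal.ofReal_lt_ofReal_iff (by positivity)] at h3
  intro t ht
  have htT : t ∈ Ioc 0 T := ⟨ht.1, ht.2.trans ht₁⟩
  rw [hiff t htT, max_eq_left (by positivity)]
  by_contra! hbad
  have hηt : η ≤ t := by
    by_contra! h
    exact absurd (hη' t ⟨ht.1, h⟩ htT.2) (not_lt.2 hbad.le)
  have hsub : Icc (η / 2) t₁ ⊆ Ioc 0 T := fun s hs => ⟨(half_pos hη).trans_le hs.1, hs.2.trans ht₁⟩
  -- Continuity method: `g` is below 2ε near 0, so the set of bad times has a first element s₀.
  -- Duhamel with the trivial weight then gives g(s₀) ≤ 5ε/4, a contradiction.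
  have hS : IsCompact (Icc (η / 2) t₁ ∩ g ⁻¹' Ici (2 * ε)) :=
    isCompact_Icc.of_isClosed_subset
      ((hgc.mono hsub).preimage_isClosed_of_isClosed isClosed_Icc isClosed_Ici) inter_subset_left
  obtain ⟨s₀, hs₀, hleast⟩ := hS.exists_isLeast ⟨t, ⟨by linarith, ht.2⟩, hbad.le⟩
  have hs₀T := hsub hs₀.1
  have hlt : ∀ s ∈ Ioo 0 s₀, multNorm (fun ξ => ((1 : ℝ) : ℂ) * symA (5 / 4) ξ) (u s) ≤
      ENNReal.ofReal (2 * ε * (s - 0) ^ (-(3 / 8) : ℝ)) := by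
    intro s hs
    have hsT : s ∈ Ioc 0 T := ⟨hs.1, hs.2.le.trans hs₀T.2⟩
    simp only [Complex.ofReal_one, one_mul, sub_zero]
    refine (hiff s hsT (2 * ε)).2 ?_
    rw [max_eq_left (by positivity)]
    by_contra! h2
    rcases lt_or_ge s η with h3 | h3
    · exact absurd (hη' s ⟨hs.1, h3⟩ hsT.2) (not_lt.2 h2.le)
    · exact absurd (hleast ⟨⟨by linarith, hs.2.le.trans hs₀.1.2⟩, h2.le⟩) (not_le.2 hs.2)
  have h5 := h.weighted_le hK0 hK (by norm_num) (by norm_num) hc le_rfl hs₀T.1 hs₀T.2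
    (isHeatWeight_one 0) (by positivity) hlt
  simp only [Complex.ofReal_one, one_mul, sub_zero] at h5
  have h6 := (multNorm_mono (w := fun ξ => symA (5 / 4) ξ * symHeat s₀ ξ) (u 0) fun ξ => by
    rw [norm_mul, norm_mul, norm_mul, norm_expWeight, mul_assoc]
    exact le_mul_of_one_le_left (by positivity)
      (one_le_expWeight (Real.sqrt_nonneg _) ξ)).trans (H1 s₀ ⟨hs₀T.1, hs₀.1.2⟩)
  have hs00 : 0 < s₀ := hs₀T.1
  have h7 : normA (5 / 4) (u s₀) ≤ ENNReal.ofReal (5 / 4 * ε * s₀ ^ (-(3 / 8) : ℝ)) := by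
    refine (h5.trans (add_le_add h6 le_rfl)).trans ?_
    rw [← ENNReal.ofReal_add (by positivity) (by positivity)]
    apply ENNReal.ofReal_le_ofReal
    rw [show (1 - 5 / 4 / 2 - 3 / 4 : ℝ) = -(3 / 8) by norm_num]
    have h6 : 0 < s₀ ^ (-(3 / 8) : ℝ) := by positivity
    have h7 : 4 * K * (2 * ε) ^ 2 * c ≤ ε / 4 := by nlinarith
    nlinarith
  rw [hiff s₀ hs₀T, max_eq_left (by positivity)] at h7
  have h8 : 2 * ε ≤ g s₀ := hs₀.2
  linarith

/-- The analyticity bound in `H^(1/2)` on an interval of smallness. -/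
theorem IsMild.normExpH_le (h : IsMild T u b) (hK0 : 0 ≤ K) (hK : ForceBound K T u b) {c c₀ c₁ : ℝ}
    (hc : KernelBound (5 / 4) c) (hc0 : 0 ≤ c) (hc₀ : KernelBound 0 c₀) (hc₀0 : 0 ≤ c₀)
    (hc₁ : KernelBound (1 / 2) c₁) (hc₁0 : 0 ≤ c₁) {ε : ℝ} (hε : 0 ≤ ε) (hε' : 64 * K * c * ε ≤ 1)
    {t₀ t : ℝ} (ht₀ : 0 ≤ t₀) (ht : t₀ < t) (htT : t ≤ T)
    (H1 : ∀ s ∈ Ioc t₀ t, multNorm (fun ξ => (expWeight √(s - t₀) ξ : ℂ) * symA (5 / 4) ξ *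
      symHeat (s - t₀) ξ) (u t₀) ≤ ENNReal.ofReal (ε * (s - t₀) ^ (-(3 / 8) : ℝ)))
    (H2 : ∀ s ∈ Ioc t₀ t, normA (5 / 4) (u s) ≤
      ENNReal.ofReal (2 * ε * (s - t₀) ^ (-(3 / 8) : ℝ))) :
    normExpH √(t - t₀) (1 / 2) (u t) ≤ 8 * normH (1 / 2) (u t₀) +
      ENNReal.ofReal (16 * K * ε ^ 2 * (c₀ * (t - t₀) ^ (1 / 4 : ℝ) + c₁)) := by
  have hτ : 0 < t - t₀ := sub_pos.2 ht
  have hB := fun s (hs : s ∈ Ioo t₀ t) =>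
    h.gevrey hK0 hK hc hc0 hε hε' ht₀ htT H1 H2 (Ioo_subset_Ioc_self hs)
  have hV := isHeatWeight_expWeight t₀
  have a0 := h.weighted_le hK0 hK le_rfl (by norm_num) hc₀ ht₀ ht htT hV (by positivity) hB
  have a1 := h.weighted_le hK0 hK (by norm_num) (by norm_num) hc₁ ht₀ ht htT hV (by positivity) hB
  have heat : ∀ a : ℝ, 0 ≤ a → a ≤ 1 / 2 →
      multNorm (fun ξ => (expWeight √(t - t₀) ξ : ℂ) * symA a ξ * symHeat (t - t₀) ξ) (u t₀) ≤
        4 * normH (1 / 2) (u t₀) := by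
    intro a ha ha'
    refine (multNorm_le_mul (c := 4) (w' := symBessel (1 / 2)) (u t₀) fun ξ => ?_).trans
      (le_of_eq (by rw [normH]; norm_num))
    have h1 := rpow_mul_exp_mul_heat_le hτ (l := 2 * Real.pi * ‖ξ‖) (by positivity) le_rfl zero_le_two
    have h2 := (norm_symA_le_symBessel ha ξ).trans (norm_symBessel_mono ha' ξ)
    rw [norm_mul, norm_mul, norm_expWeight, norm_symHeat, expWeight]
    norm_num at h1
    calc _ = (Real.exp (√(t - t₀) * (2 * Real.pi * ‖ξ‖)) *
          Real.exp (-((t - t₀) * (2 * Real.pi * ‖ξ‖) ^ 2))) * ‖symA a ξ‖ := by ring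
      _ ≤ _ := by gcongr
  have hm : ∀ a, Measurable fun ξ => (expWeight √(t - t₀) ξ : ℂ) * symA a ξ := fun a =>
    (Complex.measurable_ofReal.comp (measurable_expWeight _)).mul (measurable_symA _)
  have key : normExpH √(t - t₀) (1 / 2) (u t) ≤
      multNorm (fun ξ => (expWeight √(t - t₀) ξ : ℂ) * symA 0 ξ) (u t) +
      multNorm (fun ξ => (expWeight √(t - t₀) ξ : ℂ) * symA (1 / 2) ξ) (u t) := by
    refine multNorm_le_add (u t) (hm 0) (hm _) fun ξ => ?_
    have h1 := norm_symBessel_le_one_add (s := 1 / 2) (by norm_num) (by norm_num) ξ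
    have h2 : ‖symA 0 ξ‖ = 1 := by rw [norm_symA, Real.rpow_zero]
    rw [norm_mul, norm_mul, norm_mul, h2, ← mul_add]
    exact mul_le_mul_of_nonneg_left h1 (norm_nonneg _)
  refine (key.trans (add_le_add (a0.trans (add_le_add (heat 0 le_rfl (by norm_num)) le_rfl))
    (a1.trans (add_le_add (heat _ (by norm_num) le_rfl) le_rfl)))).trans (le_of_eq ?_)
  rw [add_add_add_comm, ← add_mul, ← ENNReal.ofReal_add (by positivity) (by positivity)]
  congr 2
  · norm_num
  · rw [show (1 - 0 / 2 - 3 / 4 : ℝ) = 1 / 4 by norm_num,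
      show (1 - 1 / 2 / 2 - 3 / 4 : ℝ) = 0 by norm_num, Real.rpow_zero]
    ring

end Bootstrap

/-! ### Smallness of the heat evolution and the analyticity bounds -/

/-- Guarantees that the `sSup` in the Sobolev bounds is a genuine supremum and not the default value
0. -/
lemma bddAbove_rpow_mul_exp_neg {p : ℝ} (hp : 0 ≤ p) :
    BddAbove ((fun x : ℝ => x ^ p * Real.exp (-x)) '' Ici 0) := by
  refine ⟨1 + (⌈p⌉₊.factorial : ℝ), ?_⟩
  rintro _ ⟨x, hx, rfl⟩
  have hx : 0 ≤ x := hx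
  have h1 : x ^ p ≤ 1 + x ^ ⌈p⌉₊ := by
    rcases le_total x 1 with h | h
    · exact (Real.rpow_le_one hx h hp).trans (by simp; positivity)
    · have := Real.rpow_le_rpow_of_exponent_le h (Nat.le_ceil p)
      rw [Real.rpow_natCast] at this
      linarith
  have h2 := Real.pow_div_factorial_le_exp x hx ⌈p⌉₊
  rw [div_le_iff₀ (by positivity)] at h2
  have h3 := Real.one_le_exp hx
  have h4 : 0 < (⌈p⌉₊.factorial : ℝ) := by positivity
  simp only
  rw [Real.exp_neg, ← div_eq_mul_inv, div_le_iff₀ (Real.exp_pos _)]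
  nlinarith

/-- The Sobolev bounds follow from the analyticity bound. -/
lemma normA_le_of_normExpH {θ C s : ℝ} (hθ : 0 < θ) (hs : 1 / 2 ≤ s) {f : L2}
    (hf : normExpH θ (1 / 2) f ≤ ENNReal.ofReal C) :
    normA s f ≤ ENNReal.ofReal
      (C * sSup ((fun x : ℝ => x ^ (s - 1 / 2) * Real.exp (-x)) '' Ici 0) * θ ^ (-(s - 1 / 2))) := by
  set p := s - 1 / 2 with hp
  have hp0 : 0 ≤ p := by linarith
  set S := sSup ((fun x : ℝ => x ^ p * Real.exp (-x)) '' Ici 0) with hS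
  have hle : ∀ x : ℝ, 0 ≤ x → x ^ p * Real.exp (-x) ≤ S := fun x hx =>
    le_csSup (bddAbove_rpow_mul_exp_neg hp0) ⟨x, hx, rfl⟩
  have hS0 : 0 ≤ S := (by positivity : 0 ≤ (0 : ℝ) ^ p * Real.exp (-0)).trans (hle 0 le_rfl)
  refine (multNorm_le_mul (c := S * θ ^ (-p)) (w' := fun ξ => symExp θ ξ * symBessel (1 / 2) ξ) f
    fun ξ => ?_).trans ((mul_le_mul_right hf _).trans (le_of_eq ?_))
  · set l := 2 * Real.pi * ‖ξ‖ with hl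
    have hl0 : 0 ≤ l := by positivity
    have h1 := hle (θ * l) (by positivity)
    rw [Real.exp_neg, ← div_eq_mul_inv, div_le_iff₀ (Real.exp_pos _), Real.mul_rpow hθ.le hl0] at h1
    have h2 : l ^ s = l ^ p * l ^ (1 / 2 : ℝ) := by
      rw [← Real.rpow_add_of_nonneg hl0 hp0 (by norm_num)]; congr 1; ring
    have h3 := norm_symA_le_symBessel (s := 1 / 2) (by norm_num) ξ
    rw [norm_symA, ← hl] at h3
    rw [norm_symA, ← hl, h2, norm_mul, symExp, Complex.norm_real,
      Real.norm_of_nonneg (Real.exp_pos _).le, ← hl]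
    have h4 : l ^ p ≤ S * Real.exp (θ * l) * θ ^ (-p) := by
      rw [Real.rpow_neg hθ.le, ← div_eq_mul_inv, le_div_iff₀ (by positivity)]
      linarith
    calc l ^ p * l ^ (1 / 2 : ℝ) ≤ (S * Real.exp (θ * l) * θ ^ (-p)) * ‖symBessel (1 / 2) ξ‖ := by
          gcongr
      _ = _ := by ring
  · rw [← ENNReal.ofReal_mul (by positivity)]
    congr 1; ring

/-- Smallness of the heat evolution of `f` in the critical Gevrey norm on `]0, τ]`. -/
def HeatSmall (ε τ : ℝ) (f : L2) : Prop := ∀ t ∈ Ioc 0 τ,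
  multNorm (fun ξ => (expWeight √t ξ : ℂ) * symA (5 / 4) ξ * symHeat t ξ) f ≤
    ENNReal.ofReal (ε * t ^ (-(3 / 8) : ℝ))

/-- Smoothing by a - q derivatives costs t^(-(a-q)/2), even in presence of the exponential weight.
With a = 5/4 the critical power t^(-3/8) corresponds to q = 1/2; any larger `q` leaves a positive
power of t to spare. -/
lemma multNorm_heat_le {t a q : ℝ} (ht : 0 < t) (hq : 0 ≤ q) (hqa : q ≤ a) (haq : a - q ≤ 2)
    (f : L2) :
    multNorm (fun ξ => (expWeight √t ξ : ℂ) * symA a ξ * symHeat t ξ) f ≤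
      ENNReal.ofReal (4 * t ^ (-((a - q) / 2))) * normA q f := by
  refine multNorm_le_mul f fun ξ => ?_
  have h1 := rpow_mul_exp_mul_heat_le ht (l := 2 * Real.pi * ‖ξ‖) (by positivity)
    (sub_nonneg.2 hqa) haq
  have h2 : (2 * Real.pi * ‖ξ‖) ^ a = (2 * Real.pi * ‖ξ‖) ^ (a - q) * (2 * Real.pi * ‖ξ‖) ^ q := by
    rw [← Real.rpow_add_of_nonneg (by positivity) (by linarith) hq, sub_add_cancel]
  rw [norm_mul, norm_mul, norm_expWeight, norm_symHeat, norm_symA, norm_symA, expWeight, h2]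
  calc _ = ((2 * Real.pi * ‖ξ‖) ^ (a - q) * (Real.exp (√t * (2 * Real.pi * ‖ξ‖)) *
        Real.exp (-(t * (2 * Real.pi * ‖ξ‖) ^ 2)))) * (2 * Real.pi * ‖ξ‖) ^ q := by ring
    _ ≤ _ := by gcongr

/-- Subcritical data have small heat evolution on an interval depending only on their norm. -/
lemma exists_heatSmall_of_subcritical {r b ε : ℝ} (hr : 1 / 2 < r) (hb : 0 ≤ b) (hε : 0 < ε) :
    ∃ τ, 0 < τ ∧ ∀ f : L2, normH r f ≤ ENNReal.ofReal b → HeatSmall ε τ f := by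
  set q := min r (5 / 4) with hq
  have hq2 : 1 / 2 < q := lt_min hr (by norm_num)
  have hq5 : q ≤ 5 / 4 := min_le_right _ _
  set p := (q - 1 / 2) / 2 with hp
  have hp0 : 0 < p := by linarith
  -- Chosen so that 4 b t^p ≤ ε, where p > 0 is the gain over the critical exponent; `b + 1` avoids
  -- division by zero.
  refine ⟨(ε / (4 * (b + 1))) ^ p⁻¹, by positivity, fun f hf t ht => ?_⟩
  have ht0 : 0 < t := ht.1
  have h1 := multNorm_heat_le (a := 5 / 4) (q := q) ht0 (by linarith) hq5 (by linarith) f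
  have h2 : normA q f ≤ ENNReal.ofReal b :=
    (multNorm_mono f fun ξ => (norm_symA_le_symBessel (by linarith) ξ).trans
      (norm_symBessel_mono (min_le_left _ _) ξ)).trans hf
  refine h1.trans ((mul_le_mul_right h2 _).trans ?_)
  rw [← ENNReal.ofReal_mul (by positivity)]
  apply ENNReal.ofReal_le_ofReal
  have h3 : t ^ p ≤ ε / (4 * (b + 1)) := by
    have := Real.rpow_le_rpow ht0.le ht.2 hp0.le
    rwa [← Real.rpow_mul (by positivity), inv_mul_cancel₀ hp0.ne', Real.rpow_one] at this
  rw [le_div_iff₀ (by positivity)] at h3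
  have h4 : t ^ (-((5 / 4 - q) / 2)) = t ^ p * t ^ (-(3 / 8) : ℝ) := by
    rw [← Real.rpow_add ht0]; congr 1; rw [hp]; ring
  rw [h4]
  have h5 : 0 < t ^ (-(3 / 8) : ℝ) := by positivity
  have h6 : 0 < t ^ p := by positivity
  have h7 : 4 * t ^ p * b ≤ ε := by nlinarith
  nlinarith

lemma tendsto_rpow_mul_exp_heat (l : ℝ) :
    Tendsto (fun t : ℝ => t ^ (3 / 8 : ℝ) * (Real.exp (√t * l) * l ^ (5 / 4 : ℝ) *
      Real.exp (-(t * l ^ 2)))) (𝓝[>] 0) (𝓝 0) := by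
  have hc : Continuous (fun t : ℝ => t ^ (3 / 8 : ℝ) * (Real.exp (√t * l) * l ^ (5 / 4 : ℝ) *
      Real.exp (-(t * l ^ 2)))) :=
    (Real.continuous_rpow_const (by norm_num)).mul (by fun_prop)
  have := hc.tendsto 0
  rw [Real.zero_rpow (by norm_num), zero_mul] at this
  exact this.mono_left nhdsWithin_le_nhds

/-- Critical data have small heat evolution on some interval. -/
lemma exists_heatSmall_of_critical {f : L2} (hf : normH (1 / 2) f < ⊤) {ε : ℝ} (hε : 0 < ε) :
    ∃ τ, 0 < τ ∧ HeatSmall ε τ f := by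
  set w : ℝ → R3 → ℂ := fun t ξ => ((t ^ (3 / 8 : ℝ) : ℝ) : ℂ) *
    ((expWeight √t ξ : ℂ) * symA (5 / 4) ξ * symHeat t ξ) with hw
  have hA : normA (1 / 2) f < ⊤ :=
    (multNorm_mono f fun ξ => norm_symA_le_symBessel (by norm_num) ξ).trans_lt hf
  have hwle : ∀ t, 0 < t → ∀ ξ, ‖w t ξ‖ ≤ 4 * ‖symA (1 / 2) ξ‖ := by
    intro t ht ξ
    have h1 := rpow_mul_exp_mul_heat_le (a := 3 / 4) ht (l := 2 * Real.pi * ‖ξ‖) (by positivity)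
      (by norm_num) (by norm_num)
    have h2 : (2 * Real.pi * ‖ξ‖) ^ (5 / 4 : ℝ) =
        (2 * Real.pi * ‖ξ‖) ^ (3 / 4 : ℝ) * (2 * Real.pi * ‖ξ‖) ^ (1 / 2 : ℝ) := by
      rw [← Real.rpow_add_of_nonneg (by positivity) (by norm_num) (by norm_num)]; norm_num
    rw [hw]
    simp only
    rw [norm_mul, norm_mul, norm_mul, norm_expWeight, norm_symHeat, norm_symA, norm_symA, expWeight,
      h2, Complex.norm_real, Real.norm_of_nonneg (by positivity)]
    have h3 : t ^ (-(3 / 4 / 2) : ℝ) = (t ^ (3 / 8 : ℝ))⁻¹ := by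
      rw [← Real.rpow_neg ht.le]; norm_num
    rw [h3, ← div_eq_mul_inv, le_div_iff₀ (by positivity)] at h1
    calc _ = ((2 * Real.pi * ‖ξ‖) ^ (3 / 4 : ℝ) * (Real.exp (√t * (2 * Real.pi * ‖ξ‖)) *
        Real.exp (-(t * (2 * Real.pi * ‖ξ‖) ^ 2))) * t ^ (3 / 8 : ℝ)) *
          (2 * Real.pi * ‖ξ‖) ^ (1 / 2 : ℝ) := by ring
      _ ≤ _ := by gcongr
  have hmeas : ∀ t, Measurable (w t) := fun t => measurable_const.mul
    (((Complex.measurable_ofReal.comp (measurable_expWeight _)).mul (measurable_symA _)).mul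
      (isSymbol_symHeat t).meas)
  -- Dominated convergence with majorant 4 |A^(1/2) f| on the Fourier side. There is no rate, so
  -- here the interval depends on `f` itself and not only on its norm.
  have hlim : Tendsto (fun t => multNorm (w t) f ^ 2) (𝓝[>] 0) (𝓝 0) := by
    simp_rw [multNorm_sq]
    have h0 : (0 : ℝ≥0∞) = ∫⁻ _ : R3, 0 := by simp
    rw [h0]
    refine tendsto_lintegral_filter_of_dominated_convergence
      (fun ξ => ‖((4 : ℂ) * symA (1 / 2) ξ) • hat f ξ‖ₑ ^ 2) ?_ ?_ ?_ ?_
    · exact Eventually.of_forall fun t =>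
        (((hmeas t).smul (measurable_hat f)).enorm.pow_const 2)
    · filter_upwards [self_mem_nhdsWithin] with t ht
      refine Eventually.of_forall fun ξ => ?_
      gcongr
      rw [enorm_smul, enorm_smul]
      gcongr
      rw [enorm_le_iff_norm_le, norm_mul (4 : ℂ), Complex.norm_ofNat]
      exact hwle t ht ξ
    · rw [← multNorm_sq]
      refine (ENNReal.pow_lt_top ?_).ne
      refine (multNorm_le_mul (c := 4) (w' := symA (1 / 2)) f fun ξ => ?_).trans_lt
        (ENNReal.mul_lt_top ENNReal.ofReal_lt_top hA)
      rw [norm_mul]; simp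
    · refine Eventually.of_forall fun ξ => ?_
      have h1 := tendsto_rpow_mul_exp_heat (2 * Real.pi * ‖ξ‖)
      have h2 : Tendsto (fun t => w t ξ • hat f ξ) (𝓝[>] 0) (𝓝 0) := by
        have h3 := ((Complex.continuous_ofReal.tendsto 0).comp h1).smul_const (hat f ξ)
        rw [Complex.ofReal_zero, zero_smul] at h3
        refine h3.congr fun t => ?_
        rw [hw]
        simp only [Function.comp_apply]
        rw [symA, symHeat, expWeight]
        push_cast; rfl
      have h4 := ((ENNReal.continuous_pow 2).tendsto _).comp h2.enorm
      simpa [Function.comp_def] using h4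
  have hev := hlim.eventually (gt_mem_nhds (show (0 : ℝ≥0∞) < ENNReal.ofReal ε ^ 2 by
    have := ENNReal.ofReal_pos.2 hε; positivity))
  obtain ⟨τ, hτ, h2⟩ := (mem_nhdsGT_iff_exists_Ioc_subset).1 hev
  refine ⟨τ, hτ, fun t ht => ?_⟩
  have h3 : multNorm (w t) f ≤ ENNReal.ofReal ε := by
    have := (h2 ht)
    simp only [mem_ofPred_eq] at this
    exact (lt_of_pow_lt_pow_left' 2 this).le
  have ht0 : 0 < t := ht.1
  refine (multNorm_le_mul (c := t ^ (-(3 / 8) : ℝ)) (w' := w t) f fun ξ => le_of_eq ?_).trans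
    ((mul_le_mul_right h3 _).trans (le_of_eq ?_))
  · rw [hw]
    simp only
    rw [norm_mul ((t ^ (3 / 8 : ℝ) : ℝ) : ℂ), Complex.norm_real,
      Real.norm_of_nonneg (by positivity), ← mul_assoc, ← Real.rpow_add ht0]
    simp
  · rw [← ENNReal.ofReal_mul (by positivity), mul_comm]

/-- The order of quantifiers records the dependence of the constants: ε precedes everything about
the solution, δ sees only τ and the bound `a` on |u|, and C sees in addition T and the bound `c` in
H^(1/2). Finer information on u(0) enters only through τ. -/
theorem exists_analyticityBounds (M : Matrix (Fin 3) (Fin 3) ℝ) {P : L2 →L[ℝ] L2}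
    (hP : IsFiberedProjection P) {r : ℝ} (hr : 0 ≤ r) : ∃ ε, 0 < ε ∧ ∀ τ a : ℝ, 0 < τ → 0 ≤ a →
      ∃ δ, 0 < δ ∧ ∀ T c : ℝ, 0 ≤ c → ∃ C, 0 < C ∧ ∀ u : ℝ → L2, 0 < T →
        IsStrongSolution M P r T u → (critNorm T u).toReal ≤ a →
        (∀ t ∈ Icc 0 T, normH (1 / 2) (u t) ≤ ENNReal.ofReal c) → HeatSmall ε τ (u 0) →
        AnalyticityBounds T δ C u := by
  obtain ⟨K, hK0, hK⟩ := multNorm_force_le M hP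
  obtain ⟨k, hk0, hk⟩ := exists_kernelBound (a := 5 / 4) (by norm_num) (by norm_num)
  obtain ⟨k₀, hk₀0, hk₀⟩ := exists_kernelBound (a := 0) (by norm_num) (by norm_num)
  obtain ⟨k₁, hk₁0, hk₁⟩ := exists_kernelBound (a := 1 / 2) (by norm_num) (by norm_num)
  set ε : ℝ := 1 / (64 * K * k) with hε
  have hε0 : 0 < ε := by positivity
  have hε1 : 64 * K * k * ε ≤ 1 := by rw [hε]; field_simp; rfl
  refine ⟨ε, hε0, fun τ a hτ ha => ?_⟩
  -- The first condition keeps the restart time t - δ² above τ/2. The second makes the bound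
  -- a(τ/2)^(-3/8) on ‖A^(5/4) u‖ there small at the critical scale of an interval of length δ².
  obtain ⟨δ, hδ0, hδτ, hδε⟩ : ∃ δ : ℝ, 0 < δ ∧ δ ^ 2 ≤ τ / 2 ∧
      4 * (a * (τ / 2) ^ (-(3 / 8) : ℝ)) * (δ ^ 2) ^ (3 / 8 : ℝ) ≤ ε := by
    have h1 : Tendsto (fun δ : ℝ => 4 * (a * (τ / 2) ^ (-(3 / 8) : ℝ)) * (δ ^ 2) ^ (3 / 8 : ℝ))
        (𝓝[>] 0) (𝓝 0) := by
      have hc : Continuous (fun δ : ℝ => 4 * (a * (τ / 2) ^ (-(3 / 8) : ℝ)) * (δ ^ 2) ^ (3 / 8 : ℝ)) :=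
        continuous_const.mul ((continuous_pow 2).rpow_const fun _ => Or.inr (by norm_num))
      have := hc.tendsto 0
      simp only [ne_eq, OfNat.ofNat_ne_zero, not_false_eq_true, zero_pow] at this
      rw [Real.zero_rpow (by norm_num), mul_zero] at this
      exact this.mono_left nhdsWithin_le_nhds
    have h2 : Tendsto (fun δ : ℝ => δ ^ 2) (𝓝[>] 0) (𝓝 0) := by
      have := (continuous_pow 2 (M := ℝ)).tendsto 0
      simp only [ne_eq, OfNat.ofNat_ne_zero, not_false_eq_true, zero_pow] at this
      exact this.mono_left nhdsWithin_le_nhds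
    obtain ⟨δ, ⟨h3, h4⟩, h5⟩ := (((h1.eventually (ge_mem_nhds hε0)).and
      (h2.eventually (ge_mem_nhds (half_pos hτ)))).and self_mem_nhdsWithin).exists
    exact ⟨δ, h5, h4, h3⟩
  refine ⟨δ, hδ0, fun T c hc => ⟨8 * c + 16 * K * ε ^ 2 * (k₀ * |T| ^ (1 / 4 : ℝ) + k₁),
    by positivity, fun u hT hu hcrit hH hsmall => ?_⟩⟩
  rw [abs_of_pos hT]
  have hm := hu.isMild hP hr
  have hfb : ForceBound K T u (fun t => force M P (u t)) := fun W hW he t ht =>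
    hK W hW he (u t) (hu.normA_lt_top ht)
  have hbd : ∀ t₀ t, 0 ≤ t₀ → t₀ < t → t ≤ T →
      (∀ s ∈ Ioc t₀ t, multNorm (fun ξ => (expWeight √(s - t₀) ξ : ℂ) * symA (5 / 4) ξ *
        symHeat (s - t₀) ξ) (u t₀) ≤ ENNReal.ofReal (ε * (s - t₀) ^ (-(3 / 8) : ℝ))) →
      (∀ s ∈ Ioc t₀ t, normA (5 / 4) (u s) ≤
        ENNReal.ofReal (2 * ε * (s - t₀) ^ (-(3 / 8) : ℝ))) →
      normExpH √(t - t₀) (1 / 2) (u t) ≤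
        ENNReal.ofReal (8 * c + 16 * K * ε ^ 2 * (k₀ * T ^ (1 / 4 : ℝ) + k₁)) := by
    intro t₀ t h1 h2 h3 h4 h5
    refine (hm.normExpH_le hK0.le hfb hk hk0.le hk₀ hk₀0.le hk₁ hk₁0.le hε0.le hε1 h1 h2 h3 h4
      h5).trans ?_
    rw [ENNReal.ofReal_add (by positivity) (by positivity), ENNReal.ofReal_mul (p := 8) (by norm_num)]
    refine add_le_add ?_ (ENNReal.ofReal_le_ofReal ?_)
    · norm_num
      exact mul_le_mul_right (hH t₀ ⟨h1, (h2.trans_le h3).le⟩) _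
    · have : (t - t₀) ^ (1 / 4 : ℝ) ≤ T ^ (1 / 4 : ℝ) :=
        Real.rpow_le_rpow (by linarith) (by linarith) (by norm_num)
      gcongr
  have hcritle : ∀ t₀ s, τ / 2 ≤ t₀ → t₀ ≤ s → s ∈ Ioc 0 T → normA (5 / 4) (u s) ≤
      ENNReal.ofReal (a * (τ / 2) ^ (-(3 / 8) : ℝ)) := by
    intro t₀ s h1 h2 hs
    refine (hu.normA_le hs).trans (ENNReal.ofReal_le_ofReal ?_)
    have : s ^ (-(3 / 8) : ℝ) ≤ (τ / 2) ^ (-(3 / 8) : ℝ) :=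
      Real.rpow_le_rpow_of_nonpos (by positivity) (h1.trans h2) (by norm_num)
    exact mul_le_mul hcrit this (Real.rpow_nonneg hs.1.le _) ha
  have main : ∀ t ∈ Ioc 0 T, normExpH (min √t δ) (1 / 2) (u t) ≤
      ENNReal.ofReal (8 * c + 16 * K * ε ^ 2 * (k₀ * T ^ (1 / 4 : ℝ) + k₁)) := by
    intro t ht
    have hmono : ∀ {θ θ' : ℝ}, θ ≤ θ' → normExpH θ (1 / 2) (u t) ≤ normExpH θ' (1 / 2) (u t) := by
      intro θ θ' h
      refine multNorm_mono _ fun ξ => ?_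
      rw [norm_mul, norm_mul, symExp, symExp, Complex.norm_real, Complex.norm_real,
        Real.norm_of_nonneg (Real.exp_pos _).le, Real.norm_of_nonneg (Real.exp_pos _).le]
      gcongr
    rcases le_or_gt t τ with h | h
    · refine (hmono (min_le_left _ _)).trans ?_
      have H1 : ∀ s ∈ Ioc 0 t, multNorm (fun ξ => (expWeight √s ξ : ℂ) * symA (5 / 4) ξ *
          symHeat s ξ) (u 0) ≤ ENNReal.ofReal (ε * s ^ (-(3 / 8) : ℝ)) :=
        fun s hs => hsmall s ⟨hs.1, hs.2.trans h⟩
      have H2 := hm.small_of_heat hK0.le hfb hk hk0.le hε0 hε1 hu.continuous_crit hu.vanish_crit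
        ht.2 H1
      simpa only [sub_zero] using hbd 0 t le_rfl ht.1 ht.2 (by simpa only [sub_zero] using H1)
        (by simpa only [sub_zero] using H2)
    -- After time τ the argument is restarted at t - δ², and √(t - (t - δ²)) = δ is the radius
    -- obtained.
    · refine (hmono (min_le_right _ _)).trans ?_
      have e : √(t - (t - δ ^ 2)) = δ := by rw [sub_sub_cancel, Real.sqrt_sq hδ0.le]
      have ht0 : τ / 2 ≤ t - δ ^ 2 := by linarith
      have hlt : t - δ ^ 2 < t := by have := pow_pos hδ0 2; linarith
      have hsδ : ∀ s ∈ Ioc (t - δ ^ 2) t,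
          4 * (a * (τ / 2) ^ (-(3 / 8) : ℝ)) ≤ ε * (s - (t - δ ^ 2)) ^ (-(3 / 8) : ℝ) := by
        intro s hs
        have h1 : 0 < s - (t - δ ^ 2) := sub_pos.2 hs.1
        rw [Real.rpow_neg h1.le, ← div_eq_mul_inv, le_div_iff₀ (by positivity)]
        refine le_trans ?_ hδε
        have : (s - (t - δ ^ 2)) ^ (3 / 8 : ℝ) ≤ (δ ^ 2) ^ (3 / 8 : ℝ) :=
          Real.rpow_le_rpow h1.le (by linarith [hs.2]) (by norm_num)
        gcongr
      have := hbd (t - δ ^ 2) t (by linarith) hlt ht.2 (fun s hs => ?_) (fun s hs => ?_)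
      · rwa [e] at this
      · have h1 : 0 < s - (t - δ ^ 2) := sub_pos.2 hs.1
        refine (multNorm_heat_le (q := 5 / 4) h1 (by norm_num) le_rfl (by norm_num) _).trans ?_
        rw [sub_self, zero_div, neg_zero, Real.rpow_zero, mul_one]
        refine (mul_le_mul_right (hcritle _ _ ht0 le_rfl ⟨by linarith, hlt.le.trans ht.2⟩) _).trans ?_
        rw [← ENNReal.ofReal_mul (by norm_num)]
        exact ENNReal.ofReal_le_ofReal (hsδ s hs)
      · refine (hcritle _ s ht0 hs.1.le ⟨by linarith [hs.1], hs.2.trans ht.2⟩).trans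
          (ENNReal.ofReal_le_ofReal ?_)
        have h1 : 0 < s - (t - δ ^ 2) := sub_pos.2 hs.1
        have h2 := hsδ s hs
        have h3 : 0 ≤ a * (τ / 2) ^ (-(3 / 8) : ℝ) := by positivity
        have h4 : 0 ≤ ε * (s - (t - δ ^ 2)) ^ (-(3 / 8) : ℝ) := by positivity
        nlinarith
  exact ⟨main, fun s hs t ht =>
    normA_le_of_normExpH (lt_min (Real.sqrt_pos.2 ht.1) hδ0) hs (main t ht)⟩

/-! ### Regularity in time -/

/-- Rewrites an unbounded operator through its bounded inverse, so that it can be exchanged with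
time integrals. -/
lemma isMultiplier_symBessel_iff {s : ℝ} (hs : 0 ≤ s) {f g : L2} :
    IsMultiplier (symBessel s) f g ↔ D (symBessel (-s)) g = f := by
  have hb : IsBddSymbol (symBessel (-s)) := isBddSymbol_symBessel (by linarith)
  constructor
  · intro h
    exact isMultiplier_symBessel_zero.1 ((h.comp (isMultiplier_D hb g)).congr fun ξ => by
      rw [symBessel_mul, neg_add_cancel])
  · intro h
    filter_upwards [h ▸ isMultiplier_D hb g] with ξ h1
    rw [h1, smul_smul, symBessel_mul, add_neg_cancel, symBessel_zero, one_smul]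

lemma isMultiplier_intervalIntegral {s : ℝ} (hs : 0 ≤ s) {u v : ℝ → L2} {a b : ℝ} (hab : a ≤ b)
    (hu : IntervalIntegrable v volume a b)
    (h : ∀ t ∈ Icc a b, IsMultiplier (symBessel s) (u t) (v t)) :
    IsMultiplier (symBessel s) (∫ t in a..b, u t) (∫ t in a..b, v t) := by
  rw [isMultiplier_symBessel_iff hs, ← ContinuousLinearMap.intervalIntegral_comp_comm _ hu]
  refine intervalIntegral.integral_congr fun t ht => ?_
  rw [uIcc_of_le hab] at ht
  exact (isMultiplier_symBessel_iff hs).1 (h t ht)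

/-- `u` is smooth in space, with all Sobolev norms continuous on `]0, T]`. -/
def ContSmooth (T : ℝ) (u : ℝ → L2) : Prop := ∀ s : ℝ, 0 ≤ s →
  (∀ t ∈ Ioc 0 T, IsMultiplier (symBessel s) (u t) (op (symBessel s) (u t))) ∧
  ContinuousOn (fun t => op (symBessel s) (u t)) (Ioc 0 T)

lemma norm_symBessel_le_two_rpow {s : ℝ} (hs : 0 ≤ s) (ξ : R3) :
    ‖symBessel s ξ‖ ≤ 2 ^ (s / 2) * (1 + ‖symA s ξ‖) := by
  rw [norm_symBessel, norm_symA]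
  have hx : 0 ≤ 2 * Real.pi * ‖ξ‖ := by positivity
  set x := 2 * Real.pi * ‖ξ‖
  have h2 : 0 ≤ (2 : ℝ) ^ (s / 2) := by positivity
  have h3 : 0 ≤ x ^ s := by positivity
  rcases le_total x 1 with h | h
  · have h1 := Real.rpow_le_rpow (z := s / 2) (by positivity) (show 1 + x ^ 2 ≤ 2 by nlinarith)
      (by linarith)
    nlinarith
  · have h1 := Real.rpow_le_rpow (z := s / 2) (by positivity) (show 1 + x ^ 2 ≤ 2 * x ^ 2 by nlinarith)
      (by linarith)
    rw [Real.mul_rpow zero_le_two (by positivity), ← Real.rpow_natCast_mul hx, Nat.cast_ofNat,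
      mul_div_cancel₀ _ two_ne_zero] at h1
    nlinarith

/-- Interpolation between `L²` and `H^(s+1)`. -/
lemma norm_symBessel_le_interp {s η : ℝ} (hs : 0 ≤ s) (hη : 0 < η) (ξ : R3) :
    ‖symBessel s ξ‖ ≤ η * ‖symBessel (s + 1) ξ‖ + η ^ (-s) := by
  rw [norm_symBessel, norm_symBessel]
  set y := 1 + (2 * Real.pi * ‖ξ‖) ^ 2 with hy
  have hy0 : 0 < y := by positivity
  have e1 : y ^ ((s + 1) / 2) = y ^ (s / 2) * y ^ (1 / 2 : ℝ) := by
    rw [← Real.rpow_add hy0]; congr 1; ring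
  have h0 : 0 < y ^ (s / 2) := by positivity
  have h1 : 0 < η ^ (-s) := by positivity
  rcases le_total 1 (η * y ^ (1 / 2 : ℝ)) with h | h
  · rw [e1]; nlinarith
  · have h2 : y ^ (1 / 2 : ℝ) ≤ η⁻¹ := by rwa [← one_div, le_div_iff₀' hη]
    have h3 := Real.rpow_le_rpow (z := s) (by positivity) h2 hs
    rw [← Real.rpow_mul hy0.le, Real.inv_rpow hη.le, ← Real.rpow_neg hη.le] at h3
    have h4 : (1 / 2 : ℝ) * s = s / 2 := by ring
    rw [h4] at h3
    have h5 : 0 ≤ η * y ^ ((s + 1) / 2) := by positivity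
    linarith

lemma norm_sub_le_interp {s η : ℝ} (hs : 0 ≤ s) (hη : 0 < η) {f f' g g' k k' : L2}
    (hg : IsMultiplier (symBessel s) f g) (hg' : IsMultiplier (symBessel s) f' g')
    (hk : IsMultiplier (symBessel (s + 1)) f k) (hk' : IsMultiplier (symBessel (s + 1)) f' k') :
    ‖g - g'‖ ≤ η * ‖k - k'‖ + η ^ (-s) * ‖f - f'‖ := by
  have h1 := isMultiplier_sub hg hg'
  have h2 := isMultiplier_sub hk hk'
  have h3 := multNorm_le_add (w := symBessel s) (w₁ := fun ξ => (η : ℂ) * symBessel (s + 1) ξ)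
    (w₂ := fun _ => ((η ^ (-s) : ℝ) : ℂ)) (f - f') (measurable_const.mul (measurable_symBessel _))
    measurable_const (fun ξ => by
      rw [norm_mul, Complex.norm_real, Complex.norm_real, Real.norm_of_nonneg hη.le,
        Real.norm_of_nonneg (by positivity)]
      exact norm_symBessel_le_interp hs hη ξ)
  have h4 := multNorm_le_mul (c := η) (w := fun ξ => (η : ℂ) * symBessel (s + 1) ξ)
    (w' := symBessel (s + 1)) (f - f') (fun ξ => by
      rw [norm_mul, Complex.norm_real, Real.norm_of_nonneg hη.le])
  have h5 := multNorm_le_of_bdd (c := η ^ (-s)) (w := fun _ => ((η ^ (-s) : ℝ) : ℂ)) (f - f')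
    (fun ξ => by rw [Complex.norm_real, Real.norm_of_nonneg (by positivity)])
  rw [← h1.enorm_eq] at h3
  rw [← h2.enorm_eq] at h4
  have h6 := h3.trans (add_le_add h4 h5)
  rwa [← ofReal_norm, ← ofReal_norm, ← ofReal_norm, ← ENNReal.ofReal_mul hη.le,
    ← ENNReal.ofReal_mul (by positivity), ← ENNReal.ofReal_add (by positivity) (by positivity),
    ENNReal.ofReal_le_ofReal_iff (by positivity)] at h6

/-- Locally in ]0,T] the solution is bounded in H^(s+1) and continuous in L²; interpolation gives
continuity in H^s. -/
lemma AnalyticityBounds.contSmooth {T δ C : ℝ} {u : ℝ → L2} (h : AnalyticityBounds T δ C u)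
    (hδ : 0 < δ) (hu : ContinuousOn u (Icc 0 T)) : ContSmooth T u := by
  have hbdd : ∀ s : ℝ, 0 ≤ s → ∀ η : ℝ, 0 < η → ∃ B : ℝ, 0 ≤ B ∧ ∀ t ∈ Icc η T,
      multNorm (symBessel s) (u t) ≤ ENNReal.ofReal B := by
    intro s hs η hη
    obtain ⟨B, hB⟩ := isCompact_Icc.exists_bound_of_continuousOn hu
    set q := max s (1 / 2) with hq
    have hq2 : 1 / 2 ≤ q := le_max_right _ _
    set S := C * sSup ((fun x : ℝ => x ^ (q - 1 / 2) * Real.exp (-x)) '' Ici 0) with hS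
    set θ := min √η δ with hθ
    have hθ0 : 0 < θ := lt_min (Real.sqrt_pos.2 hη) hδ
    refine ⟨2 ^ (q / 2) * (|B| + |S| * θ ^ (-(q - 1 / 2))), by positivity, fun t ht => ?_⟩
    have ht0 : 0 < t := hη.trans_le ht.1
    have h1 : multNorm (symBessel s) (u t) ≤ ENNReal.ofReal (2 ^ (q / 2)) *
        (multNorm (fun _ => 1) (u t) + normA q (u t)) := by
      have h2 := multNorm_le_add (w := fun ξ => ((1 + ‖symA q ξ‖ : ℝ) : ℂ)) (w₁ := fun _ => 1)
        (w₂ := symA q) (u t) measurable_const (measurable_symA q) (fun ξ => by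
          rw [Complex.norm_real, Real.norm_of_nonneg (by positivity), norm_one])
      refine le_trans ?_ (mul_le_mul_right h2 _)
      refine multNorm_le_mul _ fun ξ => ?_
      rw [Complex.norm_real, Real.norm_of_nonneg (by positivity)]
      exact (norm_symBessel_mono (le_max_left _ _) ξ).trans (norm_symBessel_le_two_rpow (by linarith) ξ)
    refine h1.trans ?_
    rw [ENNReal.ofReal_mul (by positivity), ENNReal.ofReal_add (by positivity) (by positivity)]
    refine mul_le_mul_right (add_le_add ?_ ?_) _
    · rw [multNorm_one, ← ofReal_norm]
      exact ENNReal.ofReal_le_ofReal ((hB t ⟨ht0.le, ht.2⟩).trans (le_abs_self B))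
    · refine (h.2 q hq2 t ⟨ht0, ht.2⟩).trans (ENNReal.ofReal_le_ofReal ?_)
      have h3 : θ ≤ min √t δ := min_le_min (Real.sqrt_le_sqrt ht.1) le_rfl
      have h4 := Real.rpow_le_rpow_of_nonpos hθ0 h3 (show -(q - 1 / 2) ≤ 0 by linarith)
      exact mul_le_mul (le_abs_self S) h4 (Real.rpow_nonneg (hθ0.le.trans h3) _) (abs_nonneg S)
  have hmul : ∀ s : ℝ, 0 ≤ s → ∀ t ∈ Ioc 0 T,
      IsMultiplier (symBessel s) (u t) (op (symBessel s) (u t)) := by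
    intro s hs t ht
    obtain ⟨B, hB0, hB⟩ := hbdd s hs t ht.1
    exact isMultiplier_op (isSymbol_symBessel s)
      ((hB t ⟨le_rfl, ht.2⟩).trans_lt ENNReal.ofReal_lt_top)
  refine fun s hs => ⟨hmul s hs, fun t ht => ?_⟩
  have ht2 : 0 < t / 2 := half_pos ht.1
  obtain ⟨B, hB0, hB⟩ := hbdd (s + 1) (by linarith) (t / 2) ht2
  have hnB : ∀ t' ∈ Icc (t / 2) T, ‖op (symBessel (s + 1)) (u t')‖ ≤ B := fun t' ht' => by
    have := hB t' ht'
    rwa [← (hmul (s + 1) (by linarith) t' ⟨ht2.trans_le ht'.1, ht'.2⟩).enorm_eq, ← ofReal_norm,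
      ENNReal.ofReal_le_ofReal_iff hB0] at this
  rw [ContinuousWithinAt, tendsto_iff_norm_sub_tendsto_zero, Metric.tendsto_nhds]
  intro e he
  -- Makes the H^(s+1) part of the interpolation inequality at most η · 2B ≤ e/2; the L² part tends
  -- to 0.
  set η : ℝ := e / (4 * (B + 1)) with hη
  have hη0 : 0 < η := by positivity
  have hc : Tendsto (fun t' => η ^ (-s) * ‖u t' - u t‖) (𝓝[Ioc 0 T] t) (𝓝 0) := by
    have h1 := (hu.mono Ioc_subset_Icc_self) t ht
    rw [ContinuousWithinAt, tendsto_iff_norm_sub_tendsto_zero] at h1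
    simpa using h1.const_mul (η ^ (-s))
  filter_upwards [hc.eventually (gt_mem_nhds (half_pos he)), self_mem_nhdsWithin,
    nhdsWithin_le_nhds (lt_mem_nhds (half_lt_self ht.1))] with t' h1 h2 h3
  have h4 := norm_sub_le_interp hs hη0 (hmul s hs t' h2) (hmul s hs t ht)
    (hmul (s + 1) (by linarith) t' h2) (hmul (s + 1) (by linarith) t ht)
  have h5 := (norm_sub_le _ _).trans (add_le_add (hnB t' ⟨h3.le, h2.2⟩)
    (hnB t ⟨(half_lt_self ht.1).le, ht.2⟩))
  have h6 : η * (B + B) ≤ e / 2 := by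
    rw [hη, div_mul_eq_mul_div, div_le_iff₀ (by positivity)]; nlinarith
  rw [dist_zero_right, norm_norm]
  nlinarith

/-- The symbol of `-Δ (1 - Δ)⁻¹`. -/
def symRes (ξ : R3) : ℂ := symLap ξ * symBessel (-2) ξ

lemma isBddSymbol_symRes : IsBddSymbol symRes := by
  refine ⟨isSymbol_symLap.mul (isSymbol_symBessel _), 1, fun ξ => ?_⟩
  have h : ‖symLap ξ‖ ≤ ‖symBessel 2 ξ‖ := by
    refine le_trans (le_of_eq ?_) (norm_symA_le_symBessel zero_le_two ξ)
    rw [symLap, symA, Real.rpow_two]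
  rw [symRes, norm_mul]
  refine (mul_le_mul_of_nonneg_right h (norm_nonneg _)).trans (le_of_eq ?_)
  rw [← norm_mul, symBessel_mul, add_neg_cancel, symBessel_zero, norm_one]

lemma isMultiplier_neg_left {w : R3 → ℂ} {f g : L2} (h : IsMultiplier w f g) :
    IsMultiplier (fun ξ => -w ξ) f (-g) := by
  rw [IsMultiplier, hat_neg]
  filter_upwards [h, Lp.coeFn_neg (hat g)] with ξ h1 h2
  rw [h2, Pi.neg_apply, h1, neg_smul]

section Smooth

variable {M : Matrix (Fin 3) (Fin 3) ℝ} {P : L2 →L[ℝ] L2} {T : ℝ} {u : ℝ → L2}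

/-- The evolution equation in every Sobolev space. -/
theorem ContSmooth.exists_hasDerivWithinAt (hs : ContSmooth T u)
    (hm : IsMild T u (fun t => force M P (u t))) (hP : IsFiberedProjection P) {s : ℝ}
    (hs0 : 0 ≤ s) : ∃ Q : L2 →L[ℝ] L2 →L[ℝ] L2,
      (∀ f F : L2, IsMultiplier (symBessel (s + 5 / 4)) f F →
        IsMultiplier (symBessel s) (force M P f) (P (Q F F))) ∧
      ∀ t ∈ Ioc 0 T, HasDerivWithinAt (fun t => op (symBessel s) (u t))
      (-(D symRes (op (symBessel (s + 2)) (u t)) +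
        P (Q (op (symBessel (s + 5 / 4)) (u t)) (op (symBessel (s + 5 / 4)) (u t))))) (Ioc 0 T) t := by
  obtain ⟨Q, hQ⟩ := exists_bilin_force M hP hs0
  refine ⟨Q, hQ, fun t ht => ?_⟩
  set v : ℝ → ℝ → L2 := fun s t => op (symBessel s) (u t) with hv
  set N : ℝ → L2 := fun t => P (Q (v (s + 5 / 4) t) (v (s + 5 / 4) t)) with hN
  have hvc := fun s hs0 => (hs s hs0).2
  have hNc : ContinuousOn N (Ioc 0 T) := P.continuous.comp_continuousOn
    ((Q.continuous.comp_continuousOn (hvc _ (by linarith))).clm_apply (hvc _ (by linarith)))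
  set g : ℝ → L2 := fun t => D symRes (v (s + 2) t) + N t with hg
  have hgc : ContinuousOn g (Ioc 0 T) :=
    ((D symRes).continuous.comp_continuousOn (hvc _ (by linarith))).add hNc
  have hint : ∀ t₁ t₂, 0 < t₁ → t₁ ≤ t₂ → t₂ ≤ T → ∀ f : ℝ → L2, ContinuousOn f (Ioc 0 T) →
      IntervalIntegrable f volume t₁ t₂ := by
    intro t₁ t₂ h1 h2 h3 f hf
    apply ContinuousOn.intervalIntegrable
    rw [uIcc_of_le h2]
    exact hf.mono fun x hx => ⟨h1.trans_le hx.1, hx.2.trans h3⟩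
  have heq : ∀ t₁ t₂, 0 < t₁ → t₁ ≤ t₂ → t₂ ≤ T → v s t₂ = v s t₁ - ∫ x in t₁..t₂, g x := by
    intro t₁ t₂ h1 h2 h3
    have hI : Icc t₁ t₂ ⊆ Ioc 0 T := fun x hx => ⟨h1.trans_le hx.1, hx.2.trans h3⟩
    have i1 := hint t₁ t₂ h1 h2 h3 _ (hvc (s + 2) (by linarith))
    have i2 := hint t₁ t₂ h1 h2 h3 _ hNc
    have e1 := hm.isMultiplier_integral h1.le h2 h3
    have e2 := isMultiplier_intervalIntegral (by linarith) h2 i1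
      (fun x hx => (hs (s + 2) (by linarith)).1 x (hI hx))
    have e3 := isMultiplier_intervalIntegral hs0 h2 i2
      (fun x hx => hQ _ _ ((hs (s + 5 / 4) (by linarith)).1 x (hI hx)))
    have e4 := isMultiplier_add (isMultiplier_sub ((hs s hs0).1 t₂ (hI ⟨h2, le_rfl⟩))
      ((hs s hs0).1 t₁ (hI ⟨le_rfl, h2⟩))) e3
    -- Both sides are the multiplier -A²⟨A⟩^s applied to the time integral of `u`, so uniqueness
    -- lifts the integrated equation from L² to H^s.
    have e5 := e1.comp e4
    have e6 := isMultiplier_neg_left (e2.comp (isMultiplier_D isBddSymbol_symRes _))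
    have e7 := e5.unique (e6.congr fun ξ => by
      rw [symRes, mul_assoc, symBessel_mul, show -2 + (s + 2) = s by ring, symLap]
      push_cast; ring)
    have i3 : IntervalIntegrable (fun x => D symRes (v (s + 2) x)) volume t₁ t₂ :=
      hint t₁ t₂ h1 h2 h3 _ ((D symRes).continuous.comp_continuousOn (hvc (s + 2) (by linarith)))
    have e8 : ∫ x in t₁..t₂, g x =
        D symRes (∫ x in t₁..t₂, v (s + 2) x) + ∫ x in t₁..t₂, N x := by
      rw [hg, intervalIntegral.integral_add i3 i2,
        ContinuousLinearMap.intervalIntegral_comp_comm _ i1]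
    rw [e8]
    rw [← sub_eq_zero]
    calc _ = (v s t₂ - v s t₁ + ∫ x in t₁..t₂, N x) - -(D symRes) (∫ x in t₁..t₂, v (s + 2) x) := by
          abel
      _ = 0 := sub_eq_zero.2 e7
  -- Extending `g` by a constant beyond T makes it continuous around the end point, so the two-sided
  -- fundamental theorem also covers t = T.
  set g' : ℝ → L2 := fun x => g (min x T) with hg'
  have hg'c : ContinuousOn g' (Ioi 0) := by
    refine hgc.comp (by fun_prop) fun x hx => ⟨lt_min hx (ht.1.trans_le ht.2), min_le_right _ _⟩
  have ht2 : 0 < t / 2 := half_pos ht.1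
  have hi' : IntervalIntegrable g' volume (t / 2) t := by
    apply ContinuousOn.intervalIntegrable
    rw [uIcc_of_le (half_le_self ht.1.le)]
    exact hg'c.mono fun x hx => ht2.trans_le hx.1
  have hd := (intervalIntegral.integral_hasDerivAt_right hi'
    (hg'c.stronglyMeasurableAtFilter isOpen_Ioi t ht.1)
    (hg'c.continuousAt (isOpen_Ioi.mem_nhds ht.1))).const_sub (v s (t / 2))
  rw [show g' t = g t from congrArg g (min_eq_left ht.2)] at hd
  have heq' : ∀ x ∈ Icc (t / 2) T, v s x = v s (t / 2) - ∫ y in (t / 2)..x, g' y := by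
    intro x hx
    rw [heq (t / 2) x ht2 hx.1 hx.2]
    congr 1
    refine intervalIntegral.integral_congr fun y hy => ?_
    rw [uIcc_of_le hx.1] at hy
    exact (congrArg g (min_eq_left (hy.2.trans hx.2))).symm
  refine hd.hasDerivWithinAt.congr_of_eventuallyEq ?_ (heq' t ⟨half_le_self ht.1.le, ht.2⟩)
  filter_upwards [self_mem_nhdsWithin, nhdsWithin_le_nhds (lt_mem_nhds (half_lt_self ht.1))]
    with x h1 h2
  exact heq' x ⟨h2.le, h1.2⟩

/-- One time derivative of ⟨A⟩^s u is a bounded linear plus a bounded quadratic expression in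
⟨A⟩^(s+2) u and ⟨A⟩^(s+5/4) u. The induction must therefore run over all `s` at once. -/
theorem ContSmooth.contDiffOn (hs : ContSmooth T u)
    (hm : IsMild T u (fun t => force M P (u t))) (hP : IsFiberedProjection P) (k : ℕ) :
    ∀ s : ℝ, 0 ≤ s → ContDiffOn ℝ k (fun t => op (symBessel s) (u t)) (Ioc 0 T) := by
  induction k with
  | zero => exact fun s hs0 => contDiffOn_zero.2 (hs s hs0).2
  | succ k ih =>
    intro s hs0
    obtain ⟨Q, -, hd⟩ := hs.exists_hasDerivWithinAt hm hP hs0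
    have hu : UniqueDiffOn ℝ (Ioc 0 T) := uniqueDiffOn_Ioc 0 T
    rw [Nat.cast_succ, contDiffOn_succ_iff_derivWithin hu]
    refine ⟨fun t ht => (hd t ht).differentiableWithinAt, by simp, ?_⟩
    refine ContDiffOn.congr ?_ fun t ht => (hd t ht).derivWithin (hu t ht)
    have h1 := ih (s + 5 / 4) (by linarith)
    exact (((D symRes).contDiff.comp_contDiffOn (ih (s + 2) (by linarith))).add
      (P.contDiff.comp_contDiffOn ((Q.contDiff.comp_contDiffOn h1).clm_apply h1))).neg

theorem ContSmooth.sobolevContDiffOn (hs : ContSmooth T u)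
    (hm : IsMild T u (fun t => force M P (u t))) (hP : IsFiberedProjection P) (k : ℕ) {s : ℝ}
    (hs0 : 0 ≤ s) : SobolevContDiffOn k s (Ioc 0 T) u :=
  ⟨_, (hs s hs0).1, hs.contDiffOn hm hP k s hs0⟩

end Smooth

/-! ### Joint smoothness in time and space -/

lemma IsBddSymbol.add {w w' : R3 → ℂ} (h : IsBddSymbol w) (h' : IsBddSymbol w') :
    IsBddSymbol (fun ξ => w ξ + w' ξ) := by
  obtain ⟨c, hc⟩ := h.bdd
  obtain ⟨c', hc'⟩ := h'.bdd
  exact ⟨⟨h.meas.add h'.meas, fun ξ => by rw [h.herm, h'.herm]; exact (map_add _ _ _).symm⟩, c + c',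
    fun ξ => (norm_add_le _ _).trans (add_le_add (hc ξ) (hc' ξ))⟩

lemma IsBddSymbol.sub {w w' : R3 → ℂ} (h : IsBddSymbol w) (h' : IsBddSymbol w') :
    IsBddSymbol (fun ξ => w ξ - w' ξ) := by
  obtain ⟨c, hc⟩ := h.bdd
  obtain ⟨c', hc'⟩ := h'.bdd
  exact ⟨⟨h.meas.sub h'.meas, fun ξ => by rw [h.herm, h'.herm]; exact (map_sub _ _ _).symm⟩, c + c',
    fun ξ => (norm_sub_le _ _).trans (add_le_add (hc ξ) (hc' ξ))⟩

lemma IsBddSymbol.real_mul {w : R3 → ℂ} (h : IsBddSymbol w) (r : ℝ) :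
    IsBddSymbol (fun ξ => r * w ξ) := by
  obtain ⟨c, hc⟩ := h.bdd
  refine ⟨⟨h.meas.const_mul _, fun ξ => by
    rw [h.herm, map_mul (starRingEnd ℂ) (r : ℂ), Complex.conj_ofReal]⟩, |r| * c, fun ξ => ?_⟩
  rw [norm_mul, Complex.norm_real, Real.norm_eq_abs]
  exact mul_le_mul_of_nonneg_left (hc ξ) (abs_nonneg _)

/-- The symbol of the translation by `x`. -/
def symTr (x ξ : R3) : ℂ := Complex.exp (((2 * Real.pi * ⟪ξ, x⟫_ℝ : ℝ) : ℂ) * Complex.I)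

lemma norm_symTr (x ξ : R3) : ‖symTr x ξ‖ = 1 := Complex.norm_exp_ofReal_mul_I _

lemma isBddSymbol_symTr (x : R3) : IsBddSymbol (symTr x) := by
  refine ⟨⟨by unfold symTr; fun_prop, fun ξ => ?_⟩, 1, fun ξ => (norm_symTr x ξ).le⟩
  rw [symTr, symTr, ← Complex.exp_conj, map_mul, Complex.conj_ofReal, Complex.conj_I,
    inner_neg_left]
  congr 1; push_cast; ring

lemma symTr_add (x y ξ : R3) : symTr (x + y) ξ = symTr x ξ * symTr y ξ := by
  rw [symTr, symTr, symTr, ← Complex.exp_add, inner_add_right]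
  congr 1; push_cast; ring

lemma abs_two_pi_inner_le (y ξ : R3) : |2 * Real.pi * ⟪ξ, y⟫_ℝ| ≤ ‖y‖ * (2 * Real.pi * ‖ξ‖) := by
  rw [abs_mul, abs_of_pos Real.two_pi_pos]
  have := abs_real_inner_le_norm ξ y
  nlinarith [Real.two_pi_pos]

lemma norm_symTr_sub_one_le (y ξ : R3) : ‖symTr y ξ - 1‖ ≤ ‖y‖ * (2 * Real.pi * ‖ξ‖) := by
  rw [symTr, mul_comm]
  exact Real.norm_exp_I_mul_ofReal_sub_one_le.trans (abs_two_pi_inner_le y ξ)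

lemma norm_exp_mul_I_sub_le (a : ℝ) :
    ‖Complex.exp ((a : ℂ) * Complex.I) - 1 - (a : ℂ) * Complex.I‖ ≤ 2 * a ^ 2 := by
  have hn : ‖(a : ℂ) * Complex.I‖ = |a| := by simp
  rcases le_total |a| 1 with h | h
  · have := Complex.norm_exp_sub_one_sub_id_le (x := (a : ℂ) * Complex.I) (by rwa [hn])
    rw [hn, sq_abs] at this
    nlinarith [sq_nonneg a]
  · have h1 : ‖Complex.exp ((a : ℂ) * Complex.I) - 1‖ ≤ |a| := by
      rw [mul_comm]; exact Real.norm_exp_I_mul_ofReal_sub_one_le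
    refine (norm_sub_le _ _).trans ?_
    rw [hn, ← sq_abs a]
    nlinarith

lemma sum_symD (y ξ : R3) :
    ∑ j, ((y j : ℝ) : ℂ) * symD j ξ = ((2 * Real.pi * ⟪ξ, y⟫_ℝ : ℝ) : ℂ) * Complex.I := by
  simp only [symD, Fin.sum_univ_three, PiLp.inner_apply, RCLike.inner_apply, conj_trivial]
  push_cast; ring

lemma norm_symTr_sub_sub_le (y ξ : R3) :
    ‖symTr y ξ - 1 - ∑ j, ((y j : ℝ) : ℂ) * symD j ξ‖ ≤ 2 * (‖y‖ * (2 * Real.pi * ‖ξ‖)) ^ 2 := by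
  rw [sum_symD]
  refine (norm_exp_mul_I_sub_le _).trans ?_
  have := pow_le_pow_left₀ (abs_nonneg _) (abs_two_pi_inner_le y ξ) 2
  rw [sq_abs] at this
  linarith

lemma le_norm_symBessel_one (ξ : R3) : 2 * Real.pi * ‖ξ‖ ≤ ‖symBessel 1 ξ‖ := by
  have := norm_symA_le_symBessel zero_le_one ξ
  rwa [norm_symA, Real.rpow_one] at this

/-- Symbols of order `-s`. -/
def HasDecay (s : ℝ) (w : R3 → ℂ) : Prop := ∃ c, 0 ≤ c ∧ ∀ ξ, ‖w ξ‖ ≤ c * ‖symBessel (-s) ξ‖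

lemma HasDecay.isBddSymbol {s : ℝ} (hs : 0 ≤ s) {w : R3 → ℂ} (hw : IsSymbol w) (h : HasDecay s w) :
    IsBddSymbol w := by
  obtain ⟨c, hc0, hc⟩ := h
  refine ⟨hw, c * 1, fun ξ => (hc ξ).trans (mul_le_mul_of_nonneg_left ?_ hc0)⟩
  refine (norm_symBessel_mono (b := 0) (by linarith) ξ).trans ?_
  rw [symBessel_zero, norm_one]

lemma HasDecay.symD_mul {s : ℝ} {w : R3 → ℂ} (h : HasDecay (s + 1) w) (j : Fin 3) :
    HasDecay s (fun ξ => symD j ξ * w ξ) := by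
  obtain ⟨c, hc0, hc⟩ := h
  refine ⟨c, hc0, fun ξ => ?_⟩
  rw [norm_mul]
  calc _ ≤ ‖symBessel 1 ξ‖ * (c * ‖symBessel (-(s + 1)) ξ‖) := by
        gcongr
        · exact (norm_symD_le j ξ).trans (le_norm_symBessel_one ξ)
        · exact hc ξ
    _ = c * ‖symBessel (-s) ξ‖ := by
        rw [mul_left_comm, ← norm_mul, symBessel_mul]; congr 3; ring

lemma HasDecay.norm_mul_le {s : ℝ} (hs : 0 ≤ s) {w : R3 → ℂ} {n : ℕ} (h : HasDecay (s + n) w) :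
    ∃ c, 0 ≤ c ∧ ∀ ξ, (2 * Real.pi * ‖ξ‖) ^ n * ‖w ξ‖ ≤ c := by
  obtain ⟨c, hc0, hc⟩ := h
  refine ⟨c, hc0, fun ξ => ?_⟩
  have h1 : (2 * Real.pi * ‖ξ‖) ^ n ≤ ‖symBessel n ξ‖ := by
    have := norm_symA_le_symBessel (Nat.cast_nonneg n) ξ
    rwa [norm_symA, Real.rpow_natCast] at this
  calc _ ≤ ‖symBessel n ξ‖ * (c * ‖symBessel (-(s + n)) ξ‖) := by gcongr; exact hc ξ
    _ = c * ‖symBessel (-s) ξ‖ := by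
        rw [mul_left_comm, ← norm_mul, symBessel_mul]; congr 3; ring
    _ ≤ c * ‖symBessel 0 ξ‖ := by gcongr; exact norm_symBessel_mono (by linarith) ξ
    _ = c := by rw [symBessel_zero, norm_one, mul_one]

lemma D_sum_smul {w : Fin 3 → R3 → ℂ} (h : ∀ j, IsBddSymbol (w j)) (y : R3) :
    IsBddSymbol (fun ξ => ∑ j, ((y j : ℝ) : ℂ) * w j ξ) ∧
    D (fun ξ => ∑ j, ((y j : ℝ) : ℂ) * w j ξ) = ∑ j, y j • D (w j) := by
  simp only [Fin.sum_univ_three]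
  have h0 := fun j => (h j).real_mul (y j)
  refine ⟨((h0 0).add (h0 1)).add (h0 2), ?_⟩
  rw [D_add ((h0 0).add (h0 1)) (h0 2), D_add (h0 0) (h0 1), D_real_smul (h 0), D_real_smul (h 1),
    D_real_smul (h 2)]

/-- Translations composed with operators of order `-2` are differentiable in operator norm. -/
lemma hasFDerivAt_D_symTr {w : R3 → ℂ} (hw : IsSymbol w) (hd : HasDecay (0 + (2 : ℕ)) w) (x : R3) :
    HasFDerivAt (fun x => D (fun ξ => symTr x ξ * w ξ))
      (∑ j : Fin 3, (EuclideanSpace.proj j : R3 →L[ℝ] ℝ).smulRight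
        (D (fun ξ => symTr x ξ * (symD j ξ * w ξ)))) x := by
  obtain ⟨c, hc0, hc⟩ := hd.norm_mul_le le_rfl
  rw [hasFDerivAt_iff_isLittleO_nhds_zero]
  have hbw : IsBddSymbol w := hd.isBddSymbol (by norm_num) hw
  have hdj : ∀ j, HasDecay 1 (fun ξ => symD j ξ * w ξ) := fun j =>
    HasDecay.symD_mul (by convert hd using 1; norm_num) j
  have hbj : ∀ j, IsBddSymbol (fun ξ => symTr x ξ * (symD j ξ * w ξ)) := fun j =>
    (isBddSymbol_symTr x).mul ((hdj j).isBddSymbol zero_le_one ((isSymbol_symD j).mul hw))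
  refine Asymptotics.IsBigO.trans_isLittleO (g := fun y : R3 => ‖y‖ ^ 2) ?_ ?_
  · refine Asymptotics.IsBigO.of_bound (2 * c) (Eventually.of_forall fun y => ?_)
    have b1 := (isBddSymbol_symTr (x + y)).mul hbw
    have b2 := (isBddSymbol_symTr x).mul hbw
    obtain ⟨b3, e3⟩ := D_sum_smul hbj y
    have e : (∑ j : Fin 3, (EuclideanSpace.proj j : R3 →L[ℝ] ℝ).smulRight
        (D (fun ξ => symTr x ξ * (symD j ξ * w ξ)))) y =
        ∑ j, y j • D (fun ξ => symTr x ξ * (symD j ξ * w ξ)) := by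
      simp
    rw [e, ← e3, ← D_sub b1 b2, ← D_sub (b1.sub b2) b3]
    refine norm_D_le ((b1.sub b2).sub b3) fun ξ => ?_
    have e1 : symTr (x + y) ξ * w ξ - symTr x ξ * w ξ -
        ∑ j, ((y j : ℝ) : ℂ) * (symTr x ξ * (symD j ξ * w ξ)) =
        symTr x ξ * (symTr y ξ - 1 - ∑ j, ((y j : ℝ) : ℂ) * symD j ξ) * w ξ := by
      rw [symTr_add]
      simp only [Fin.sum_univ_three]
      ring
    rw [e1, norm_mul, norm_mul, norm_symTr, one_mul, Real.norm_of_nonneg (by positivity)]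
    calc _ ≤ 2 * (‖y‖ * (2 * Real.pi * ‖ξ‖)) ^ 2 * ‖w ξ‖ := by
          gcongr; exact norm_symTr_sub_sub_le y ξ
      _ = 2 * ((2 * Real.pi * ‖ξ‖) ^ 2 * ‖w ξ‖) * ‖y‖ ^ 2 := by ring
      _ ≤ _ := by gcongr; exact hc ξ
  · have h1 : (fun y : R3 => ‖y‖ ^ 2) =o[𝓝 0] (fun y : R3 => ‖y‖ ^ 1) :=
      (Asymptotics.isLittleO_pow_pow (show 1 < 2 by norm_num)).comp_tendsto
        (by simpa using (continuous_norm (E := R3)).tendsto 0)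
    exact h1.trans_isBigO (Asymptotics.isBigO_of_le _ fun y => by simp)

/-- Translations are not norm continuous in x, but each order of decay of `w` buys one derivative.
The one order in excess makes the case m = 0 Lipschitz. -/
lemma contDiff_D_symTr (m : ℕ) : ∀ {w : R3 → ℂ}, IsSymbol w → HasDecay (m + 1) w →
    ContDiff ℝ m (fun x => D (fun ξ => symTr x ξ * w ξ)) := by
  induction m with
  | zero =>
    intro w hw hd
    have hd1 : HasDecay (0 + (1 : ℕ)) w := by simpa using hd
    obtain ⟨c, hc0, hc⟩ := hd1.norm_mul_le le_rfl
    have hbw : IsBddSymbol w := hd1.isBddSymbol (by norm_num) hw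
    refine contDiff_zero.2 (LipschitzWith.of_dist_le_mul (K := ⟨c, hc0⟩) fun x y => ?_).continuous
    have b1 := (isBddSymbol_symTr x).mul hbw
    have b2 := (isBddSymbol_symTr y).mul hbw
    rw [dist_eq_norm, dist_eq_norm, ← D_sub b1 b2]
    refine norm_D_le (b1.sub b2) fun ξ => ?_
    have e1 : symTr x ξ * w ξ - symTr y ξ * w ξ = symTr y ξ * (symTr (x - y) ξ - 1) * w ξ := by
      have : symTr x ξ = symTr y ξ * symTr (x - y) ξ := by rw [← symTr_add, add_sub_cancel]
      rw [this]; ring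
    rw [e1, norm_mul, norm_mul, norm_symTr, one_mul]
    calc _ ≤ ‖x - y‖ * (2 * Real.pi * ‖ξ‖) * ‖w ξ‖ := by
          gcongr; exact norm_symTr_sub_one_le _ ξ
      _ = ((2 * Real.pi * ‖ξ‖) ^ 1 * ‖w ξ‖) * ‖x - y‖ := by ring
      _ ≤ _ := by gcongr; exact hc ξ
  | succ m ih =>
    intro w hw hd
    rw [Nat.cast_succ, contDiff_succ_iff_hasFDerivAt]
    have hd2 : HasDecay (0 + (2 : ℕ)) w := by
      obtain ⟨c, hc0, hc⟩ := hd
      refine ⟨c, hc0, fun ξ => (hc ξ).trans ?_⟩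
      gcongr
      apply norm_symBessel_mono
      have : (0 : ℝ) ≤ m := Nat.cast_nonneg m
      push_cast; linarith
    refine ⟨_, ?_, fun x => hasFDerivAt_D_symTr hw hd2 x⟩
    refine ContDiff.sum fun j _ => ?_
    have hj := ih ((isSymbol_symD j).mul hw) (HasDecay.symD_mul (by
      convert hd using 1; push_cast; ring) j)
    exact contDiff_const.smulRight hj

/-- The square decays like ‖ξ‖^(-4), and 4 > 3. Hence two orders of regularity suffice for point
evaluation. -/
lemma memLp_symBessel_neg_two : MemLp (symBessel (-2)) 2 (volume : Measure R3) := by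
  rw [memLp_two_iff_integrable_sq_norm (measurable_symBessel _).aestronglyMeasurable]
  have h := integrable_rpow_neg_one_add_norm_sq (E := R3) (μ := volume) (r := 4) (by simp; norm_num)
  refine h.mono ((measurable_symBessel _).norm.pow_const 2).aestronglyMeasurable
    (Eventually.of_forall fun ξ => ?_)
  rw [norm_symBessel, Real.norm_of_nonneg (by positivity), Real.norm_of_nonneg (by positivity),
    ← Real.rpow_mul_natCast (by positivity), show (-2 / 2 * (2 : ℕ) : ℝ) = -4 / 2 by norm_num]
  refine Real.rpow_le_rpow_of_nonpos (by positivity) ?_ (by norm_num)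
  have h1 : ‖ξ‖ ≤ 2 * Real.pi * ‖ξ‖ :=
    le_mul_of_one_le_left (norm_nonneg _) (by linarith [Real.pi_gt_three])
  have := pow_le_pow_left₀ (norm_nonneg ξ) h1 2
  linarith

lemma integrable_symBessel_smul_hat (f : L2) :
    Integrable (fun ξ => symBessel (-2) ξ • hat f ξ) (volume : Measure R3) :=
  memLp_one_iff_integrable.1 ((Lp.memLp (hat f)).smul memLp_symBessel_neg_two)

/-- The value at the origin of `(1 - Δ)⁻¹ f`. -/
def evalZero : L2 →L[ℝ] R3 :=
  LinearMap.mkContinuous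
    { toFun := fun f => reC (∫ ξ, symBessel (-2) ξ • hat f ξ)
      map_add' := fun f g => by
        rw [← map_add, ← integral_add (integrable_symBessel_smul_hat f)
          (integrable_symBessel_smul_hat g), hat_add]
        congr 1
        refine integral_congr_ae ?_
        filter_upwards [Lp.coeFn_add (hat f) (hat g)] with ξ h
        rw [h, Pi.add_apply, smul_add]
      map_smul' := fun c f => by
        rw [RingHom.id_apply, ← map_smul, ← integral_smul, hat_smul]
        congr 1
        refine integral_congr_ae ?_
        filter_upwards [Lp.coeFn_smul c (hat f)] with ξ h
        rw [h, Pi.smul_apply, smul_comm] }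
    (‖reC‖ * (eLpNorm (symBessel (-2)) 2 (volume : Measure R3)).toReal) (fun f => by
      have h1 : ‖∫ ξ, symBessel (-2) ξ • hat f ξ‖ₑ ≤
          eLpNorm (symBessel (-2)) 2 (volume : Measure R3) * ‖f‖ₑ := by
        refine (enorm_integral_le_lintegral_enorm _).trans ?_
        rw [← eLpNorm_one_eq_lintegral_enorm]
        refine (eLpNorm_smul_le_mul_eLpNorm (p := 2) (q := 2) (r := 1)
          (Lp.aestronglyMeasurable (hat f)) memLp_symBessel_neg_two.1).trans (le_of_eq ?_)
        rw [← Lp.enorm_def, ← ofReal_norm (hat f), norm_hat, ofReal_norm]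
      have h2 : ‖∫ ξ, symBessel (-2) ξ • hat f ξ‖ ≤
          (eLpNorm (symBessel (-2)) 2 (volume : Measure R3)).toReal * ‖f‖ := by
        have := ENNReal.toReal_mono (by
          exact ENNReal.mul_ne_top memLp_symBessel_neg_two.2.ne enorm_ne_top) h1
        rwa [ENNReal.toReal_mul, toReal_enorm, toReal_enorm] at this
      refine (reC.le_opNorm _).trans ?_
      rw [mul_assoc]
      exact mul_le_mul_of_nonneg_left h2 (norm_nonneg _))

lemma evalZero_apply (f : L2) : evalZero f = reC (∫ ξ, symBessel (-2) ξ • hat f ξ) := rfl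

/-- The representative of `f` obtained by Fourier inversion. -/
def smoothRep (f : L2) (x : R3) : R3 := reC (𝓕⁻ (hat f : R3 → C3) x)

/-- Separates the variables: the operator depends only on x and the field `F` only on the solution
at time t, so joint smoothness follows from smoothness in each. -/
lemma smoothRep_eq {s : ℝ} (hs : 0 ≤ s) {f F : L2} (h : IsMultiplier (symBessel (s + 2)) f F)
    (x : R3) : smoothRep f x = evalZero (D (fun ξ => symTr x ξ * symBessel (-s) ξ) F) := by
  have hb : IsBddSymbol (fun ξ => symTr x ξ * symBessel (-s) ξ) :=
    (isBddSymbol_symTr x).mul (isBddSymbol_symBessel (by linarith))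
  rw [smoothRep, evalZero_apply, Real.fourierInv_eq']
  congr 1
  refine integral_congr_ae ?_
  filter_upwards [h, isMultiplier_D hb F] with ξ h1 h2
  rw [h2, h1, smul_smul, smul_smul]
  have : symBessel (-2) ξ * (symTr x ξ * symBessel (-s) ξ) * symBessel (s + 2) ξ = symTr x ξ := by
    calc _ = symTr x ξ * (symBessel (-2) ξ * symBessel (-s) ξ * symBessel (s + 2) ξ) := by ring
      _ = _ := by
        rw [symBessel_mul, symBessel_mul, show -2 + -s + (s + 2) = 0 by ring, symBessel_zero, mul_one]
  rw [this, symTr]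

lemma smoothRep_ae_eq {f F : L2} (h : IsMultiplier (symBessel 2) f F) : smoothRep f =ᵐ[volume] f := by
  have hi : Integrable (hat f) (volume : Measure R3) := by
    refine (integrable_symBessel_smul_hat F).congr ?_
    filter_upwards [h] with ξ h1
    rw [h1, smul_smul, symBessel_mul, neg_add_cancel, symBessel_zero, one_smul]
  filter_upwards [ae_eq_fourierInv_of_integrable (complexify.compLp f) hi,
    complexify.coeFn_compLp f] with x h1 h2
  rw [smoothRep, hat, ← h1, h2, reC_complexify]

theorem ContSmooth.contDiffOn_smoothRep {M : Matrix (Fin 3) (Fin 3) ℝ} {P : L2 →L[ℝ] L2} {T : ℝ}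
    {u : ℝ → L2} (hs : ContSmooth T u) (hm : IsMild T u (fun t => force M P (u t)))
    (hP : IsFiberedProjection P) :
    ContDiffOn ℝ ∞ (fun p : ℝ × R3 => smoothRep (u p.1) p.2) (Ioc 0 T ×ˢ (univ : Set R3)) := by
  rw [contDiffOn_infty]
  intro m
  -- `m + 1` orders pay for m derivatives of the translations, and 2 for the evaluation at the
  -- origin.
  have h1 := hs.contDiffOn hm hP m ((m + 1 : ℝ) + 2) (by positivity)
  have h2 := contDiff_D_symTr m (isSymbol_symBessel (-(m + 1 : ℝ))) ⟨1, zero_le_one, fun ξ => by simp⟩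
  have h3 : ContDiffOn ℝ m (fun p : ℝ × R3 => op (symBessel ((m + 1 : ℝ) + 2)) (u p.1))
      (Ioc 0 T ×ˢ (univ : Set R3)) := h1.comp contDiff_fst.contDiffOn fun p hp => hp.1
  have h4 := evalZero.contDiff.comp_contDiffOn
    ((h2.comp contDiff_snd).contDiffOn (s := Ioc 0 T ×ˢ (univ : Set R3)) |>.clm_apply h3)
  exact h4.congr fun p hp =>
    smoothRep_eq (by positivity) ((hs ((m + 1 : ℝ) + 2) (by positivity)).1 p.1 hp.1) p.2

/-! ### The energy identity -/

lemma inner_eq_re_inner_hat (f g : L2) : ⟪f, g⟫_ℝ = (⟪hat f, hat g⟫_ℂ).re := by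
  have h1 := re_inner_eq_norm_add_mul_self_sub_norm_sub_mul_self_div_four (𝕜 := ℝ) f g
  have h2 := re_inner_eq_norm_add_mul_self_sub_norm_sub_mul_self_div_four (𝕜 := ℂ) (hat f) (hat g)
  rw [← hat_add, ← hat_sub, norm_hat, norm_hat] at h2
  simp only [RCLike.re_to_real] at h1
  rw [h1]
  exact h2.symm

/-- The bilinear form `(z, w) ↦ ∑ᵢ zᵢ wᵢ` on `ℂ³`. -/
def dotForm : C3 →L[ℂ] C3 →L[ℂ] ℂ :=
  ∑ i : Fin 3, (EuclideanSpace.proj i : C3 →L[ℂ] ℂ).smulRight (EuclideanSpace.proj i : C3 →L[ℂ] ℂ)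

lemma dotForm_apply (z w : C3) : dotForm z w = ∑ i, z i * w i := by
  simp [dotForm, Fin.sum_univ_three]

lemma dotForm_comm (z w : C3) : dotForm z w = dotForm w z := by
  simp only [dotForm_apply, mul_comm]

lemma dotForm_complexify (x y : R3) :
    dotForm (complexify x) (complexify y) = ((⟪x, y⟫_ℝ : ℝ) : ℂ) := by
  simp [dotForm_apply, PiLp.inner_apply, Fin.sum_univ_three, mul_comm]

/-- The bilinear map `(z, w) ↦ (∑ᵢ zᵢ wᵢ) m`. -/
def dotBilin (m : R3) : C3 →L[ℂ] C3 →L[ℂ] C3 :=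
  (ContinuousLinearMap.compL ℂ C3 ℂ C3 (ContinuousLinearMap.toSpanSingleton ℂ (complexify m))).comp
    dotForm

lemma dotBilin_apply (m : R3) (z w : C3) : dotBilin m z w = dotForm z w • complexify m := rfl

lemma dotBilin_complexify (m x y : R3) :
    dotBilin m (complexify x) (complexify y) = complexify (⟪x, y⟫_ℝ • m) := by
  rw [dotBilin_apply, dotForm_complexify, map_smul, Complex.coe_smul]

lemma isRealBilin_dotBilin (m : R3) : IsRealBilin (dotBilin m) := fun x y => by
  rw [dotBilin_complexify, conjC_complexify]

lemma prodFun_dotBilin (m : R3) (f g : L2) (x : R3) :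
    prodFun (dotBilin m) f g x = ⟪f x, g x⟫_ℝ • m := by
  rw [prodFun, dotBilin_complexify, reC_complexify]

lemma integrable_dotForm_conv (F G : Lp C3 2 (volume : Measure R3)) (ξ : R3) :
    Integrable (fun η => dotForm (F η) (G (ξ - η))) (volume : Measure R3) :=
  memLp_one_iff_integrable.1 (dotForm.memLp_of_bilin 1 (Lp.memLp F)
    ((Lp.memLp G).comp_measurePreserving (Measure.measurePreserving_sub_left volume ξ)))

lemma symD_add (j : Fin 3) (ξ η : R3) : symD j (ξ - η) + symD j η = symD j ξ := by
  simp only [symD, PiLp.sub_apply]; push_cast; ring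

/-- Symmetrisation: `f · ∂ⱼ f = ∂ⱼ |f|² / 2` on the Fourier side. -/
lemma integral_dotForm_partialD {f : L2} (hf : normA (5 / 4) f < ⊤) (j : Fin 3) (ξ : R3) :
    ∫ η, dotForm (hat f η) (hat (partialD j f) (ξ - η)) =
      symD j ξ * (1 / 2 * ∫ η, dotForm (hat f η) (hat f (ξ - η))) := by
  have hD := isMultiplier_partialD hf j
  have hq := (Measure.measurePreserving_sub_left (volume : Measure R3) ξ).quasiMeasurePreserving
  have e1 : ∫ η, dotForm (hat f η) (hat (partialD j f) (ξ - η)) =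
      ∫ η, symD j (ξ - η) * dotForm (hat f η) (hat f (ξ - η)) := by
    refine integral_congr_ae ?_
    filter_upwards [hq.ae hD] with η h
    rw [h, map_smul, smul_eq_mul]
  -- The substitution η ↦ ξ - η moves the derivative to the other factor. In the average of both
  -- expressions the symbols add up to `symD j ξ`.
  have e2 : ∫ η, dotForm (hat f η) (hat (partialD j f) (ξ - η)) =
      ∫ η, symD j η * dotForm (hat f η) (hat f (ξ - η)) := by
    rw [← integral_sub_left_eq_self _ (volume : Measure R3) ξ]
    refine integral_congr_ae ?_
    filter_upwards [hD] with η h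
    rw [sub_sub_cancel, h, map_smul, smul_eq_mul, dotForm_comm]
  have i0 := integrable_dotForm_conv (hat f) (hat (partialD j f)) ξ
  have i1 : Integrable (fun η => symD j (ξ - η) * dotForm (hat f η) (hat f (ξ - η))) := by
    refine i0.congr ?_
    filter_upwards [hq.ae hD] with η h
    rw [h, map_smul, smul_eq_mul]
  have i2 : Integrable (fun η => symD j η * dotForm (hat f η) (hat f (ξ - η))) := by
    refine (integrable_dotForm_conv (hat (partialD j f)) (hat f) ξ).congr ?_
    filter_upwards [hD] with η h
    rw [h, map_smul, smul_apply, smul_eq_mul]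
  have e3 := integral_add i1 i2
  rw [← e1, ← e2] at e3
  simp_rw [← add_mul, symD_add] at e3
  rw [integral_const_mul] at e3
  linear_combination (-1 / 2 : ℂ) * e3

lemma rowForm_apply (M : Matrix (Fin 3) (Fin 3) ℝ) (j : Fin 3) (z : C3) :
    rowForm M j z = ∑ k, (M j k : ℂ) * z k := rfl

/-- The divergence condition tested against complex functions. -/
lemma DivFree.integral_eq_zero {M : Matrix (Fin 3) (Fin 3) ℝ} {f : L2} (h : DivFree M f)
    (ψ : 𝓢(R3, ℂ)) :
    ∑ j, rowForm M j (∫ x, (LineDeriv.lineDerivOp (EuclideanSpace.single j (1 : ℝ)) ψ : 𝓢(R3, ℂ)) x •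
      complexify.compLp f x) = 0 := by
  set g : Fin 3 → R3 → C3 := fun j x =>
    (LineDeriv.lineDerivOp (EuclideanSpace.single j (1 : ℝ)) ψ : 𝓢(R3, ℂ)) x • complexify.compLp f x
    with hg
  have hgi : ∀ j, Integrable (g j) volume := fun j => integrable_smul_complexify f _
  have hgi' : ∀ j, Integrable (fun x => rowForm M j (g j x)) volume := fun j =>
    (rowForm M j).integrable_comp (hgi j)
  have e1 : ∑ j, rowForm M j (∫ x, g j x) = ∫ x, ∑ j, rowForm M j (g j x) := by
    rw [integral_finsetSum _ fun j _ => hgi' j]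
    exact Finset.sum_congr rfl fun j _ => ((rowForm M j).integral_comp_comm (hgi j)).symm
  have hsum : Integrable (fun x => ∑ j, rowForm M j (g j x)) volume :=
    integrable_finsetSum _ fun j _ => hgi' j
  -- The divergence condition admits only real test functions, so real and imaginary parts are
  -- tested separately.
  have key : ∀ p : ℂ →L[ℝ] ℝ, p (∫ x, ∑ j, rowForm M j (g j x)) = 0 := by
    intro p
    rw [← p.integral_comp_comm hsum, ← h (SchwartzMap.postcompCLM p ψ)]
    refine integral_congr_ae ?_
    filter_upwards [complexify.coeFn_compLp f] with x hx
    have e2 : fderiv ℝ (SchwartzMap.postcompCLM p ψ) x = p.comp (fderiv ℝ ψ x) :=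
      (p.hasFDerivAt.comp x (ψ.differentiableAt.hasFDerivAt)).fderiv
    rw [e2, ContinuousLinearMap.comp_apply]
    congr 1
    have e3 : matVec M (f x) = ∑ j, matVec M (f x) j • EuclideanSpace.single j (1 : ℝ) := by
      ext i; simp [Fin.sum_univ_three]; fin_cases i <;> simp
    rw [e3, map_sum]
    refine Finset.sum_congr rfl fun j _ => ?_
    rw [hg]
    simp only
    rw [hx, map_smul, map_smul, rowForm_apply, rowForm_complexify, smul_eq_mul, mul_comm,
      Complex.real_smul]
    rfl
  rw [e1]
  exact Complex.ext (key Complex.reCLM) (key Complex.imCLM)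

/-- The divergence condition on the Fourier side. -/
lemma DivFree.ae_eq_zero {M : Matrix (Fin 3) (Fin 3) ℝ} {f : L2} (h : DivFree M f) :
    ∀ᵐ ξ : R3, ∑ j, symD j ξ * rowForm M j (hat f ξ) = 0 := by
  have hloc : ∀ j, LocallyIntegrable (fun ξ => symD j ξ * rowForm M j (hat f ξ)) := by
    intro j
    have h1 : LocallyIntegrable (fun ξ => rowForm M j (hat f ξ)) :=
      ((rowForm M j).comp_memLp (hat f)).locallyIntegrable one_le_two
    rw [← locallyIntegrableOn_univ] at h1 ⊢
    exact h1.continuousOn_smul isOpen_univ.isLocallyClosed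
      (g := symD j) (by unfold symD; fun_prop)
  refine ae_eq_of_integral_contDiff_smul_eq (f' := fun _ => (0 : ℂ)) ?_ (locallyIntegrable_const _) ?_
  · simp only [Fin.sum_univ_three]
    exact ((hloc 0).add (hloc 1)).add (hloc 2)
  intro χ hχ hc
  have hc1 : HasCompactSupport (Complex.ofRealCLM ∘ χ) := hc.comp_left rfl
  have hc2 : ContDiff ℝ ∞ (Complex.ofRealCLM ∘ χ) := by fun_prop
  set χ' := hc1.toSchwartzMap hc2 with hχ'
  have hχa : ∀ x, χ' x = (χ x : ℂ) := fun x => rfl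
  have h1 := h.integral_eq_zero (𝓕 χ')
  simp only [SchwartzMap.lineDerivOp_fourier_eq, integral_fourier_smul_Lp] at h1
  have hgi : ∀ (j : Fin 3), Integrable (fun ξ => χ ξ • (symD j ξ * rowForm M j (hat f ξ))) volume :=
    fun j => (hloc j).integrable_smul_left_of_hasCompactSupport hχ.continuous hc
  simp only [Finset.smul_sum, smul_zero, integral_zero]
  rw [integral_finsetSum _ fun j _ => hgi j, ← neg_eq_zero, ← Finset.sum_neg_distrib, ← h1]
  refine Finset.sum_congr rfl fun j _ => ?_
  have htg : (fun x : R3 => ⟪x, EuclideanSpace.single j (1 : ℝ)⟫_ℝ).HasTemperateGrowth := by fun_prop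
  set θ : 𝓢(R3, ℂ) := -(2 * (Real.pi : ℂ) * Complex.I) • SchwartzMap.smulLeftCLM ℂ
    (fun x : R3 => ⟪x, EuclideanSpace.single j (1 : ℝ)⟫_ℝ) χ' with hθ
  have hθa : ∀ ξ, θ ξ = -((χ ξ : ℂ) * symD j ξ) := by
    intro ξ
    rw [hθ, smul_apply, SchwartzMap.smulLeftCLM_apply_apply htg, hχa, symD,
      EuclideanSpace.inner_single_right]
    simp only [conj_trivial, one_mul, Complex.real_smul, smul_eq_mul]
    ring
  have hi : Integrable (fun ξ => θ ξ • hat f ξ) (volume : Measure R3) :=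
    memLp_one_iff_integrable.1 ((ContinuousLinearMap.lsmul ℂ ℂ).memLp_of_bilin (p := 2) (q := 2) 1
      (θ.memLp 2 volume) (Lp.memLp (hat f)))
  change _ = rowForm M j (∫ ξ, θ ξ • hat f ξ)
  rw [← (rowForm M j).integral_comp_comm hi, ← integral_neg]
  refine integral_congr_ae (Eventually.of_forall fun ξ => ?_)
  simp only
  rw [map_smul, hθa, smul_eq_mul, Complex.real_smul]
  ring

lemma inner_complexify_right (z : C3) (m : R3) :
    ⟪z, complexify m⟫_ℂ = (starRingEnd ℂ) (∑ k, (m k : ℂ) * z k) := by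
  simp [PiLp.inner_apply, Fin.sum_univ_three, mul_comm]

lemma inner_matVec (M : Matrix (Fin 3) (Fin 3) ℝ) (x : R3) (j : Fin 3) :
    ⟪x, (WithLp.toLp 2 (M j) : R3)⟫_ℝ = matVec M x j := by
  simp [PiLp.inner_apply, matVec, Matrix.mulVec, dotProduct]

/-- The nonlinearity does no work on the solution. -/
theorem DivFree.inner_Nl_eq_zero {M : Matrix (Fin 3) (Fin 3) ℝ} {f : L2} (h : DivFree M f)
    (hf : normA (5 / 4) f < ⊤) : ⟪f, Nl M f f⟫_ℝ = 0 := by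
  set m : Fin 3 → R3 := fun j => WithLp.toLp 2 (M j) with hm
  set G : Fin 3 → L2 := fun j => toL2 (prodFun (dotBilin (m j)) f (partialD j f)) with hG
  have hGe := fun j => exists_prodFun_partialD (isRealBilin_dotBilin (m j)) hf hf j
  have hNe := fun j => exists_prodFun_partialD (isRealBilin_convBilin M j) hf hf j
  have hGhat : ∀ j, ∀ᵐ ξ, hat (G j) ξ =
      (symD j ξ * (1 / 2 * ∫ η, dotForm (hat f η) (hat f (ξ - η)))) • complexify (m j) := by
    intro j
    filter_upwards [(hGe j).2] with ξ h1
    rw [h1, ← integral_dotForm_partialD hf j ξ, ← integral_smul_const]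
    rfl
  -- Pointwise, f · ((Mf)ⱼ ∂ⱼf) = f · ((f · ∂ⱼf) mⱼ), with mⱼ the j-th row of `M`. In the second
  -- form the transform is `symD j` times a scalar independent of j, so summing over j produces the
  -- divergence of Mf.
  have e1 : ∀ j, ⟪f, toL2 (prodFun (convBilin M j) f (partialD j f))⟫_ℝ = ⟪f, G j⟫_ℝ := by
    intro j
    rw [L2.inner_def, L2.inner_def]
    refine integral_congr_ae ?_
    filter_upwards [toL2_ae (hNe j).1, toL2_ae (hGe j).1] with x h1 h2
    rw [h1, h2, prodFun_convBilin, prodFun_dotBilin, inner_smul_right, inner_smul_right, hm,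
      inner_matVec, mul_comm]
  have e2 : ⟪f, Nl M f f⟫_ℝ = ⟪f, G 0 + G 1 + G 2⟫_ℝ := by
    simp only [Nl, Fin.sum_univ_three, inner_add_right, e1]
  rw [e2, inner_eq_re_inner_hat, L2.inner_def, hat_add, hat_add]
  have e3 : ∫ ξ, ⟪hat f ξ, (hat (G 0) + hat (G 1) + hat (G 2) : Lp C3 2 (volume : Measure R3)) ξ⟫_ℂ
      = ∫ _ : R3, (0 : ℂ) := by
    refine integral_congr_ae ?_
    filter_upwards [hGhat 0, hGhat 1, hGhat 2, h.ae_eq_zero,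
      Lp.coeFn_add (hat (G 0) + hat (G 1)) (hat (G 2)), Lp.coeFn_add (hat (G 0)) (hat (G 1))]
      with ξ h0 h1 h2 h3 h4 h5
    have hr : ∀ j, ⟪hat f ξ, complexify (m j)⟫_ℂ = (starRingEnd ℂ) (rowForm M j (hat f ξ)) :=
      fun j => inner_complexify_right _ _
    have hs : ∀ j, symD j ξ = -(starRingEnd ℂ) (symD j ξ) := fun j => by
      simp [symD, Complex.conj_ofNat]
    rw [h4, Pi.add_apply, h5, Pi.add_apply, h0, h1, h2, inner_add_right, inner_add_right,
      inner_smul_right, inner_smul_right, inner_smul_right, hr, hr, hr]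
    have h6 := congrArg (starRingEnd ℂ) h3
    simp only [Fin.sum_univ_three, map_add, map_mul, map_zero] at h6
    rw [hs 0, hs 1, hs 2]
    linear_combination (-(1 / 2 * ∫ η, dotForm (hat f η) (hat f (ξ - η)))) * h6
  rw [e3, integral_zero, Complex.zero_re]

lemma inner_eq_norm_sq_of_isMultiplier {a : R3 → ℝ} {f g k : L2}
    (hg : IsMultiplier (fun ξ => (a ξ : ℂ)) f g)
    (hk : IsMultiplier (fun ξ => (a ξ : ℂ) * (a ξ : ℂ)) f k) : ⟪f, k⟫_ℝ = ‖g‖ ^ 2 := by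
  rw [← real_inner_self_eq_norm_sq, inner_eq_re_inner_hat, inner_eq_re_inner_hat, L2.inner_def,
    L2.inner_def]
  congr 1
  refine integral_congr_ae ?_
  filter_upwards [hg, hk] with ξ h1 h2
  rw [h1, h2, inner_smul_right, inner_smul_right, inner_smul_left, Complex.conj_ofReal, mul_assoc]

section Energy

variable {M : Matrix (Fin 3) (Fin 3) ℝ} {P : L2 →L[ℝ] L2} {T : ℝ} {u : ℝ → L2}

lemma inner_proj_of_mem_range (hP : IsStarProjection P) {f : L2} (hf : f ∈ P.range) (g : L2) :
    ⟪f, P g⟫_ℝ = ⟪f, g⟫_ℝ := by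
  obtain ⟨f', rfl⟩ := hf
  have h1 : P (P f') = P f' := congrArg (fun L : L2 →L[ℝ] L2 => L f') hP.isIdempotentElem.eq
  rw [← ContinuousLinearMap.adjoint_inner_left, ← ContinuousLinearMap.star_eq_adjoint,
    hP.isSelfAdjoint.star_eq]
  exact congrArg (fun x => ⟪x, g⟫_ℝ) h1

/-- Energy dissipation. -/
lemma ContSmooth.hasDerivAt_norm_sq (hs : ContSmooth T u)
    (hm : IsMild T u (fun t => force M P (u t))) (hP : IsFiberedProjection P)
    {t : ℝ} (ht : t ∈ Ioo 0 T) (hr : u t ∈ P.range) (hdiv : DivFree M (u t)) :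
    HasDerivAt (fun t => ‖u t‖ ^ 2) (-(2 * (normA 1 (u t)).toReal ^ 2)) t := by
  have ht' : t ∈ Ioc 0 T := Ioo_subset_Ioc_self ht
  obtain ⟨Q, hQ, hd⟩ := hs.exists_hasDerivWithinAt hm hP le_rfl
  have hnhds : Ioc 0 T ∈ 𝓝 t := mem_of_superset (isOpen_Ioo.mem_nhds ht) Ioo_subset_Ioc_self
  have hu0 : ∀ x ∈ Ioc 0 T, op (symBessel 0) (u x) = u x := fun x hx =>
    isMultiplier_symBessel_zero.1 ((hs 0 le_rfl).1 x hx)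
  have h54 := (hs (0 + 5 / 4) (by norm_num)).1 t ht'
  have hcrit : normA (5 / 4) (u t) < ⊤ :=
    normA_lt_top_of_isMultiplier_symBessel (by norm_num) (by norm_num) h54
  have hN := isMultiplier_symBessel_zero.1 (hQ _ _ h54)
  have h1 := ((hd t ht').hasDerivAt hnhds).congr_of_eventuallyEq
    (f₁ := u) (by filter_upwards [hnhds] with x hx using (hu0 x hx).symm)
  rw [hN] at h1
  have h2 := (hs 1 zero_le_one).1 t ht'
  have hA : normA 1 (u t) < ⊤ := normA_lt_top_of_isMultiplier_symBessel zero_le_one le_rfl h2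
  have h3 := isMultiplier_op (isSymbol_symA 1) hA
  have h4 := ((hs (0 + 2) (by norm_num)).1 t ht').comp (isMultiplier_D isBddSymbol_symRes _)
  have h5 : ⟪u t, D symRes (op (symBessel (0 + 2)) (u t))⟫_ℝ = (normA 1 (u t)).toReal ^ 2 := by
    rw [inner_eq_norm_sq_of_isMultiplier h3 (h4.congr fun ξ => ?_), normA, ← h3.enorm_eq,
      toReal_enorm]
    rw [symRes, mul_assoc, symBessel_mul, show -2 + (0 + 2) = (0 : ℝ) by ring, symBessel_zero, mul_one,
      symLap, Real.rpow_one]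
    push_cast; ring
  -- Since u(t) ∈ Ran P and P is self-adjoint, the projection disappears from the pairing.
  have h6 : ⟪u t, force M P (u t)⟫_ℝ = 0 := by
    rw [force, inner_proj_of_mem_range hP.proj hr, toL2_convection M hcrit,
      hdiv.inner_Nl_eq_zero hcrit]
  have h7 := h1.norm_sq
  rw [inner_neg_right, inner_add_right, h5, h6, add_zero] at h7
  simpa using h7

/-- The differential identity holds only for positive times. Integrability of ‖Au‖² down to 0 comes
for free: it is the nonnegative derivative of -‖u‖²/2, which is continuous at 0. -/
theorem ContSmooth.energy (hs : ContSmooth T u)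
    (hm : IsMild T u (fun t => force M P (u t))) (hP : IsFiberedProjection P)
    (hr : ∀ t ∈ Icc 0 T, u t ∈ P.range) (hdiv : ∀ t ∈ Ioc 0 T, DivFree M (u t)) {t : ℝ}
    (ht : t ∈ Ioc 0 T) :
    IntervalIntegrable (fun s => (normA 1 (u s)).toReal ^ 2) volume 0 t ∧
      ‖u t‖ ^ 2 = ‖u 0‖ ^ 2 - 2 * ∫ s in (0 : ℝ)..t, (normA 1 (u s)).toReal ^ 2 ∧
      ‖u t‖ ≤ ‖u 0‖ := by
  have hd : ∀ s ∈ Ioo 0 t, HasDerivAt (fun t => -(1 / 2) * ‖u t‖ ^ 2)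
      ((normA 1 (u s)).toReal ^ 2) s := by
    intro s hs'
    have hsT : s ∈ Ioo 0 T := ⟨hs'.1, hs'.2.trans_le ht.2⟩
    refine ((hs.hasDerivAt_norm_sq hm hP hsT (hr s (Ioo_subset_Icc_self hsT))
      (hdiv s (Ioo_subset_Ioc_self hsT))).const_mul (-(1 / 2))).congr_deriv (by ring)
  have hc : ContinuousOn (fun t => -(1 / 2) * ‖u t‖ ^ 2) (Icc 0 t) :=
    continuousOn_const.mul ((hm.cont.mono (Icc_subset_Icc le_rfl ht.2)).norm.pow 2)
  have hi : IntervalIntegrable (fun s => (normA 1 (u s)).toReal ^ 2) volume 0 t :=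
    (intervalIntegrable_iff_integrableOn_Ioc_of_le ht.1.le).2
      (intervalIntegral.integrableOn_deriv_of_nonneg hc hd fun s _ => sq_nonneg _)
  have he := intervalIntegral.integral_eq_sub_of_hasDerivAt_of_le ht.1.le hc hd hi
  have hnn : 0 ≤ ∫ s in (0 : ℝ)..t, (normA 1 (u s)).toReal ^ 2 :=
    intervalIntegral.integral_nonneg ht.1.le fun s _ => sq_nonneg _
  refine ⟨hi, by linarith, ?_⟩
  exact (sq_le_sq₀ (norm_nonneg _) (norm_nonneg _)).1 (by linarith)

end Energy

/-! ### Dependence of the constants and conclusion -/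

section Final

variable {M : Matrix (Fin 3) (Fin 3) ℝ} {P : L2 →L[ℝ] L2} {r T : ℝ} {u : ℝ → L2}

lemma normH_mono {a b : ℝ} (h : a ≤ b) (f : L2) : normH a f ≤ normH b f :=
  multNorm_mono f (norm_symBessel_mono h)

lemma IsStrongSolution.exists_normH_le (h : IsStrongSolution M P r T u) :
    ∃ B : ℝ, 0 ≤ B ∧ ∀ t ∈ Icc 0 T, normH r (u t) ≤ ENNReal.ofReal B := by
  obtain ⟨v, hv, hc⟩ := h.continuous
  obtain ⟨B, hB⟩ := isCompact_Icc.exists_bound_of_continuousOn hc.continuousOn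
  refine ⟨|B|, abs_nonneg B, fun t ht => ?_⟩
  rw [normH, ← (hv t ht).enorm_eq, ← ofReal_norm]
  exact ENNReal.ofReal_le_ofReal ((hB t ht).trans (le_abs_self B))

theorem IsStrongSolution.exists_analyticityBounds (h : IsStrongSolution M P r T u)
    (hP : IsFiberedProjection P) (hr : 1 / 2 ≤ r) (hT : 0 < T) :
    ∃ δ : ℝ, 0 < δ ∧ ∃ C : ℝ, 0 < C ∧ AnalyticityBounds T δ C u := by
  obtain ⟨ε, hε, hmain⟩ := StrongNS.exists_analyticityBounds M hP (r := r) (by linarith)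
  obtain ⟨B, hB0, hB⟩ := h.exists_normH_le
  have hB' : ∀ t ∈ Icc 0 T, normH (1 / 2) (u t) ≤ ENNReal.ofReal B := fun t ht =>
    (normH_mono hr _).trans (hB t ht)
  obtain ⟨τ, hτ, hsmall⟩ := exists_heatSmall_of_critical
    ((hB' 0 ⟨le_rfl, hT.le⟩).trans_lt ENNReal.ofReal_lt_top) hε
  obtain ⟨δ, hδ, h1⟩ := hmain τ (critNorm T u).toReal hτ ENNReal.toReal_nonneg
  obtain ⟨C, hC, h2⟩ := h1 T B hB0
  exact ⟨δ, hδ, C, hC, h2 u hT h le_rfl hB' hsmall⟩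

/-- In the subcritical case the constants depend only on norms of the solution. -/
theorem exists_uniform_analyticityBounds (M : Matrix (Fin 3) (Fin 3) ℝ)
    (hP : IsFiberedProjection P) (hr : 1 / 2 < r) (a b : ℝ≥0∞) :
    ∃ δ : ℝ, 0 < δ ∧ ∀ (T : ℝ) (c : ℝ≥0∞), ∃ C : ℝ, 0 < C ∧ ∀ u : ℝ → L2, 0 < T →
      IsStrongSolution M P r T u → critNorm T u = a → normH r (u 0) = b →
      (⨆ t ∈ Ioc 0 T, normH (1 / 2) (u t)) = c → AnalyticityBounds T δ C u := by
  obtain ⟨ε, hε, hmain⟩ := StrongNS.exists_analyticityBounds M hP (r := r) (by linarith)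
  obtain ⟨τ, hτ, hsmall⟩ := exists_heatSmall_of_subcritical (b := b.toReal) hr
    ENNReal.toReal_nonneg hε
  obtain ⟨δ, hδ, h1⟩ := hmain τ a.toReal hτ ENNReal.toReal_nonneg
  refine ⟨δ, hδ, fun T c => ?_⟩
  -- The supremum `c` omits t = 0; there the H^(1/2) norm is bounded by the H^r norm `b`.
  obtain ⟨C, hC, h2⟩ := h1 T (max b.toReal c.toReal)
    (ENNReal.toReal_nonneg.trans (le_max_left _ _))
  refine ⟨C, hC, fun u hT h ha hb hc => ?_⟩
  obtain ⟨B, hB0, hB⟩ := h.exists_normH_le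
  have hbt : b ≠ ⊤ := hb ▸ ((hB 0 ⟨le_rfl, hT.le⟩).trans_lt ENNReal.ofReal_lt_top).ne
  have hct : c ≠ ⊤ := by
    refine ((hc ▸ iSup₂_le fun t ht => (normH_mono hr.le _).trans
      (hB t (Ioc_subset_Icc_self ht)) : c ≤ ENNReal.ofReal B).trans_lt ENNReal.ofReal_lt_top).ne
  have hb' : normH r (u 0) ≤ ENNReal.ofReal b.toReal := by rw [ENNReal.ofReal_toReal hbt, hb]
  refine h2 u hT h (by rw [ha]) (fun t ht => ?_) (hsmall _ hb')
  rcases ht.1.eq_or_lt with h0 | h0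
  · rw [← h0]
    exact ((normH_mono hr.le _).trans hb').trans (ENNReal.ofReal_le_ofReal (le_max_left _ _))
  · refine le_trans ?_ (ENNReal.ofReal_le_ofReal (le_max_right b.toReal c.toReal))
    rw [ENNReal.ofReal_toReal hct, ← hc]
    exact le_iSup₂ (f := fun t (_ : t ∈ Ioc 0 T) => normH (1 / 2) (u t)) t ⟨h0, ht.2⟩

end Final

end StrongNS

end

theorem mainTheorem10 (M : Matrix (Fin 3) (Fin 3) ℝ) (P : StrongNS.L2 →L[ℝ] StrongNS.L2)
    (hP : StrongNS.IsFiberedProjection P) (r : ℝ) (hr : 1 / 2 ≤ r) :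
    (∀ T : ℝ, 0 < T → ∀ u : ℝ → StrongNS.L2, StrongNS.IsStrongSolution M P r T u →
      (∃ δ : ℝ, 0 < δ ∧ ∃ C : ℝ, 0 < C ∧ StrongNS.AnalyticityBounds T δ C u) ∧
      (∀ k : ℕ, ∀ s : ℝ, 1 / 2 ≤ s → StrongNS.SobolevContDiffOn k s (Ioc 0 T) u) ∧
      (∃ U : ℝ × StrongNS.R3 → StrongNS.R3,
        (∀ t ∈ Ioc 0 T, ∀ᵐ x : StrongNS.R3, U (t, x) = u t x) ∧
        ContDiffOn ℝ ∞ U (Ioc 0 T ×ˢ (univ : Set StrongNS.R3))) ∧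
      ((∀ t ∈ Ioc 0 T, StrongNS.DivFree M (u t)) →
        ∀ t ∈ Ioc 0 T,
          IntervalIntegrable (fun s => (StrongNS.normA 1 (u s)).toReal ^ 2) volume 0 t ∧
          ‖u t‖ ^ 2 = ‖u 0‖ ^ 2 - 2 * ∫ s in (0 : ℝ)..t, (StrongNS.normA 1 (u s)).toReal ^ 2 ∧
          ‖u t‖ ≤ ‖u 0‖)) ∧
    (1 / 2 < r →
      ∃ (δ : ℝ≥0∞ → ℝ≥0∞ → ℝ) (C : ℝ → ℝ≥0∞ → ℝ≥0∞ → ℝ≥0∞ → ℝ),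
        (∀ a b, 0 < δ a b) ∧ (∀ T a b c, 0 < C T a b c) ∧
        ∀ T : ℝ, 0 < T → ∀ u : ℝ → StrongNS.L2, StrongNS.IsStrongSolution M P r T u →
          StrongNS.AnalyticityBounds T
            (δ (StrongNS.critNorm T u) (StrongNS.normH r (u 0)))
            (C T (StrongNS.critNorm T u) (⨆ t ∈ Ioc 0 T, StrongNS.normH (1 / 2) (u t))
              (StrongNS.normH r (u 0))) u) := by
  refine ⟨fun T hT u hu => ?_, fun hr' => ?_⟩
  · obtain ⟨δ, hδ, C, hC, hb⟩ := hu.exists_analyticityBounds hP hr hT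
    have hm := hu.isMild hP (by linarith)
    have hs := hb.contSmooth hδ hm.cont
    refine ⟨⟨δ, hδ, C, hC, hb⟩, fun k s hs0 => hs.sobolevContDiffOn hm hP k (by linarith),
      ⟨fun p => StrongNS.smoothRep (u p.1) p.2, fun t ht => ?_, hs.contDiffOn_smoothRep hm hP⟩,
      fun hdiv t ht => hs.energy hm hP hu.mem_range hdiv ht⟩
    have hae := StrongNS.smoothRep_ae_eq ((hs 2 zero_le_two).1 t ht)
    filter_upwards [hae] with x hx
    exact hx
  -- Choice turns the uniform bounds, stated for prescribed values of the norms, into functions of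
  -- these norms.
  · choose δ hδ C hC hb using StrongNS.exists_uniform_analyticityBounds M hP hr'
    exact ⟨δ, fun T a c b => C a b T c, hδ, fun T a c b => hC a b T c,
      fun T hT u hu => hb _ _ T _ u hT hu rfl rfl rfl⟩
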